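/- **Notation.** Let $\mathbb K$ be a commutative ring and let $B$ be a finite set with an involution $b\mapsto b^*$. *The bialgebra $\mathscr F(\mathbb KB)$.* For $n\ge 0$, an element of $B\wr\mathfrak S_n$ is a pair $(b_1,\dots,b_n;\sigma)$ with $b_i\in B$ and $\sigma\in\mathfrak S_n$; for $\pi\in\mathfrak S_n$ put $\pi\cdot(b_1,\dots,b_n;\sigma)=(b_{\pi^{-1}(1)},\dots,b_{\pi^{-1}(n)};\pi\sigma)$, and let $e_n$ be the unit of $\mathfrak S_n$. Let $\mathscr F_n$ be the free $\mathbb K$-module with basis $B\wr\mathfrak S_n$ and $\mathscr F(\mathbb KB)=\bigoplus_{n\ge0}\mathscr F_n$. The product is $$(b_1,\dots,b_n;\sigma)*(b'_1,\dots,b'_m;\sigma')=\sum_{\rho}\rho\cdot(b_1,\dots,b_n,b'_1,\dots,b'_m;\sigma\times\sigma'),$$ the sum being over all $\rho\in\mathfrak S_{n+m}$ that are increasing on $\{1,\dots,n\}$ and on $\{n+1,\dots,n+m\}$. The coproduct is $$\Delta(b_1,\dots,b_n;\sigma)=\sum_{k=0}^n(b_1,\dots,b_k;\pi_k)\otimes(b_{k+1},\dots,b_n;\pi'_k),$$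 where $\pi_k$ and $\pi'_k$ are the inverses of the standardisations of the words $\sigma^{-1}(1)\cdots\sigma^{-1}(k)$ and $\sigma^{-1}(k+1)\cdots\sigma^{-1}(n)$. The counit is the projection onto $\mathscr F_0=\mathbb K$. This makes $\mathscr F(\mathbb KB)$ a graded bialgebra. For $\alpha=(b_1,\dots,b_n;\sigma)$ let $\alpha^*=\sigma^{-1}\cdot(b_1^*,\dots,b_n^*;e_n)$, and let $\varpi_{\rm tot}$ be the bilinear form on $\mathscr F(\mathbb KB)$ with $\varpi_{\rm tot}(\alpha,\beta)=1$ if $\beta=\alpha^*$ and $0$ otherwise, for all basis elements $\alpha,\beta$. For a submodule $S$ let $S^\circ$ be its orthogonal with respect to $\varpi_{\rm tot}$. *The algebra $\mathscr D(B)$.* For $n\ge1$ and $b\in B$ put $y_{n,b}=(b,\dots,b;e_n)\in\mathscr F_n$. The Mantaci–Reutenauer algebra $\mathscr D(B)$ is the subalgebra of $\mathscr F(\mathbb KB)$ generated by all $y_{n,b}$. *The module $\mathscr Q(B)$.* A standard $B$-tableau is a family $\mathbf T=(T_b)_{b\in B}$ of tableaux, increasing along rows and columns, in whose boxes the labels $1,\dots,n$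 are used once each in total, where $n$ is the total number of boxes; its shape $\mathrm{sh}(\mathbf T)$ is the family of partitions $(\mathrm{sh}(T_b))_{b\in B}$. Given $\alpha=\sigma\cdot(b_1,\dots,b_n;e_n)$ in $B\wr\mathfrak S_n$, the record tableau $\mathbf Q(\alpha)=(Q_b)_{b\in B}$ is obtained as follows: for each $b$, insert successively by Schensted row insertion the letters $\sigma(j)$ for those $j$, in increasing order, with $b_j=b$; the label of a box of $Q_b$ is the index $j$ at which this box appears. Put $t_{\mathbf T}=\sum\alpha$, the sum being over the $\alpha\in B\wr\mathfrak S_n$ with $\mathbf Q(\alpha)=\mathbf T$, and let $\mathscr Q(B)$ be the $\mathbb K$-span of all $t_{\mathbf T}$. *The bialgebra $\Lambda(B)$.* Let $\Lambda$ be the graded bialgebra of symmetric functions over $\mathbb K$ (with the coproduct $f\mapsto f(x,y)$), with complete symmetric functions $h_n$ and Schur functions $s_\lambda$. Let $\Lambda(B)=\bigotimes_{b\in B}\Lambda(b)$ be the tensor product of copies $\Lambda(b)$ of $\Lambda$; write $f(b)$ for the image of $f\in\Lambda$ in $\Lambda(b)$. For a family $\boldsymbol\lambda=(\lambda_b)_{b\in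 B}$ of partitions put $\mathbf s_{\boldsymbol\lambda}=\prod_{b\in B}s_{\lambda_b}(b)$ and $\boldsymbol\lambda^*=(\lambda_{b^*})_{b\in B}$. Let $\langle\ ,\ \rangle$ be the bilinear form on $\Lambda(B)$ with $\langle\mathbf s_{\boldsymbol\lambda},\mathbf s_{\boldsymbol\mu}\rangle=1$ if $\boldsymbol\mu=\boldsymbol\lambda^*$ and $0$ otherwise. **Theorem.** $\mathscr Q(B)$ is a graded subbialgebra of $\mathscr F(\mathbb KB)$ that contains $\mathscr D(B)$, and the assignment $t_{\mathbf T}\mapsto\mathbf s_{\mathrm{sh}(\mathbf T)}$, for all standard $B$-tableaux $\mathbf T$, defines a $\mathbb K$-linear map $\Theta_B:\mathscr Q(B)\to\Lambda(B)$ that is a surjective morphism of graded bialgebras with kernel $\mathscr Q(B)\cap\mathscr Q(B)^\circ$. It is compatible with the pairings: $$\varpi_{\rm tot}(x,y)=\langle\Theta_B(x),\Theta_B(y)\rangle\qquad\text{for all }x,y\in\mathscr Q(B).$$ The restriction of $\Theta_B$ to $\mathscr D(B)$ is the unique algebra homomorphism $\mathscr D(B)\to\Lambda(B)$ that maps $y_{n,b}$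 to $h_n(b)$ for all $n\ge1$ and $b\in B$; this restriction is also surjective, with kernel $\mathscr D(B)\cap\mathscr D(B)^\circ$. -/

import Mathlib

open scoped TensorProduct

/-- Words over `L` with coefficients in `K`; carries the shuffle product. -/
def ShuffleAlg (K L : Type*) [CommRing K] : Type _ := List L →₀ K

namespace ShuffleAlg

noncomputable section

variable {K L : Type*} [CommRing K]

instance : AddCommGroup (ShuffleAlg K L) := inferInstanceAs (AddCommGroup (List L →₀ K))
instance : Module K (ShuffleAlg K L) := inferInstanceAs (Module K (List L →₀ K))

/-- The basis of words. -/
def basis : Module.Basis (List L) K (ShuffleAlg K L) := Finsupp.basisSingleOne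

/-- The word `w`, as an element of the algebra. -/
def wd (w : List L) : ShuffleAlg K L := basis w

/-- All shuffles of two words, as a list of words. -/
def sh : List L → List L → List (List L)
  | [], v => [v]
  | a :: u, [] => [a :: u]
  | a :: u, b :: v => (sh u (b :: v)).map (List.cons a) ++ (sh (a :: u) v).map (List.cons b)
termination_by u v => u.length + v.length

variable (K) in
/-- The linear map induced by a map between words. -/
def mapW {L' : Type*} (f : List L → List L') : ShuffleAlg K L →ₗ[K] ShuffleAlg K L' :=
  basis.constr K fun w => wd (f w)

@[simp] theorem mapW_wd {L' : Type*} (f : List L → List L') (w : List L) :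
    mapW K f (wd w) = wd (f w) := by simp [mapW, wd]

theorem hom_ext {M : Type*} [AddCommMonoid M] [Module K M] {f g : ShuffleAlg K L →ₗ[K] M}
    (h : ∀ w, f (wd w) = g (wd w)) : f = g := basis.ext h

/-- The shuffle product. -/
def mulMap : ShuffleAlg K L →ₗ[K] ShuffleAlg K L →ₗ[K] ShuffleAlg K L :=
  basis.constr K fun u => basis.constr K fun v => ((sh u v).map wd).sum

instance : Mul (ShuffleAlg K L) := ⟨fun x y => mulMap x y⟩
instance : One (ShuffleAlg K L) := ⟨wd []⟩

theorem mul_eq (x y : ShuffleAlg K L) : x * y = mulMap x y := rfl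
theorem one_eq : (1 : ShuffleAlg K L) = wd [] := rfl

theorem wd_mul (u v : List L) : (wd u * wd v : ShuffleAlg K L) = ((sh u v).map wd).sum := by
  simp [mul_eq, mulMap, wd]

variable (K) in
/-- Prefixing a letter. -/
def cn (a : L) : ShuffleAlg K L →ₗ[K] ShuffleAlg K L := mapW K (List.cons a)

@[simp] theorem cn_wd (a : L) (w : List L) : cn K a (wd w) = wd (a :: w) := mapW_wd _ _

theorem sum_map_cons (a : L) (l : List (List L)) :
    ((l.map (List.cons a)).map (wd (K := K))).sum = cn K a ((l.map wd).sum) := by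
  induction l with
  | nil => simp
  | cons x l ih =>
    simp only [List.map_cons, List.sum_cons, map_add, cn_wd]
    rw [ih]

theorem cn_mul_cn (a b : L) (x y : ShuffleAlg K L) :
    cn K a x * cn K b y = cn K a (x * cn K b y) + cn K b (cn K a x * y) := by
  have : (mulMap.compl₁₂ (cn K a) (cn K b) : ShuffleAlg K L →ₗ[K] _ →ₗ[K] _) =
      (mulMap.compl₂ (cn K b)).compr₂ (cn K a) + (mulMap.comp (cn K a)).compr₂ (cn K b) := by
    refine hom_ext fun u => hom_ext fun v => ?_
    simp only [LinearMap.compl₁₂_apply, LinearMap.add_apply, LinearMap.compr₂_apply,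
      LinearMap.compl₂_apply, LinearMap.comp_apply, cn_wd, ← mul_eq, wd_mul]
    rw [sh]
    simp only [List.map_append, List.sum_append, sum_map_cons]
  exact LinearMap.congr_fun (LinearMap.congr_fun this x) y

theorem sone_mul (x : ShuffleAlg K L) : 1 * x = x := by
  have : (mulMap (wd []) : ShuffleAlg K L →ₗ[K] _) = LinearMap.id := hom_ext fun u => by
    rw [← mul_eq, wd_mul]; simp [sh]
  exact LinearMap.congr_fun this x

theorem mul_sone (x : ShuffleAlg K L) : x * 1 = x := by
  have : (mulMap.flip (wd []) : ShuffleAlg K L →ₗ[K] _) = LinearMap.id := hom_ext fun u => by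
    rw [LinearMap.flip_apply, ← mul_eq, wd_mul]; cases u <;> simp [sh]
  exact LinearMap.congr_fun this x

theorem mul_assoc_wd : ∀ u v w : List L,
    (wd u * wd v * wd w : ShuffleAlg K L) = wd u * (wd v * wd w)
  | [], v, w => by rw [← one_eq, sone_mul, sone_mul]
  | a :: u, [], w => by rw [← one_eq, sone_mul, mul_sone]
  | a :: u, b :: v, [] => by rw [← one_eq, mul_sone, mul_sone]
  | a :: u, b :: v, c :: w => by
    have h1 := mul_assoc_wd u (b :: v) (c :: w)
    have h2 := mul_assoc_wd (a :: u) v (c :: w)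
    have h3 := mul_assoc_wd (a :: u) (b :: v) w
    simp only [← cn_wd] at h1 h2 h3 ⊢
    have e1 : ∀ x y z : ShuffleAlg K L, (x + y) * z = x * z + y * z := fun x y z => by
      simp [mul_eq]
    have e2 : ∀ x y z : ShuffleAlg K L, x * (y + z) = x * y + x * z := fun x y z => by
      simp [mul_eq]
    rw [cn_mul_cn a b, cn_mul_cn b c, e1, e2, cn_mul_cn a c, cn_mul_cn b c, cn_mul_cn a b,
      cn_mul_cn a c, h1, h2]
    have h3' := h3
    rw [cn_mul_cn a b, e1] at h3'
    have h4 : cn K a (wd u * (cn K b (wd v) * cn K c (wd w))) =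
        cn K a (wd u * cn K b (wd v * cn K c (wd w))) +
        cn K a (wd u * cn K c (cn K b (wd v) * wd w)) := by
      rw [cn_mul_cn b c, e2, map_add]
    rw [h4]
    have h5 : cn K c (cn K a (wd u * cn K b (wd v)) * wd w) +
        cn K c (cn K b (cn K a (wd u) * wd v) * wd w) =
        cn K c (cn K a (wd u) * (cn K b (wd v) * wd w)) := by
      rw [← map_add, h3']
    rw [← h5]; abel
termination_by u v w => u.length + v.length + w.length

theorem ind {p : ShuffleAlg K L → Prop} (x : ShuffleAlg K L) (h0 : p 0)
    (hw : ∀ w, p (wd w)) (ha : ∀ x y, p x → p y → p (x + y))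
    (hs : ∀ (c : K) x, p x → p (c • x)) : p x := by
  have hx : x ∈ Submodule.span K (Set.range (basis (K := K) (L := L))) := by
    rw [basis.span_eq]; trivial
  induction hx using Submodule.span_induction with
  | mem x h => obtain ⟨w, rfl⟩ := h; exact hw w
  | zero => exact h0
  | add x y _ _ hx hy => exact ha x y hx hy
  | smul c x _ hx => exact hs c x hx

instance : Ring (ShuffleAlg K L) where
  __ := (inferInstance : AddCommGroup (ShuffleAlg K L))
  left_distrib x y z := by simp [mul_eq]
  right_distrib x y z := by simp [mul_eq]
  zero_mul x := by simp [mul_eq]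
  mul_zero x := by simp [mul_eq]
  one_mul := sone_mul
  mul_one := mul_sone
  mul_assoc x y z := by
    induction x using ind with
    | h0 => simp [mul_eq]
    | ha x x' h h' => simp_all [mul_eq]
    | hs c x h => simp_all [mul_eq]
    | hw u =>
    induction y using ind with
    | h0 => simp [mul_eq]
    | ha x x' h h' => simp_all [mul_eq]
    | hs c x h => simp_all [mul_eq]
    | hw v =>
    induction z using ind with
    | h0 => simp [mul_eq]
    | ha x x' h h' => simp_all [mul_eq]
    | hs c x h => simp_all [mul_eq]
    | hw w => exact mul_assoc_wd u v w

instance : Algebra K (ShuffleAlg K L) :=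
  Algebra.ofModule (fun r x y => by simp [mul_eq]) (fun r x y => by simp [mul_eq])

/-- Deconcatenation. -/
def dc : ShuffleAlg K L →ₗ[K] ShuffleAlg K L ⊗[K] ShuffleAlg K L :=
  basis.constr K fun w => ∑ k ∈ Finset.range (w.length + 1), wd (w.take k) ⊗ₜ wd (w.drop k)

theorem dc_wd (w : List L) : dc (wd w : ShuffleAlg K L) =
    ∑ k ∈ Finset.range (w.length + 1), wd (w.take k) ⊗ₜ wd (w.drop k) := by simp [dc, wd]

variable (K) in
/-- Prefixing a letter in the left factor. -/
def cn2 (a : L) : ShuffleAlg K L ⊗[K] ShuffleAlg K L →ₗ[K] ShuffleAlg K L ⊗[K] ShuffleAlg K L :=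
  TensorProduct.map (cn K a) LinearMap.id

theorem dc_nil : dc (wd [] : ShuffleAlg K L) = 1 ⊗ₜ wd [] := by
  rw [dc_wd]; simp [one_eq]

theorem dc_cn (a : L) (x : ShuffleAlg K L) :
    dc (cn K a x) = 1 ⊗ₜ cn K a x + cn2 K a (dc x) := by
  have : dc.comp (cn K a) = (TensorProduct.mk K _ _ 1).comp (cn K a) + (cn2 K a).comp dc :=
    hom_ext fun w => by
      simp only [LinearMap.comp_apply, LinearMap.add_apply, TensorProduct.mk_apply, cn_wd, dc_wd,
        List.length_cons, map_sum]
      rw [Finset.sum_range_succ']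
      simp [cn2, one_eq, add_comm]
  exact LinearMap.congr_fun this x

theorem cn2_mul_cn2 (a b : L) (x y : ShuffleAlg K L ⊗[K] ShuffleAlg K L) :
    cn2 K a x * cn2 K b y = cn2 K a (x * cn2 K b y) + cn2 K b (cn2 K a x * y) := by
  induction x with
  | zero => simp
  | add x x' h h' => simp only [map_add, add_mul, h, h']; abel
  | tmul x1 x2 =>
  induction y with
  | zero => simp
  | add x x' h h' => simp only [map_add, mul_add, h, h']; abel
  | tmul y1 y2 =>
    simp [cn2, Algebra.TensorProduct.tmul_mul_tmul, cn_mul_cn, TensorProduct.add_tmul]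

theorem cn2_mul_one_tmul (a : L) (x : ShuffleAlg K L ⊗[K] ShuffleAlg K L) (y : ShuffleAlg K L) :
    cn2 K a x * (1 ⊗ₜ y) = cn2 K a (x * (1 ⊗ₜ y)) := by
  induction x with
  | zero => simp
  | add x x' h h' => simp only [map_add, add_mul, h, h']
  | tmul x1 x2 => simp [cn2]

theorem one_tmul_mul_cn2 (a : L) (x : ShuffleAlg K L ⊗[K] ShuffleAlg K L) (y : ShuffleAlg K L) :
    (1 ⊗ₜ y) * cn2 K a x = cn2 K a ((1 ⊗ₜ y) * x) := by
  induction x with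
  | zero => simp
  | add x x' h h' => simp only [map_add, mul_add, h, h']
  | tmul x1 x2 => simp [cn2]

theorem dc_mul_wd : ∀ u v : List L,
    dc (wd u * wd v : ShuffleAlg K L) = dc (wd u) * dc (wd v)
  | [], v => by
    rw [dc_nil, ← one_eq, one_mul, ← Algebra.TensorProduct.one_def, one_mul]
  | a :: u, [] => by
    rw [dc_nil, ← one_eq, mul_one, ← Algebra.TensorProduct.one_def, mul_one]
  | a :: u, b :: v => by
    have h1 := dc_mul_wd u (b :: v)
    have h2 := dc_mul_wd (a :: u) v
    simp only [← cn_wd] at h1 h2 ⊢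
    rw [cn_mul_cn, map_add, dc_cn a (wd u * _), dc_cn b (_ * wd v), h1, h2, dc_cn a, dc_cn b,
      add_mul, add_mul, mul_add, mul_add, mul_add, cn2_mul_cn2, cn2_mul_one_tmul, one_tmul_mul_cn2]
    simp only [map_add, Algebra.TensorProduct.tmul_mul_tmul, one_mul,
      cn_mul_cn a b (wd u), TensorProduct.tmul_add]
    abel
termination_by u v => u.length + v.length

theorem dc_mul (x y : ShuffleAlg K L) : dc (x * y) = dc x * dc y := by
  induction x using ind with
  | h0 => simp
  | ha x x' h h' => simp_all [add_mul]
  | hs c x h => rw [smul_mul_assoc, map_smul, map_smul, h, smul_mul_assoc]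
  | hw u =>
  induction y using ind with
  | h0 => simp
  | ha x x' h h' => simp_all [mul_add]
  | hs c x h => rw [mul_smul_comm, map_smul, map_smul, h, mul_smul_comm]
  | hw v => exact dc_mul_wd u v

theorem dc_coassoc (w : List L) :
    TensorProduct.assoc K _ _ _ (TensorProduct.map dc LinearMap.id (dc (wd w : ShuffleAlg K L))) =
      TensorProduct.map LinearMap.id dc (dc (wd w : ShuffleAlg K L)) := by
  induction w with
  | nil => simp [dc_nil, one_eq]
  | cons a w ih =>
    have h1 : ∀ z : ShuffleAlg K L ⊗[K] ShuffleAlg K L,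
        TensorProduct.assoc K _ _ _ (TensorProduct.map dc LinearMap.id (cn2 K a z)) =
        1 ⊗ₜ cn2 K a z + TensorProduct.map (cn K a) LinearMap.id
          (TensorProduct.assoc K _ _ _ (TensorProduct.map dc LinearMap.id z)) := by
      intro z
      induction z with
      | zero => simp
      | add x y hx hy => simp only [map_add, hx, hy, TensorProduct.tmul_add]; abel
      | tmul x y =>
        simp only [cn2, TensorProduct.map_tmul, LinearMap.id_apply, dc_cn, TensorProduct.add_tmul,
          map_add, TensorProduct.assoc_tmul]
        congr 1
        generalize dc x = t
        induction t with
        | zero => simp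
        | add x y hx hy => simp only [map_add, TensorProduct.add_tmul, hx, hy]
        | tmul x y => simp
    have h2 : ∀ z : ShuffleAlg K L ⊗[K] ShuffleAlg K L,
        TensorProduct.map LinearMap.id dc (cn2 K a z) =
        TensorProduct.map (cn K a) LinearMap.id (TensorProduct.map LinearMap.id dc z) := by
      intro z
      induction z with
      | zero => simp
      | add x y hx hy => simp only [map_add, hx, hy]
      | tmul x y => simp [cn2]
    rw [← cn_wd, dc_cn, map_add, map_add, map_add, h1, h2, ih]
    simp only [TensorProduct.map_tmul, LinearMap.id_apply, dc_cn, one_eq, dc_nil,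
      TensorProduct.assoc_tmul, TensorProduct.tmul_add]
    abel

end
end ShuffleAlg

namespace ShuffleAlg

noncomputable section

variable {K L : Type*} [CommRing K]

theorem sh_map {L' : Type*} (f : L → L') : ∀ u v : List L,
    sh (u.map f) (v.map f) = (sh u v).map (List.map f)
  | [], v => by simp [sh]
  | a :: u, [] => by simp [sh]
  | a :: u, b :: v => by
    have h1 := sh_map f u (b :: v)
    have h2 := sh_map f (a :: u) v
    simp only [List.map_cons] at h1 h2 ⊢
    rw [sh, sh, h1, h2]
    simp [Function.comp_def]
termination_by u v => u.length + v.length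

theorem mapW_list_sum {L' : Type*} (f : List L → List L') (l : List (List L)) :
    mapW K f (l.map wd).sum = ((l.map f).map wd).sum := by
  induction l with
  | nil => simp
  | cons x l ih => simp only [List.map_cons, List.sum_cons, map_add, mapW_wd, ih]

theorem mapW_mul {L' : Type*} (f : L → L') (x y : ShuffleAlg K L) :
    mapW K (List.map f) (x * y) = mapW K (List.map f) x * mapW K (List.map f) y := by
  induction x using ind with
  | h0 => simp
  | ha x x' h h' => simp_all [add_mul]
  | hs c x h => rw [smul_mul_assoc, map_smul, map_smul, h, smul_mul_assoc]
  | hw u =>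
  induction y using ind with
  | h0 => simp
  | ha x x' h h' => simp_all [mul_add]
  | hs c x h => rw [mul_smul_comm, map_smul, map_smul, h, mul_smul_comm]
  | hw v => rw [mapW_wd, mapW_wd, wd_mul, wd_mul, sh_map, mapW_list_sum]

theorem sh_perm : ∀ {u v w : List L}, w ∈ sh u v → w.Perm (u ++ v)
  | [], v, w, h => by simp_all [sh]
  | a :: u, [], w, h => by simp_all [sh]
  | a :: u, b :: v, w, h => by
    rw [sh, List.mem_append, List.mem_map, List.mem_map] at h
    rcases h with ⟨w', h, rfl⟩ | ⟨w', h, rfl⟩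
    · exact (sh_perm h).cons a
    · exact ((sh_perm h).cons b).trans List.perm_middle.symm
termination_by u v => u.length + v.length

theorem sh_sublist : ∀ {u v w : List L}, w ∈ sh u v → u.Sublist w ∧ v.Sublist w
  | [], v, w, h => by simp_all [sh]
  | a :: u, [], w, h => by simp_all [sh]
  | a :: u, b :: v, w, h => by
    rw [sh, List.mem_append, List.mem_map, List.mem_map] at h
    rcases h with ⟨w', h, rfl⟩ | ⟨w', h, rfl⟩
    · exact ⟨(sh_sublist h).1.cons_cons a, (sh_sublist h).2.cons a⟩
    · exact ⟨(sh_sublist h).1.cons b, (sh_sublist h).2.cons_cons b⟩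
termination_by u v => u.length + v.length

theorem sh_nodup : ∀ {u v : List L}, (u ++ v).Nodup → (sh u v).Nodup
  | [], v, h => by simp [sh]
  | a :: u, [], h => by simp [sh]
  | a :: u, b :: v, h => by
    rw [sh]
    have h1 : (sh u (b :: v)).Nodup := sh_nodup (List.Nodup.of_cons h)
    have h2 : (sh (a :: u) v).Nodup :=
      sh_nodup (h.sublist (List.Sublist.append_left (List.sublist_cons_self b v) _))
    refine List.Nodup.append (h1.map (List.cons_injective)) (h2.map (List.cons_injective)) ?_
    intro w hw hw'
    rw [List.mem_map] at hw hw'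
    obtain ⟨x, -, rfl⟩ := hw
    obtain ⟨y, -, hy⟩ := hw'
    have : b = a := (List.cons.inj hy).1
    subst this
    simp at h
termination_by u v => u.length + v.length

theorem mem_sh_of_sublist : ∀ {w u v : List L}, w.Nodup → w.Perm (u ++ v) → u.Sublist w →
    v.Sublist w → w ∈ sh u v
  | w, [], v, hn, hp, hu, hv => by
    have := hv.eq_of_length (by simpa using hp.length_eq.symm)
    simp [sh, this]
  | w, a :: u, [], hn, hp, hu, hv => by
    have := hu.eq_of_length (by simpa using hp.length_eq.symm)
    subst this
    simp [sh]
  | [], a :: u, b :: v, hn, hp, hu, hv => by simp at hu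
  | c :: w, a :: u, b :: v, hn, hp, hu, hv => by
    have hd : (a :: u ++ b :: v).Nodup := hp.nodup_iff.1 hn
    rw [sh, List.mem_append, List.mem_map, List.mem_map]
    have hc : c ∉ w := (List.nodup_cons.1 hn).1
    have hw := (List.nodup_cons.1 hn).2
    have hcm : c ∈ a :: u ++ b :: v := hp.subset (by simp)
    rcases List.mem_append.1 hcm with hca | hcb
    · left
      cases hu with
      | cons _ h => exact absurd (h.subset hca) hc
      | cons_cons _ h =>
        refine ⟨w, mem_sh_of_sublist hw (List.Perm.cons_inv hp) h ?_, rfl⟩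
        cases hv with
        | cons _ h => exact h
        | cons_cons _ h => simp at hd
    · right
      cases hv with
      | cons _ h => exact absurd (h.subset hcb) hc
      | cons_cons _ h =>
        refine ⟨w, mem_sh_of_sublist hw (List.Perm.cons_inv (hp.trans List.perm_middle)) ?_ h, rfl⟩
        cases hu with
        | cons _ h => exact h
        | cons_cons _ h => simp at hd

/-! Standardisation of words in the letters `ℕ × B`. -/

variable {B : Type*}

/-- Replace the value of a letter by the number of letters of `w` that have a smaller value. -/
def rk (w : List (ℕ × B)) (x : ℕ × B) : ℕ × B := (w.countP (fun y => y.1 < x.1), x.2)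

/-- Standardisation of a word. -/
def st (w : List (ℕ × B)) : List (ℕ × B) := w.map (rk w)

/-- Shift the values of a word. -/
def sf (n : ℕ) (x : ℕ × B) : ℕ × B := (n + x.1, x.2)

theorem st_map_of_strictMono (w : List (ℕ × B)) (g : ℕ × B → ℕ × B)
    (h2 : ∀ x, (g x).2 = x.2)
    (h : ∀ x ∈ w, ∀ y ∈ w, ((g x).1 < (g y).1 ↔ x.1 < y.1)) : st (w.map g) = st w := by
  rw [st, st, List.map_map]
  refine List.map_congr_left fun x hx => ?_
  simp only [Function.comp_apply, rk, h2, List.countP_map]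
  congr 1
  refine List.countP_congr fun y hy => ?_
  simpa using h y hy x hx

theorem rk_lt_iff (w : List (ℕ × B)) {x y : ℕ × B} (hx : x ∈ w) (hy : y ∈ w) :
    (rk w x).1 < (rk w y).1 ↔ x.1 < y.1 := by
  have key : ∀ {x y : ℕ × B}, x.1 ≤ y.1 → (rk w x).1 ≤ (rk w y).1 := fun {x y} h =>
    List.countP_mono_left fun z _ hz => by simp at hz ⊢; omega
  constructor
  · intro h
    by_contra h'
    exact absurd (key (not_lt.1 h')) (by omega)
  · intro h
    obtain ⟨s, t, rfl⟩ := List.append_of_mem hx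
    simp only [rk, List.countP_append, List.countP_cons]
    have a1 : s.countP (fun z => decide (z.1 < x.1)) ≤ s.countP (fun z => decide (z.1 < y.1)) :=
      List.countP_mono_left fun z _ hz => by simp at hz ⊢; omega
    have a2 : t.countP (fun z => decide (z.1 < x.1)) ≤ t.countP (fun z => decide (z.1 < y.1)) :=
      List.countP_mono_left fun z _ hz => by simp at hz ⊢; omega
    simp [h]
    omega

theorem st_map_rk (w u : List (ℕ × B)) (h : u ⊆ w) : st (u.map (rk w)) = st u :=
  st_map_of_strictMono u _ (fun _ => rfl) fun _ hx _ hy => rk_lt_iff w (h hx) (h hy)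

variable (K B) in
/-- The linear extension of standardisation. -/
def S : ShuffleAlg K (ℕ × B) →ₗ[K] ShuffleAlg K (ℕ × B) := mapW K st

theorem dc_S (x : ShuffleAlg K (ℕ × B)) : TensorProduct.map (S K B) (S K B) (dc (S K B x)) =
    TensorProduct.map (S K B) (S K B) (dc x) := by
  have : (TensorProduct.map (S K B) (S K B) ∘ₗ dc) ∘ₗ S K B =
      TensorProduct.map (S K B) (S K B) ∘ₗ dc := hom_ext fun w => by
    simp only [LinearMap.comp_apply, S, mapW_wd, dc_wd, map_sum, TensorProduct.map_tmul]
    have hl : (st w).length = w.length := by simp [st]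
    rw [hl]
    refine Finset.sum_congr rfl fun k _ => ?_
    have he : st w = w.map (rk w) := rfl
    simp only [he, ← List.map_take, ← List.map_drop]
    rw [st_map_rk w _ (List.take_subset _ _), st_map_rk w _ (List.drop_subset _ _)]
  exact LinearMap.congr_fun this x

/-- Standardisation of a shuffle of two words, the first having the smaller values. -/
theorem S_mul (u v : List (ℕ × B)) (h : ∀ x ∈ u, ∀ y ∈ v, x.1 < y.1) :
    S K B (wd u * wd v) = wd (st u) * wd ((st v).map (sf u.length)) := by
  have hu : st u = u.map (rk (u ++ v)) := List.map_congr_left fun x hx => by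
    simp only [rk, List.countP_append]
    rw [(List.countP_eq_zero (l := v)).2 fun y hy => by simpa using (h x hx y hy).le]
    rfl
  have hv : (st v).map (sf u.length) = v.map (rk (u ++ v)) := by
    rw [st, List.map_map]
    refine List.map_congr_left fun y hy => ?_
    simp only [rk, List.countP_append, Function.comp_apply, sf]
    rw [(List.countP_eq_length (l := u)).2 fun x hx => by simpa using h x hx y hy]
  rw [hu, hv, wd_mul, wd_mul, sh_map, S, mapW_list_sum]
  congr 2
  refine List.map_congr_left fun w hw => ?_
  rw [st]
  refine List.map_congr_left fun x _ => ?_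
  simp only [rk]
  rw [(sh_perm hw).countP_eq]

end
end ShuffleAlg

/-- An element `(b₁, …, bₙ; σ)` of `B ≀ 𝔖ₙ` (with indices starting at `0`). -/
@[ext] structure ColPerm (B : Type*) (n : ℕ) where
  /-- the letters `b₁, …, bₙ` -/
  colour : Fin n → B
  /-- the permutation `σ` -/
  perm : Equiv.Perm (Fin n)

namespace ColPerm

noncomputable section

variable {B : Type*} {n m : ℕ}

instance [Fintype B] : Fintype (ColPerm B n) := by
  classical
  exact Fintype.ofEquiv ((Fin n → B) × Equiv.Perm (Fin n))
    ⟨fun p => ⟨p.1, p.2⟩, fun α => (α.colour, α.perm), fun _ => rfl, fun _ => rfl⟩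

/-- The left action `π · (b₁, …, bₙ; σ) = (b_{π⁻¹(1)}, …, b_{π⁻¹(n)}; πσ)`. -/
def act (π : Equiv.Perm (Fin n)) (α : ColPerm B n) : ColPerm B n :=
  ⟨fun i => α.colour (π.symm i), π * α.perm⟩

/-- The element `(b₁, …, bₙ, b'₁, …, b'ₘ; σ × σ')`. -/
def juxt (α : ColPerm B n) (β : ColPerm B m) : ColPerm B (n + m) :=
  ⟨Fin.append α.colour β.colour, finSumFinEquiv.permCongr (Equiv.sumCongr α.perm β.perm)⟩

/-- The set `X_{(n,m)}` of permutations that are increasing on the first `n` and on the last `m`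
elements. -/
def X (n m : ℕ) : Finset (Equiv.Perm (Fin (n + m))) := by
  classical
  exact Finset.univ.filter fun ρ =>
    StrictMono (ρ ∘ Fin.castAdd m) ∧ StrictMono (ρ ∘ Fin.natAdd n)

/-- The element `(b₁, …, b_k; π)`, where `π` is the inverse of the standardisation of
`σ⁻¹(1) ⋯ σ⁻¹(k)`. (The standardisation of a word `f` is `(Tuple.sort f)⁻¹`.) -/
def low (α : ColPerm B n) (k : ℕ) (h : k ≤ n) : ColPerm B k :=
  ⟨fun i => α.colour (Fin.castLE h i), Tuple.sort fun i => α.perm.symm (Fin.castLE h i)⟩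

/-- The element `(b_{k+1}, …, b_n; π')`, where `π'` is the inverse of the standardisation of
`σ⁻¹(k+1) ⋯ σ⁻¹(n)`. -/
def high (α : ColPerm B n) (k : ℕ) (h : k ≤ n) : ColPerm B (n - k) :=
  ⟨fun i => α.colour ⟨k + i, by omega⟩, Tuple.sort fun i => α.perm.symm ⟨k + i, by omega⟩⟩

/-- The word `(σ⁻¹(1), b₁) ⋯ (σ⁻¹(n), bₙ)`. -/
def word (α : ColPerm B n) : List (ℕ × B) := List.ofFn fun i => ((α.perm.symm i : ℕ), α.colour i)

@[simp] theorem length_word (α : ColPerm B n) : α.word.length = n := by simp [word]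

theorem word_injective : Function.Injective fun α : Σ n, ColPerm B n => α.2.word := by
  rintro ⟨n, α⟩ ⟨m, β⟩ h
  have hnm : n = m := by simpa using congrArg List.length h
  subst hnm
  have h' := List.ofFn_injective h
  congr 1
  ext1
  · funext i; exact congrArg Prod.snd (congrFun h' i)
  · rw [← Equiv.symm_bijective.injective.eq_iff]
    ext i; exact congrArg Prod.fst (congrFun h' i)

theorem lt_of_mem_word {α : ColPerm B n} {x : ℕ × B} (h : x ∈ α.word) : x.1 < n := by
  rw [word, List.mem_ofFn] at h
  obtain ⟨i, rfl⟩ := h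
  exact (α.perm.symm i).2

open ShuffleAlg

theorem rank_sort {f : Fin n → ℕ} (hf : Function.Injective f) (i : Fin n) :
    (((Tuple.sort f).symm i : Fin n) : ℕ) = (Finset.univ.filter fun j => f j < f i).card := by
  have hm : StrictMono (f ∘ Tuple.sort f) :=
    (Tuple.monotone_sort f).strictMono_of_injective (hf.comp (Equiv.injective _))
  obtain ⟨j, rfl⟩ := (Tuple.sort f).surjective i
  rw [Equiv.symm_apply_apply, ← Fin.card_Iio j]
  refine Finset.card_bij (fun a _ => Tuple.sort f a) (fun a ha => ?_)
    (fun _ _ _ _ h => (Tuple.sort f).injective h) (fun b hb => ?_)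
  · simpa using hm (Finset.mem_Iio.1 ha)
  · obtain ⟨a, rfl⟩ := (Tuple.sort f).surjective b
    exact ⟨a, by simpa using hm.lt_iff_lt.1 (Finset.mem_filter.1 hb).2, rfl⟩

theorem countP_ofFn {A : Type*} (f : Fin n → A) (p : A → Bool) :
    (List.ofFn f).countP p = (Finset.univ.filter fun i => p (f i) = true).card := by
  rw [List.ofFn_eq_map, List.countP_map, List.countP_eq_length_filter, Finset.card_def,
    ← Multiset.coe_card]
  simp [Finset.filter, Function.comp_def, Fin.univ_def]

theorem word_sort (c : Fin n → B) {f : Fin n → ℕ} (hf : Function.Injective f) :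
    word ⟨c, Tuple.sort f⟩ = st (List.ofFn fun i => (f i, c i)) := by
  rw [st, List.map_ofFn, word]
  congr 1
  funext i
  simp [rk, rank_sort hf, countP_ofFn]

theorem sort_coe (f : Fin n → Fin m) : Tuple.sort f = Tuple.sort fun i => (f i : ℕ) := by
  obtain ⟨h1, h2⟩ := Tuple.eq_sort_iff.1 (rfl : Tuple.sort f = Tuple.sort f)
  exact Tuple.eq_sort_iff.2 ⟨h1, fun i j h h' => h2 i j h (Fin.ext h')⟩

theorem st_word (α : ColPerm B n) : st α.word = α.word := by
  have h : α = ⟨α.colour, Tuple.sort fun i => (α.perm.symm i : ℕ)⟩ := by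
    rw [← sort_coe]
    exact ColPerm.ext rfl (Tuple.sort_perm α.perm.symm).symm
  conv_rhs => rw [h]
  rw [word_sort]
  · rfl
  · exact Fin.val_injective.comp α.perm.symm.injective

theorem word_low (α : ColPerm B n) (k : ℕ) (h : k ≤ n) : (α.low k h).word = st (α.word.take k) := by
  rw [low, sort_coe, word_sort]
  · congr 1
    apply List.ext_getElem
    · simp [h]
    · intro i h1 h2
      simp [word]
  · intro i j hij
    simpa [Fin.ext_iff] using α.perm.symm.injective (Fin.ext hij)

theorem word_high (α : ColPerm B n) (k : ℕ) (h : k ≤ n) :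
    (α.high k h).word = st (α.word.drop k) := by
  rw [high, sort_coe, word_sort]
  · congr 1
    apply List.ext_getElem
    · simp
    · intro i h1 h2
      simp [word]
  · intro i j hij
    simpa [Fin.ext_iff] using α.perm.symm.injective (Fin.ext hij)

theorem ofFn_sublist {A : Type*} (a : Fin n → A) (w : Fin m → A) (f : Fin n → Fin m)
    (hf : StrictMono f) (h : ∀ i, a i = w (f i)) : (List.ofFn a).Sublist (List.ofFn w) := by
  rw [List.sublist_iff_exists_fin_orderEmbedding_get_eq]
  refine ⟨OrderEmbedding.ofStrictMono (fun i => Fin.cast (by simp) (f (Fin.cast (by simp) i)))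
    fun i j hij => ?_, fun i => ?_⟩
  · exact hf hij
  · simp only [List.get_ofFn, h]
    rfl

theorem sublist_ofFn {A : Type*} (a : Fin n → A) (w : Fin m → A)
    (h : (List.ofFn a).Sublist (List.ofFn w)) :
    ∃ f : Fin n → Fin m, StrictMono f ∧ ∀ i, a i = w (f i) := by
  rw [List.sublist_iff_exists_fin_orderEmbedding_get_eq] at h
  obtain ⟨f, hf⟩ := h
  refine ⟨fun i => Fin.cast (by simp) (f (Fin.cast (by simp) i)), fun i j hij => ?_, fun i => ?_⟩
  · exact f.strictMono hij
  · have := hf (Fin.cast (by simp) i)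
    simp only [List.get_ofFn] at this
    exact this

/-- The letters of `word α` followed by the shifted letters of `word β`. -/
def letters (α : ColPerm B n) (β : ColPerm B m) : Fin (n + m) → ℕ × B :=
  Fin.append (fun i => ((α.perm.symm i : ℕ), α.colour i))
    (fun i => (n + (β.perm.symm i : ℕ), β.colour i))

theorem letters_injective (α : ColPerm B n) (β : ColPerm B m) :
    Function.Injective (letters α β) := by
  intro i j
  refine Fin.addCases (fun i => ?_) (fun i => ?_) i <;>
  refine Fin.addCases (fun j => ?_) (fun j => ?_) j <;> intro h <;>
  simp only [letters, Fin.append_left, Fin.append_right, Prod.mk.injEq] at h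
  · rw [α.perm.symm.injective (Fin.ext h.1)]
  · have := (α.perm.symm i).2; omega
  · have := (α.perm.symm j).2; omega
  · rw [β.perm.symm.injective (Fin.ext (by omega : (β.perm.symm i : ℕ) = β.perm.symm j))]

theorem word_act_juxt (α : ColPerm B n) (β : ColPerm B m) (ρ : Equiv.Perm (Fin (n + m))) :
    (act ρ (juxt α β)).word = List.ofFn fun i => letters α β (ρ.symm i) := by
  rw [word]
  congr 1
  funext i
  simp only [act, juxt, letters]
  change ((finSumFinEquiv (Sum.map α.perm.symm β.perm.symm (finSumFinEquiv.symm (ρ.symm i))) :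
    ℕ), _) = _
  generalize ρ.symm i = j
  refine Fin.addCases (fun j => ?_) (fun j => ?_) j <;> simp

theorem ofFn_letters (α : ColPerm B n) (β : ColPerm B m) :
    List.ofFn (letters α β) = α.word ++ β.word.map (sf n) := by
  rw [letters, List.ofFn_fin_append, word, word, List.map_ofFn]
  rfl

theorem sum_X {K : Type*} [CommRing K] (α : ColPerm B n) (β : ColPerm B m) :
    ∑ ρ ∈ X n m, (wd (act ρ (juxt α β)).word : ShuffleAlg K (ℕ × B)) =
      wd α.word * wd (β.word.map (sf n)) := by
  classical
  have hnd : (α.word ++ β.word.map (sf n)).Nodup := by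
    rw [← ofFn_letters]
    exact List.nodup_ofFn_ofInjective (letters_injective α β)
  have hu : α.word = List.ofFn fun i => letters α β (Fin.castAdd m i) := by
    simp [letters, word]
  have hv : β.word.map (sf n) = List.ofFn fun i => letters α β (Fin.natAdd n i) := by
    simp [letters, word, List.map_ofFn, Function.comp_def, sf]
  have hinj : Function.Injective fun ρ : Equiv.Perm (Fin (n + m)) =>
      (act ρ (juxt α β)).word := by
    intro ρ ρ' h
    simp only [word_act_juxt] at h
    have h' := List.ofFn_injective h
    rw [← Equiv.symm_bijective.injective.eq_iff]
    ext1 i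
    exact letters_injective α β (congrFun h' i)
  have key : (X n m).image (fun ρ => (act ρ (juxt α β)).word) =
      (sh α.word (β.word.map (sf n))).toFinset := by
    ext w
    rw [Finset.mem_image, List.mem_toFinset]
    constructor
    · rintro ⟨ρ, hρ, rfl⟩
      simp only [X, Finset.mem_filter, Finset.mem_univ, true_and] at hρ
      have hp : (act ρ (juxt α β)).word.Perm (α.word ++ β.word.map (sf n)) := by
        rw [word_act_juxt, ← ofFn_letters]
        exact Equiv.Perm.ofFn_comp_perm ρ.symm (letters α β)
      refine mem_sh_of_sublist (hp.nodup_iff.2 hnd) hp ?_ ?_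
      · rw [hu, word_act_juxt]
        exact ofFn_sublist _ _ _ hρ.1 fun i => by simp
      · rw [hv, word_act_juxt]
        exact ofFn_sublist _ _ _ hρ.2 fun i => by simp
    · intro hw
      have hlen : w.length = n + m := by simpa using (sh_perm hw).length_eq
      obtain ⟨ω, rfl⟩ : ∃ ω : Fin (n + m) → ℕ × B, List.ofFn ω = w :=
        ⟨fun i => w.get (Fin.cast hlen.symm i), by
          apply List.ext_getElem <;> simp [hlen]⟩
      obtain ⟨h1, h2⟩ := sh_sublist hw
      rw [hu] at h1
      rw [hv] at h2
      obtain ⟨f, hf, hf'⟩ := sublist_ofFn _ _ h1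
      obtain ⟨g, hg, hg'⟩ := sublist_ofFn _ _ h2
      have hfg : ∀ i, letters α β i = ω (Fin.append f g i) := fun i => by
        refine Fin.addCases (fun i => ?_) (fun i => ?_) i
        · rw [Fin.append_left]; exact hf' i
        · rw [Fin.append_right]; exact hg' i
      have hi : Function.Injective (Fin.append f g) := fun i j hij =>
        letters_injective α β (by rw [hfg, hfg, hij])
      let ρ : Equiv.Perm (Fin (n + m)) :=
        Equiv.ofBijective _ (Finite.injective_iff_bijective.1 hi)
      have hρ : ∀ i, ρ i = Fin.append f g i := fun i => rfl
      refine ⟨ρ, ?_, ?_⟩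
      · simp only [X, Finset.mem_filter, Finset.mem_univ, true_and]
        constructor
        · intro i j hij
          simpa [hρ] using hf hij
        · intro i j hij
          simpa [hρ] using hg hij
      · rw [word_act_juxt]
        congr 1
        funext i
        rw [hfg, ← hρ, Equiv.apply_symm_apply]
  rw [wd_mul, ← List.sum_toFinset _ (sh_nodup hnd), ← key, Finset.sum_image hinj.injOn]

end
end ColPerm

/-- The free quasisymmetric bialgebra `𝓕(K B) = ⨁ₙ 𝓕ₙ(K B)`; the module `𝓕ₙ(K B)` is free with
basis `B ≀ 𝔖ₙ`. -/
def FQSym (K B : Type*) [CommRing K] : Type _ := (Σ n, ColPerm B n) →₀ K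

namespace FQSym

noncomputable section

open ColPerm ShuffleAlg

variable {K B : Type*} [CommRing K]

instance : AddCommGroup (FQSym K B) := inferInstanceAs (AddCommGroup ((Σ n, ColPerm B n) →₀ K))
instance : Module K (FQSym K B) := inferInstanceAs (Module K ((Σ n, ColPerm B n) →₀ K))

variable (K B) in
/-- The basis `⨆ₙ B ≀ 𝔖ₙ`. -/
def basis : Module.Basis (Σ n, ColPerm B n) K (FQSym K B) := Finsupp.basisSingleOne

variable (K) in
/-- An element of `B ≀ 𝔖ₙ`, viewed in `𝓕(K B)`. -/
def of {n : ℕ} (α : ColPerm B n) : FQSym K B := basis K B ⟨n, α⟩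

/-- The external product: `α * α' = x_{(n,n')} · (b₁, …, bₙ, b'₁, …, b'ₙ'; σ × σ')`. -/
def mulMap : FQSym K B →ₗ[K] FQSym K B →ₗ[K] FQSym K B :=
  (basis K B).constr K fun α => (basis K B).constr K fun β =>
    ∑ ρ ∈ X α.1 β.1, of K (act ρ (juxt α.2 β.2))

/-- The coproduct. -/
def comulMap : FQSym K B →ₗ[K] FQSym K B ⊗[K] FQSym K B :=
  (basis K B).constr K fun α =>
    ∑ k : Fin (α.1 + 1), of K (α.2.low k k.is_le) ⊗ₜ of K (α.2.high k k.is_le)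

/-- The counit: the projection onto `𝓕₀(K B) = K`. -/
def counitMap : FQSym K B →ₗ[K] K := (basis K B).constr K fun α => if α.1 = 0 then 1 else 0

instance : Mul (FQSym K B) := ⟨fun x y => mulMap x y⟩
instance : One (FQSym K B) := ⟨of K (⟨Fin.elim0, 1⟩ : ColPerm B 0)⟩

theorem mul_eq (x y : FQSym K B) : x * y = mulMap x y := rfl

theorem of_mul_of {n m : ℕ} (α : ColPerm B n) (β : ColPerm B m) :
    of K α * of K β = ∑ ρ ∈ X n m, of K (act ρ (juxt α β)) := by
  simp [mul_eq, mulMap, of]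

theorem hom_ext {M : Type*} [AddCommMonoid M] [Module K M] {f g : FQSym K B →ₗ[K] M}
    (h : ∀ n (α : ColPerm B n), f (of K α) = g (of K α)) : f = g :=
  (basis K B).ext fun α => h α.1 α.2

theorem ind {p : FQSym K B → Prop} (x : FQSym K B) (h0 : p 0)
    (hw : ∀ n (α : ColPerm B n), p (of K α)) (ha : ∀ x y, p x → p y → p (x + y))
    (hs : ∀ (c : K) x, p x → p (c • x)) : p x := by
  have hx : x ∈ Submodule.span K (Set.range (basis K B)) := by
    rw [(basis K B).span_eq]; trivial
  induction hx using Submodule.span_induction with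
  | mem x h => obtain ⟨w, rfl⟩ := h; exact hw w.1 w.2
  | zero => exact h0
  | add x y _ _ hx hy => exact ha x y hx hy
  | smul c x _ hx => exact hs c x hx

variable (K B) in
/-- The embedding into the shuffle algebra that sends `(b₁, …, bₙ; σ)` to the word
`(σ⁻¹(1), b₁) ⋯ (σ⁻¹(n), bₙ)`. -/
def emb : FQSym K B →ₗ[K] ShuffleAlg K (ℕ × B) := (basis K B).constr K fun α => wd α.2.word

@[simp] theorem emb_of {n : ℕ} (α : ColPerm B n) : emb K B (of K α) = wd α.word := by
  simp [emb, of]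

variable (K B) in
/-- A left inverse of the embedding. -/
def pr : ShuffleAlg K (ℕ × B) →ₗ[K] FQSym K B :=
  ShuffleAlg.basis.constr K fun w => by
    classical
    exact if h : ∃ α : Σ n, ColPerm B n, α.2.word = w then basis K B h.choose else 0

theorem pr_comp_emb : pr K B ∘ₗ emb K B = LinearMap.id := hom_ext fun n α => by
  have h : ∃ β : Σ n, ColPerm B n, β.2.word = α.word := ⟨⟨n, α⟩, rfl⟩
  have h2 : h.choose = ⟨n, α⟩ := word_injective h.choose_spec
  simp only [LinearMap.comp_apply, emb_of, pr, wd, Module.Basis.constr_basis, dif_pos h, h2,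
    LinearMap.id_apply]
  rfl

theorem emb_injective : Function.Injective (emb K B) :=
  Function.LeftInverse.injective (g := pr K B) fun x => LinearMap.congr_fun pr_comp_emb x

theorem emb2_injective : Function.Injective (TensorProduct.map (emb K B) (emb K B)) :=
  Function.LeftInverse.injective (g := TensorProduct.map (pr K B) (pr K B)) fun x => by
    rw [← LinearMap.comp_apply, ← TensorProduct.map_comp, pr_comp_emb, TensorProduct.map_id]; rfl

theorem emb3_injective :
    Function.Injective (TensorProduct.map (emb K B) (TensorProduct.map (emb K B) (emb K B))) :=
  Function.LeftInverse.injective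
    (g := TensorProduct.map (pr K B) (TensorProduct.map (pr K B) (pr K B))) fun x => by
      rw [← LinearMap.comp_apply, ← TensorProduct.map_comp, ← TensorProduct.map_comp, pr_comp_emb,
        TensorProduct.map_id, TensorProduct.map_id]; rfl

theorem emb_one : emb K B 1 = 1 := by
  change emb K B (of K _) = _
  rw [emb_of, one_eq, word]; simp

theorem emb_of_mul {n : ℕ} (α : ColPerm B n) (y : FQSym K B) :
    emb K B (of K α * y) = wd α.word * mapW K (List.map (sf n)) (emb K B y) := by
  induction y using ind with
  | h0 => simp [mul_eq]
  | ha x y hx hy =>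
    have : of K α * (x + y) = of K α * x + of K α * y := by simp [mul_eq]
    rw [this, map_add, map_add, map_add, mul_add, hx, hy]
  | hs c x hx =>
    have : of K α * (c • x) = c • (of K α * x) := by simp [mul_eq]
    rw [this, map_smul, map_smul, map_smul, hx, mul_smul_comm]
  | hw m β => rw [of_mul_of, map_sum, emb_of, mapW_wd, ← sum_X]; simp

theorem mul_assoc_of {n m l : ℕ} (α : ColPerm B n) (β : ColPerm B m) (γ : ColPerm B l) :
    of K α * of K β * of K γ = of K α * (of K β * of K γ) := by
  apply emb_injective
  have h : ∀ (s : Finset (Equiv.Perm (Fin (n + m)))) (f : _ → FQSym K B) (z : FQSym K B),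
      (∑ ρ ∈ s, f ρ) * z = ∑ ρ ∈ s, f ρ * z := fun s f z => by
    simp [mul_eq, LinearMap.sum_apply]
  have h2 : mapW K (List.map (sf n)) (mapW K (List.map (sf m)) (wd γ.word)) =
      (mapW K (List.map (sf (n + m))) (wd γ.word) : ShuffleAlg K (ℕ × B)) := by
    simp only [mapW_wd, List.map_map]
    congr 2
    funext x
    simp [sf, add_assoc]
  rw [emb_of_mul (y := of K β * of K γ), emb_of_mul, mapW_mul, emb_of, h2, ← mul_assoc, of_mul_of, h, map_sum]
  simp only [emb_of_mul, emb_of, mapW_wd]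
  rw [← Finset.sum_mul, sum_X]

instance : Ring (FQSym K B) where
  __ := (inferInstance : AddCommGroup (FQSym K B))
  left_distrib x y z := by simp [mul_eq]
  right_distrib x y z := by simp [mul_eq]
  zero_mul x := by simp [mul_eq]
  mul_zero x := by simp [mul_eq]
  one_mul x := by
    apply emb_injective
    change emb K B (of K _ * x) = _
    rw [emb_of_mul]
    have h : (⟨Fin.elim0, 1⟩ : ColPerm B 0).word = [] := by simp [word]
    have h2 : (sf 0 : ℕ × B → ℕ × B) = id := by funext x; simp [sf]
    have h3 : mapW K (List.map (sf 0)) = (LinearMap.id : ShuffleAlg K (ℕ × B) →ₗ[K] _) :=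
      ShuffleAlg.hom_ext fun w => by simp [h2]
    rw [h, h3, ← one_eq, one_mul, LinearMap.id_apply]
  mul_one x := by
    apply emb_injective
    induction x using ind with
    | h0 => simp [mul_eq]
    | ha x y hx hy =>
      have : (x + y) * 1 = x * 1 + y * 1 := by simp [mul_eq]
      rw [this, map_add, map_add, hx, hy]
    | hs c x hx =>
      have : (c • x) * 1 = c • (x * 1) := by simp [mul_eq]
      rw [this, map_smul, map_smul, hx]
    | hw n α =>
      rw [emb_of_mul, emb_one, one_eq, mapW_wd, List.map_nil, ← one_eq, mul_one, emb_of]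
  mul_assoc x y z := by
    induction x using ind with
    | h0 => simp [mul_eq]
    | ha x x' h h' => simp_all [mul_eq]
    | hs c x h => simp_all [mul_eq]
    | hw n u =>
    induction y using ind with
    | h0 => simp [mul_eq]
    | ha x x' h h' => simp_all [mul_eq]
    | hs c x h => simp_all [mul_eq]
    | hw m v =>
    induction z using ind with
    | h0 => simp [mul_eq]
    | ha x x' h h' => simp_all [mul_eq]
    | hs c x h => simp_all [mul_eq]
    | hw l w => exact mul_assoc_of u v w

instance : Algebra K (FQSym K B) :=
  Algebra.ofModule (fun r x y => by simp [mul_eq]) (fun r x y => by simp [mul_eq])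

theorem comulMap_of {n : ℕ} (α : ColPerm B n) : comulMap (of K α) =
    ∑ k : Fin (n + 1), of K (α.low k k.is_le) ⊗ₜ of K (α.high k k.is_le) := by
  simp [comulMap, of]

theorem counitMap_of {n : ℕ} (α : ColPerm B n) : counitMap (of K α) = if n = 0 then 1 else 0 := by
  simp [counitMap, of]

theorem S_emb (x : FQSym K B) : S K B (emb K B x) = emb K B x := by
  have : S K B ∘ₗ emb K B = emb K B := hom_ext fun n α => by simp [S, st_word]
  exact LinearMap.congr_fun this x

theorem emb_comul (x : FQSym K B) : TensorProduct.map (emb K B) (emb K B) (comulMap x) =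
    TensorProduct.map (S K B) (S K B) (dc (emb K B x)) := by
  have : TensorProduct.map (emb K B) (emb K B) ∘ₗ comulMap =
      TensorProduct.map (S K B) (S K B) ∘ₗ dc ∘ₗ emb K B := hom_ext fun n α => by
    simp only [LinearMap.comp_apply, comulMap_of, map_sum, TensorProduct.map_tmul, emb_of, dc_wd,
      word_low, word_high, S, mapW_wd, length_word]
    exact Fin.sum_univ_eq_sum_range
      (fun k => (wd (st (α.word.take k)) ⊗ₜ wd (st (α.word.drop k)) :
        ShuffleAlg K (ℕ × B) ⊗[K] ShuffleAlg K (ℕ × B))) (n + 1)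
  exact LinearMap.congr_fun this x

theorem comul_coassoc (x : FQSym K B) :
    TensorProduct.assoc K _ _ _ (TensorProduct.map comulMap LinearMap.id (comulMap x)) =
      TensorProduct.map LinearMap.id comulMap (comulMap x) := by
  apply emb3_injective
  have e1 : emb K B = S K B ∘ₗ emb K B := LinearMap.ext fun x => (S_emb x).symm
  have e2 : TensorProduct.map (emb K B) (emb K B) ∘ₗ comulMap =
      TensorProduct.map (S K B) (S K B) ∘ₗ dc ∘ₗ emb K B := LinearMap.ext emb_comul
  have e3 : TensorProduct.map (S K B) (S K B) ∘ₗ dc ∘ₗ S K B =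
      TensorProduct.map (S K B) (S K B) ∘ₗ dc := LinearMap.ext dc_S
  have l1 : TensorProduct.map (emb K B) (TensorProduct.map (emb K B) (emb K B))
      (TensorProduct.assoc K _ _ _ (TensorProduct.map comulMap LinearMap.id (comulMap x))) =
      TensorProduct.map (S K B) (TensorProduct.map (S K B) (S K B))
        (TensorProduct.assoc K _ _ _ (TensorProduct.map dc LinearMap.id (dc (emb K B x)))) := by
    rw [TensorProduct.map_map_assoc, TensorProduct.map_map_assoc]
    congr 1
    rw [← LinearMap.comp_apply, ← LinearMap.comp_apply (TensorProduct.map _ _),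
      ← TensorProduct.map_comp, ← TensorProduct.map_comp, e2, LinearMap.comp_id, LinearMap.comp_id]
    have : TensorProduct.map (TensorProduct.map (S K B) (S K B) ∘ₗ dc ∘ₗ emb K B) (emb K B) =
        TensorProduct.map (TensorProduct.map (S K B) (S K B) ∘ₗ dc) LinearMap.id ∘ₗ
          TensorProduct.map (emb K B) (emb K B) := by
      rw [← TensorProduct.map_comp]; rfl
    rw [this, LinearMap.comp_apply, emb_comul, ← LinearMap.comp_apply, ← TensorProduct.map_comp,
      LinearMap.comp_assoc, e3, LinearMap.id_comp]
  have l2 : TensorProduct.map (emb K B) (TensorProduct.map (emb K B) (emb K B))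
      (TensorProduct.map LinearMap.id comulMap (comulMap x)) =
      TensorProduct.map (S K B) (TensorProduct.map (S K B) (S K B))
        (TensorProduct.map LinearMap.id dc (dc (emb K B x))) := by
    rw [← LinearMap.comp_apply, ← LinearMap.comp_apply (TensorProduct.map _ _),
      ← TensorProduct.map_comp, ← TensorProduct.map_comp, e2, LinearMap.comp_id, LinearMap.comp_id]
    have : TensorProduct.map (emb K B) (TensorProduct.map (S K B) (S K B) ∘ₗ dc ∘ₗ emb K B) =
        TensorProduct.map LinearMap.id (TensorProduct.map (S K B) (S K B) ∘ₗ dc) ∘ₗ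
          TensorProduct.map (emb K B) (emb K B) := by
      rw [← TensorProduct.map_comp]; rfl
    rw [this, LinearMap.comp_apply, emb_comul, ← LinearMap.comp_apply, ← TensorProduct.map_comp,
      LinearMap.comp_assoc, e3, LinearMap.id_comp]
  rw [l1, l2]
  congr 1
  exact LinearMap.congr_fun (f := (TensorProduct.assoc K _ _ _).toLinearMap ∘ₗ
    TensorProduct.map dc LinearMap.id ∘ₗ dc) (g := TensorProduct.map LinearMap.id dc ∘ₗ dc)
    (ShuffleAlg.hom_ext dc_coassoc) (emb K B x)

theorem low_self {n : ℕ} (α : ColPerm B n) : of K (α.low n le_rfl) = of K α := by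
  apply emb_injective
  rw [emb_of, emb_of, word_low, List.take_of_length_le (by simp), st_word]

theorem high_zero {n : ℕ} (α : ColPerm B n) : of K (α.high 0 n.zero_le) = of K α := by
  apply emb_injective
  rw [emb_of, emb_of, word_high, List.drop_zero, st_word]

theorem counit_left (x : FQSym K B) :
    TensorProduct.map counitMap LinearMap.id (comulMap x) = 1 ⊗ₜ[K] x := by
  refine LinearMap.congr_fun (f := TensorProduct.map counitMap LinearMap.id ∘ₗ comulMap)
    (g := TensorProduct.mk K K _ 1) (hom_ext fun n α => ?_) x
  simp only [LinearMap.comp_apply, comulMap_of, map_sum, TensorProduct.map_tmul, counitMap_of]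
  rw [Finset.sum_eq_single 0]
  · simp only [Fin.val_zero, if_true, LinearMap.id_apply, TensorProduct.mk_apply]
    rw [← high_zero α]
  · intro k _ hk
    rw [if_neg (fun h => hk (Fin.ext (by simpa using h))), TensorProduct.zero_tmul]
  · simp

theorem counit_right (x : FQSym K B) :
    TensorProduct.map LinearMap.id counitMap (comulMap x) = x ⊗ₜ[K] (1 : K) := by
  refine LinearMap.congr_fun (f := TensorProduct.map LinearMap.id counitMap ∘ₗ comulMap)
    (g := (TensorProduct.mk K _ K).flip 1) (hom_ext fun n α => ?_) x
  simp only [LinearMap.comp_apply, comulMap_of, map_sum, TensorProduct.map_tmul, counitMap_of]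
  rw [Finset.sum_eq_single (Fin.last n)]
  · simp only [Fin.val_last, Nat.sub_self, if_true, LinearMap.id_apply, LinearMap.flip_apply,
      TensorProduct.mk_apply]
    rw [low_self]
  · intro k _ hk
    rw [if_neg (fun h => hk (Fin.ext (by have := k.is_le; simp; omega))), TensorProduct.tmul_zero]
  · simp

instance : Coalgebra K (FQSym K B) where
  comul := comulMap
  counit := counitMap
  coassoc := LinearMap.ext comul_coassoc
  rTensor_counit_comp_comul := LinearMap.ext counit_left
  lTensor_counit_comp_comul := LinearMap.ext counit_right

theorem comul_mul_of {n m : ℕ} (α : ColPerm B n) (β : ColPerm B m) :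
    comulMap (of K α * of K β) = comulMap (of K α) * comulMap (of K β) := by
  apply emb2_injective
  rw [emb_comul, emb_of_mul, emb_of, dc_mul, mapW_wd, dc_wd, dc_wd, comulMap_of, comulMap_of,
    Finset.sum_mul_sum, Finset.sum_mul_sum, map_sum, map_sum, length_word, List.length_map,
    length_word]
  rw [← Fin.sum_univ_eq_sum_range]
  refine Finset.sum_congr rfl fun k _ => ?_
  rw [map_sum, map_sum, ← Fin.sum_univ_eq_sum_range]
  refine Finset.sum_congr rfl fun l _ => ?_
  have hk := k.is_le
  have hl := l.is_le
  have hst : ∀ w : List (ℕ × B), st (w.map (sf n)) = st w := fun w =>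
    st_map_of_strictMono w _ (fun _ => rfl) fun x _ y _ => by simp [sf]
  have hlt : ∀ x ∈ α.word, ∀ y ∈ β.word.map (sf n), x.1 < y.1 := by
    intro x hx y hy
    obtain ⟨z, _, rfl⟩ := List.mem_map.1 hy
    have := lt_of_mem_word hx
    simp only [sf]; omega
  rw [Algebra.TensorProduct.tmul_mul_tmul, Algebra.TensorProduct.tmul_mul_tmul,
    TensorProduct.map_tmul, TensorProduct.map_tmul, emb_of_mul, emb_of_mul, emb_of, emb_of,
    word_low, word_low, word_high, word_high,
    S_mul _ _ (fun x hx y hy => hlt x (List.mem_of_mem_take hx) y (List.mem_of_mem_take hy)),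
    S_mul _ _ (fun x hx y hy => hlt x (List.mem_of_mem_drop hx) y (List.mem_of_mem_drop hy)),
    ← List.map_take, ← List.map_drop, hst, hst]
  simp [Nat.min_eq_left hk]

theorem comulMap_mul (x y : FQSym K B) : comulMap (x * y) = comulMap x * comulMap y := by
  induction x using ind with
  | h0 => simp
  | ha x x' h h' => simp only [add_mul, map_add, h, h']
  | hs c x h => rw [smul_mul_assoc, map_smul, map_smul, h, smul_mul_assoc]
  | hw n u =>
  induction y using ind with
  | h0 => simp
  | ha x x' h h' => simp only [mul_add, map_add, h, h']
  | hs c x h => rw [mul_smul_comm, map_smul, map_smul, h, mul_smul_comm]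
  | hw m v => exact comul_mul_of u v

theorem counitMap_mul (x y : FQSym K B) : counitMap (x * y) = counitMap x * counitMap y := by
  induction x using ind with
  | h0 => simp
  | ha x x' h h' => simp only [add_mul, map_add, h, h']
  | hs c x h => rw [smul_mul_assoc, map_smul, map_smul, h, smul_mul_assoc]
  | hw n u =>
  induction y using ind with
  | h0 => simp
  | ha x x' h h' => simp only [mul_add, map_add, h, h']
  | hs c x h => rw [mul_smul_comm, map_smul, map_smul, h, mul_smul_comm]
  | hw m v =>
    by_cases hn : n = 0
    · subst hn
      have : of K u = 1 := by
        apply emb_injective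
        rw [emb_of, emb_one, one_eq, List.length_eq_zero_iff.1 (length_word u)]
      rw [this, one_mul, ← this, counitMap_of u, if_pos rfl, one_mul]
    · rw [of_mul_of, map_sum, Finset.sum_eq_zero fun ρ _ => ?_]
      · simp [counitMap_of, hn]
      · rw [counitMap_of, if_neg (by omega)]

instance : Bialgebra K (FQSym K B) := Bialgebra.mk' K (FQSym K B)
  (by change counitMap (of K _) = 1; rw [counitMap_of, if_pos rfl])
  (fun {x y} => counitMap_mul x y)
  (by
    change comulMap (1 : FQSym K B) = 1
    apply emb2_injective
    rw [emb_comul, emb_one, one_eq, dc_nil, Algebra.TensorProduct.one_def, TensorProduct.map_tmul,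
      TensorProduct.map_tmul, emb_one, one_eq, S, mapW_wd]
    rfl)
  (fun {x y} => comulMap_mul x y)

end
end FQSym

namespace FQSym

noncomputable section

open ColPerm

variable (K : Type*) {B : Type*} [CommRing K]

/-- The homogeneous component `𝓕ₙ(K B)`. -/
def deg (B : Type*) (n : ℕ) : Submodule K (FQSym K B) :=
  Submodule.span K (Set.range fun α : ColPerm B n => of K α)

/-- The dual `(b₁, …, bₙ; σ)* = σ⁻¹ · (b₁*, …, bₙ*; e)`. -/
def _root_.ColPerm.dual (star : B → B) {n : ℕ} (α : ColPerm B n) : ColPerm B n :=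
  act α.perm.symm ⟨fun i => star (α.colour i), 1⟩

/-- The pairing `ϖ_tot`, for which the bases `(α)` and `(α*)` are dual to each other. -/
def pairing (star : B → B) : LinearMap.BilinForm K (FQSym K B) := by
  classical
  exact (basis K B).constr K fun α => (basis K B).constr K fun β =>
    if β = ⟨α.1, α.2.dual star⟩ then 1 else 0

/-- The element `y_{n,b} = ((b, …, b); eₙ)`. -/
def y (n : ℕ) (b : B) : FQSym K B := of K (⟨fun _ => b, 1⟩ : ColPerm B n)

/-- The Mantaci-Reutenauer algebra `𝓓(B)`. -/
def mantaciReutenauer (B : Type*) : Subalgebra K (FQSym K B) :=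
  Algebra.adjoin K {x | ∃ n : ℕ, 1 ≤ n ∧ ∃ b : B, x = y K n b}

end
end FQSym

namespace RobinsonSchensted

/-- Insert `x` into a row: either `x` is put at the end of the row, or it replaces the leftmost
entry that is larger than `x`, and this entry is returned. -/
def rowInsert (x : ℕ) : List ℕ → List ℕ × Option ℕ
  | [] => ([x], none)
  | y :: r => if x < y then (x :: r, some y) else (y :: (rowInsert x r).1, (rowInsert x r).2)

/-- Insert `x` into a tableau, given by the list of its rows; also return the index of the row in
which the new box appears. -/
def insert (x : ℕ) : List (List ℕ) → List (List ℕ) × ℕ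
  | [] => ([[x]], 0)
  | r :: t =>
    match rowInsert x r with
    | (r', none) => (r' :: t, 0)
    | (r', some y) => (r' :: (insert y t).1, (insert y t).2 + 1)

/-- Add a box with the label `l` at the end of the `i`-th row. -/
def addBox (l : ℕ) : ℕ → List (List ℕ) → List (List ℕ)
  | _, [] => [[l]]
  | 0, r :: t => (r ++ [l]) :: t
  | i + 1, r :: t => r :: addBox l i t

/-- The pair of the insertion tableau and the record tableau of a sequence of pairs `(x, l)`: the
letters `x` are inserted successively, and the box that appears at the insertion of `x` is
labelled `l` in the record tableau. -/
def tableaux (w : List (ℕ × ℕ)) : List (List ℕ) × List (List ℕ) :=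
  w.foldl (fun p a => ((insert a.1 p.1).1, addBox a.2 (insert a.1 p.1).2 p.2)) ([], [])

end RobinsonSchensted

/-- A standard `B`-tableau: a family of tableaux, in the boxes of which each of the labels
`1, …, n` is used exactly once, `n` being the total number of boxes. -/
structure StdTableau (B : Type*) [Fintype B] where
  /-- the shape, a family of partitions -/
  shape : B → YoungDiagram
  /-- the tableaux (increasing along rows and columns) -/
  tab : ∀ b, SemistandardYoungTableau (shape b)
  standard : ∀ m : ℕ, ∑ b, ((shape b).cells.filter fun c => tab b c.1 c.2 = m).card =
    if 1 ≤ m ∧ m ≤ ∑ b, (shape b).card then 1 else 0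

namespace StdTableau

variable {B : Type*} [Fintype B] [DecidableEq B]

/-- The total number of boxes. -/
def size (T : StdTableau B) : ℕ := ∑ b, (T.shape b).card

/-- The list of the rows of the `b`-component `Q_b` of the record tableau of
`w(α) = (σ(1), b₁) ⋯ (σ(n), bₙ)`, where `α = σ · (b₁, …, bₙ; e)`, that is,
`b_j = α.colour (σ(j))`: the letters `σ(j)` with `b_j = b` are inserted in the order of the
indices `j` and the index `j`, counted from `1`, is recorded. -/
def _root_.ColPerm.record {n : ℕ} (α : ColPerm B n) (b : B) : List (List ℕ) :=
  (RobinsonSchensted.tableaux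
    (((List.finRange n).filter fun j => α.colour (α.perm j) = b).map
      fun j => ((α.perm j : ℕ), (j : ℕ) + 1))).2

/-- The statement `Q(α) = T`: the box in row `i` and column `j` of `T_b` has the same label as the
corresponding box of `Q_b(α)`; absent boxes count as `0`. -/
def IsRecord {n : ℕ} (α : ColPerm B n) (T : StdTableau B) : Prop :=
  ∀ b i j, T.tab b i j = ((α.record b).getD i []).getD j 0

noncomputable section

variable (K : Type*) [CommRing K]

/-- The element `t_T = ∑ α`, the sum being over the `α` with `Q(α) = T`. -/
def t (T : StdTableau B) : FQSym K B := by
  classical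
  exact ∑ α : ColPerm B T.size with IsRecord α T, FQSym.of K α

/-- The submodule `𝓠(B)` that is spanned by the elements `t_T`. -/
def coplactic (B : Type*) [Fintype B] [DecidableEq B] : Submodule K (FQSym K B) :=
  Submodule.span K (Set.range fun T : StdTableau B => t K T)

end
end StdTableau

namespace SymFun

noncomputable section

open MvPowerSeries

/-- The multiset of the non-zero exponents of a monomial, that is, the partition to which it
belongs. -/
def typ {σ : Type*} (e : σ →₀ ℕ) : Multiset ℕ := e.support.val.map e

theorem typ_embDomain {σ τ : Type*} (f : σ ↪ τ) (e : σ →₀ ℕ) :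
    typ (e.embDomain f) = typ e := by
  simp [typ, Finsupp.support_embDomain, Finset.map_val, Multiset.map_map]

theorem typ_mapDomain {σ τ : Type*} (f : σ ≃ τ) (e : σ →₀ ℕ) :
    typ (e.mapDomain f) = typ e := by
  rw [← typ_embDomain f.toEmbedding e, Finsupp.embDomain_eq_mapDomain]; rfl

theorem typ_sumElim {σ τ : Type*} (a : σ →₀ ℕ) (b : τ →₀ ℕ) :
    typ (a.sumElim b) = typ a + typ b := by
  simp [typ, Finsupp.sumElim, Finset.disjSum, Multiset.disjSum, Multiset.map_map,
    Function.comp_def]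

theorem zero_notMem_typ {σ : Type*} (e : σ →₀ ℕ) : 0 ∉ typ e := by
  simp [typ]

theorem sum_typ {σ : Type*} (e : σ →₀ ℕ) : (typ e).sum = e.degree := rfl

theorem exists_typ (s : Multiset ℕ) (h : 0 ∉ s) : ∃ e : ℕ →₀ ℕ, typ e = s := by
  induction s using Multiset.induction with
  | empty => exact ⟨0, rfl⟩
  | cons a s ih =>
    obtain ⟨e, rfl⟩ := ih fun h' => h (Multiset.mem_cons_of_mem h')
    have ha : a ≠ 0 := fun h' => h (h' ▸ Multiset.mem_cons_self _ _)
    obtain ⟨i, hi⟩ := Infinite.exists_notMem_finset e.support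
    have hd : Disjoint e.support (Finsupp.single i a).support := by
      rw [Finsupp.support_single i ha]; simpa using hi
    refine ⟨e + Finsupp.single i a, ?_⟩
    rw [typ, Finsupp.support_add_eq hd, Finsupp.support_single i ha, Finset.union_comm,
      Finset.singleton_union, Finset.insert_val_of_notMem hi, Multiset.map_cons]
    have hi' : e i = 0 := by simpa using hi
    congr 1
    · simp [hi']
    · refine Multiset.map_congr rfl fun j hj => ?_
      have : i ≠ j := fun h => hi (h ▸ hj)
      simp [this]

theorem exists_perm {e e' : ℕ →₀ ℕ} (h : typ e = typ e') :
    ∃ g : Equiv.Perm ℕ, e'.mapDomain g = e := by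
  have key : ∀ k, Nonempty ({i // e' i = k} ≃ {i // e i = k}) := by
    intro k
    by_cases hk : k = 0
    · subst hk
      have hinf : ∀ f : ℕ →₀ ℕ, Infinite {i // f i = 0} := fun f => by
        have : {i | f i = 0} = (f.support : Set ℕ)ᶜ := by ext; simp
        have h2 : {i | f i = 0}.Infinite := this ▸ f.support.finite_toSet.infinite_compl
        exact h2.to_subtype
      have := hinf e
      have := hinf e'
      exact nonempty_equiv_of_countable
    · have hc : ∀ f : ℕ →₀ ℕ, ∀ i, i ∈ f.support.filter (fun i => f i = k) ↔ f i = k := by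
        intro f i
        simp only [Finset.mem_filter, Finsupp.mem_support_iff, and_iff_right_iff_imp]
        rintro rfl; exact hk
      have hcount : ∀ f : ℕ →₀ ℕ, (f.support.filter (fun i => f i = k)).card = (typ f).count k := by
        intro f
        rw [typ, Multiset.count_map, Finset.card, Finset.filter_val]
        simp only [eq_comm]
      refine ⟨(Equiv.subtypeEquivRight (hc e')).symm.trans
        ((Finset.equivOfCardEq ?_).trans (Equiv.subtypeEquivRight (hc e)))⟩
      rw [hcount, hcount, h]
  refine ⟨Equiv.ofFiberEquiv fun k => (key k).some, ?_⟩
  ext i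
  obtain ⟨j, rfl⟩ := (Equiv.ofFiberEquiv fun k => (key k).some).surjective i
  rw [Finsupp.mapDomain_apply (Equiv.injective _)]
  exact (Equiv.ofFiberEquiv_map (f := e') (g := e) _ j).symm

end

end SymFun

/-- The algebra `Λ` of symmetric functions with coefficients in `K`: the power series of bounded
degree in countably many variables that are invariant under all permutations of the variables. -/
def symmetricFunctions (K : Type*) [CommRing K] : Subalgebra K (MvPowerSeries ℕ K) where
  carrier := {f | (∀ g : Equiv.Perm ℕ, MvPowerSeries.rename g f = f) ∧
    ∃ d : ℕ, ∀ e : ℕ →₀ ℕ, d < e.degree → MvPowerSeries.coeff e f = 0}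
  mul_mem' := by
    rintro f f' ⟨h, d, hd⟩ ⟨h', d', hd'⟩
    refine ⟨fun g => by rw [map_mul, h, h'], d + d', fun e he => ?_⟩
    classical
    rw [MvPowerSeries.coeff_mul]
    refine Finset.sum_eq_zero fun p hp => ?_
    rw [Finset.HasAntidiagonal.mem_antidiagonal] at hp
    have hdeg : p.1.degree + p.2.degree = e.degree := by rw [← hp, map_add]
    by_cases h1 : d < p.1.degree
    · rw [hd _ h1, zero_mul]
    · rw [hd' _ (by omega), mul_zero]
  add_mem' := by
    rintro f f' ⟨h, d, hd⟩ ⟨h', d', hd'⟩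
    refine ⟨fun g => by rw [map_add, h, h'], max d d', fun e he => ?_⟩
    rw [map_add, hd e (lt_of_le_of_lt (le_max_left _ _) he),
      hd' e (lt_of_le_of_lt (le_max_right _ _) he), add_zero]
  algebraMap_mem' r := by
    refine ⟨fun g => AlgHom.commutes _ r, 0, fun e he => ?_⟩
    rw [MvPowerSeries.algebraMap_apply, Algebra.algebraMap_self_apply]
    classical
    rw [MvPowerSeries.coeff_C, if_neg]
    rintro rfl
    simp at he

/-- The algebra of symmetric functions, as a type. -/
def SymFun (K : Type*) [CommRing K] : Type _ := symmetricFunctions K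

noncomputable instance (K : Type*) [CommRing K] : CommRing (SymFun K) :=
  inferInstanceAs (CommRing (symmetricFunctions K))

noncomputable instance (K : Type*) [CommRing K] : Algebra K (SymFun K) :=
  inferInstanceAs (Algebra K (symmetricFunctions K))

/-- The inclusion of `Λ` in the algebra of power series. -/
noncomputable def SymFun.val (K : Type*) [CommRing K] : SymFun K →ₐ[K] MvPowerSeries ℕ K :=
  (symmetricFunctions K).val

namespace SymFun

noncomputable section

open MvPowerSeries

variable {K : Type*} [CommRing K]

theorem coeff_rename_equiv {σ τ : Type*} (g : σ ≃ τ) (f : MvPowerSeries σ K) (e : τ →₀ ℕ) :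
    coeff e (rename g f) = coeff (e.mapDomain g.symm) f := by
  have h := coeff_embDomain_rename g.toEmbedding f (e.mapDomain g.symm)
  have h2 : (e.mapDomain g.symm).embDomain g.toEmbedding = e := by
    rw [Finsupp.embDomain_eq_mapDomain]
    change (e.mapDomain g.symm).mapDomain g = e
    rw [← Finsupp.mapDomain_comp, Equiv.self_comp_symm, Finsupp.mapDomain_id]
  rw [h2] at h
  exact h

theorem val_injective : Function.Injective (val K) := Subtype.val_injective

theorem coeff_eq (f : SymFun K) {e e' : ℕ →₀ ℕ} (h : typ e = typ e') :
    coeff e (val K f) = coeff e' (val K f) := by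
  obtain ⟨g, rfl⟩ := exists_perm h
  exact (coeff_rename_equiv g.symm _ e').symm.trans (congrArg (coeff e') (f.2.1 g.symm))

/-- The symmetric function in which the coefficient of a monomial `x^e` is `c μ`, where `μ` is the
partition formed by the non-zero exponents. -/
def ofTyp (c : Multiset ℕ → K) (d : ℕ) (hc : ∀ s, d < s.sum → c s = 0) : SymFun K :=
  ⟨(fun e => c (typ e) : (ℕ →₀ ℕ) → K), fun g => by
    ext e
    refine (coeff_rename_equiv g _ e).trans ?_
    change c (typ _) = c (typ _)
    rw [typ_mapDomain], d, fun e he => hc _ (by rwa [sum_typ])⟩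

@[simp] theorem coeff_ofTyp (c : Multiset ℕ → K) (d : ℕ) (hc) (e : ℕ →₀ ℕ) :
    coeff e (val K (ofTyp c d hc)) = c (typ e) := rfl

end
end SymFun

namespace SymFun

noncomputable section

open MvPowerSeries

variable (K : Type*) [CommRing K]

/-- A monomial that belongs to a given partition. -/
def rep (s : {s : Multiset ℕ // 0 ∉ s}) : ℕ →₀ ℕ := (exists_typ s.1 s.2).choose

theorem typ_rep (s : {s : Multiset ℕ // 0 ∉ s}) : typ (rep s) = s.1 :=
  (exists_typ s.1 s.2).choose_spec

/-- The coefficient of the monomials that belong to a given partition. -/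
def cf (s : {s : Multiset ℕ // 0 ∉ s}) : SymFun K →ₗ[K] K :=
  coeff (rep s) ∘ₗ (val K).toLinearMap

variable {K}

theorem cf_apply (s : {s : Multiset ℕ // 0 ∉ s}) (f : SymFun K) : cf K s f = coeff (rep s) (val K f) :=
  rfl

theorem coeff_eq_cf (f : SymFun K) (e : ℕ →₀ ℕ) :
    coeff e (val K f) = cf K ⟨typ e, zero_notMem_typ e⟩ f := by
  rw [cf_apply]
  exact coeff_eq f (typ_rep ⟨typ e, zero_notMem_typ e⟩).symm

theorem finite_sum_le (d : ℕ) : {s : {s : Multiset ℕ // 0 ∉ s} | s.1.sum ≤ d}.Finite := by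
  have h : (⋃ n ∈ Set.Iic d, Set.range fun p : n.Partition => p.parts).Finite :=
    (Set.finite_Iic d).biUnion fun n _ => Set.finite_range _
  refine Set.Finite.of_finite_image (f := Subtype.val) (h.subset ?_) Subtype.val_injective.injOn
  rintro _ ⟨s, hs, rfl⟩
  refine Set.mem_biUnion (x := s.1.sum) hs ⟨⟨s.1, fun {i} hi => ?_, rfl⟩, rfl⟩
  exact Nat.pos_of_ne_zero fun h => s.2 (h ▸ hi)

variable (K) in
/-- The coordinates of a symmetric function in the basis of monomial symmetric functions. -/
def coord : SymFun K →ₗ[K] {s : Multiset ℕ // 0 ∉ s} →₀ K where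
  toFun f := Finsupp.ofSupportFinite (fun s => cf K s f) (by
    obtain ⟨d, hd⟩ := f.2.2
    refine (finite_sum_le d).subset fun s hs => ?_
    by_contra h
    refine hs (hd _ ?_)
    rw [← sum_typ, typ_rep]
    exact not_le.1 h)
  map_add' f g := by ext s; simp [Finsupp.ofSupportFinite_coe]
  map_smul' c f := by ext s; simp [Finsupp.ofSupportFinite_coe]

theorem coord_apply (f : SymFun K) (s : {s : Multiset ℕ // 0 ∉ s}) : coord K f s = cf K s f := rfl

theorem coord_bijective : Function.Bijective (coord K) := by
  constructor
  · intro f g h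
    refine val_injective (MvPowerSeries.ext fun e => ?_)
    rw [coeff_eq_cf, coeff_eq_cf, ← coord_apply, ← coord_apply, h]
  · intro c
    classical
    refine ⟨ofTyp (fun s => if h : 0 ∉ s then c ⟨s, h⟩ else 0) (c.support.sup fun s => s.1.sum)
      fun s hs => ?_, ?_⟩
    · by_cases h : 0 ∉ s
      · rw [dif_pos h]
        by_contra h'
        exact absurd hs (not_lt.2 (Finset.le_sup (b := ⟨s, h⟩)
          (f := fun s : {s : Multiset ℕ // 0 ∉ s} => s.1.sum) (Finsupp.mem_support_iff.2 h')))
      · rw [dif_neg h]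
    · ext s
      rw [coord_apply, cf_apply, coeff_ofTyp, dif_pos (zero_notMem_typ _)]
      congr 1
      exact Subtype.ext (typ_rep s)

variable (K) in
/-- The basis of monomial symmetric functions. -/
def mono : Module.Basis {s : Multiset ℕ // 0 ∉ s} K (SymFun K) :=
  ⟨LinearEquiv.ofBijective (coord K) coord_bijective⟩

theorem mono_repr (f : SymFun K) (s) : (mono K).repr f s = cf K s f := rfl

theorem cf_mono (s u : {s : Multiset ℕ // 0 ∉ s}) :
    cf K s (mono K u) = Finsupp.single u 1 s := by
  rw [← mono_repr, Module.Basis.repr_self]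

instance : Filter.TendstoCofinite (Sum.inl : ℕ → ℕ ⊕ ℕ) :=
  Filter.tendstoCofinite_of_injective Sum.inl_injective
instance : Filter.TendstoCofinite (Sum.inr : ℕ → ℕ ⊕ ℕ) :=
  Filter.tendstoCofinite_of_injective Sum.inr_injective

variable (K)

/-- The map `f ⊗ g ↦ f(x₀, x₁, …) g(y₀, y₁, …)`, with values in the power series in two countable
sets of variables. -/
def tensorToSeries : SymFun K ⊗[K] SymFun K →ₐ[K] MvPowerSeries (ℕ ⊕ ℕ) K :=
  Algebra.TensorProduct.lift
    ((rename (Sum.inl : ℕ → ℕ ⊕ ℕ)).comp (val K))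
    ((rename (Sum.inr : ℕ → ℕ ⊕ ℕ)).comp (val K)) fun _ _ => Commute.all _ _

/-- The map `f ↦ f(x₀, x₁, …, y₀, y₁, …)`. -/
def double : SymFun K →ₐ[K] MvPowerSeries (ℕ ⊕ ℕ) K :=
  (rename Equiv.natSumNatEquivNat.symm).comp (val K)

variable {K}

theorem coeff_tensorToSeries_tmul (f g : SymFun K) (a b : ℕ →₀ ℕ) :
    coeff (a.sumElim b) (tensorToSeries K (f ⊗ₜ g)) = coeff a (val K f) * coeff b (val K g) := by
  have h : tensorToSeries K (f ⊗ₜ g) =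
      rename (Sum.inl : ℕ → ℕ ⊕ ℕ) (val K f) * rename (Sum.inr : ℕ → ℕ ⊕ ℕ) (val K g) := by
    simp [tensorToSeries]
  have e1 : a.sumElim (0 : ℕ →₀ ℕ) = a.embDomain Function.Embedding.inl :=
    (Finsupp.embDomain_inl a).symm
  have e2 : (0 : ℕ →₀ ℕ).sumElim b = b.embDomain Function.Embedding.inr :=
    (Finsupp.embDomain_inr b).symm
  have c1 : coeff (a.sumElim (0 : ℕ →₀ ℕ)) (rename (Sum.inl : ℕ → ℕ ⊕ ℕ) (val K f)) = coeff a (val K f) := by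
    rw [e1]; exact coeff_embDomain_rename Function.Embedding.inl (val K f) a
  have c2 : coeff ((0 : ℕ →₀ ℕ).sumElim b) (rename (Sum.inr : ℕ → ℕ ⊕ ℕ) (val K g)) = coeff b (val K g) := by
    rw [e2]; exact coeff_embDomain_rename Function.Embedding.inr (val K g) b
  classical
  rw [h, coeff_mul, Finset.sum_eq_single (a.sumElim 0, (0 : ℕ →₀ ℕ).sumElim b), c1, c2]
  · rintro ⟨u, v⟩ huv hne
    rw [Finset.HasAntidiagonal.mem_antidiagonal] at huv
    by_cases hu : u ∈ Set.range (Finsupp.mapDomain (Sum.inl : ℕ → ℕ ⊕ ℕ))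
    · by_cases hv : v ∈ Set.range (Finsupp.mapDomain (Sum.inr : ℕ → ℕ ⊕ ℕ))
      · exfalso
        obtain ⟨u, rfl⟩ := hu
        obtain ⟨v, rfl⟩ := hv
        have m1 : ∀ u : ℕ →₀ ℕ, u.mapDomain (Sum.inl : ℕ → ℕ ⊕ ℕ) = u.sumElim (0 : ℕ →₀ ℕ) :=
          fun u => (Finsupp.embDomain_eq_mapDomain Function.Embedding.inl u).symm.trans
            (Finsupp.embDomain_inl u)
        have m2 : ∀ u : ℕ →₀ ℕ, u.mapDomain (Sum.inr : ℕ → ℕ ⊕ ℕ) = (0 : ℕ →₀ ℕ).sumElim u :=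
          fun u => (Finsupp.embDomain_eq_mapDomain Function.Embedding.inr u).symm.trans
            (Finsupp.embDomain_inr u)
        simp only [m1, m2] at huv hne
        rw [← Finsupp.sumElim_add, add_zero, zero_add] at huv
        apply hne
        have h1 : u = a := by ext i; exact DFunLike.congr_fun huv (Sum.inl i)
        have h2 : v = b := by ext i; exact DFunLike.congr_fun huv (Sum.inr i)
        rw [h1, h2]
      · rw [coeff_rename_eq_zero Sum.inr (val K g) hv, mul_zero]
    · rw [coeff_rename_eq_zero Sum.inl (val K f) hu, zero_mul]
  · intro hn
    refine absurd ?_ hn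
    rw [Finset.HasAntidiagonal.mem_antidiagonal, ← Finsupp.sumElim_add, add_zero, zero_add]

/-- The tensor product of two coefficient functionals. -/
def cf2 (s u : {s : Multiset ℕ // 0 ∉ s}) : SymFun K ⊗[K] SymFun K →ₗ[K] K :=
  LinearMap.mul' K K ∘ₗ TensorProduct.map (cf K s) (cf K u)

theorem cf2_tmul (s u : {s : Multiset ℕ // 0 ∉ s}) (f g : SymFun K) :
    cf2 s u (f ⊗ₜ g) = cf K s f * cf K u g := by simp [cf2]

theorem cf2_eq_repr (s u : {s : Multiset ℕ // 0 ∉ s}) (z : SymFun K ⊗[K] SymFun K) :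
    cf2 s u z = ((mono K).tensorProduct (mono K)).repr z (s, u) := by
  induction z with
  | zero => simp
  | add x y hx hy => simp [hx, hy]
  | tmul f g => simp [cf2_tmul, mono_repr, Module.Basis.tensorProduct_repr_tmul_apply, mul_comm]

theorem ext2 {z z' : SymFun K ⊗[K] SymFun K} (h : ∀ s u, cf2 s u z = cf2 s u z') : z = z' := by
  apply ((mono K).tensorProduct (mono K)).repr.injective
  ext ⟨s, u⟩
  rw [← cf2_eq_repr, ← cf2_eq_repr, h]

theorem coeff_tensorToSeries (z : SymFun K ⊗[K] SymFun K) (a b : ℕ →₀ ℕ) :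
    coeff (a.sumElim b) (tensorToSeries K z) =
      cf2 ⟨typ a, zero_notMem_typ a⟩ ⟨typ b, zero_notMem_typ b⟩ z := by
  induction z with
  | zero => simp
  | add x y hx hy => rw [map_add, map_add, map_add, hx, hy]
  | tmul f g => rw [coeff_tensorToSeries_tmul, cf2_tmul, ← coeff_eq_cf, ← coeff_eq_cf]

theorem coeff_tensorToSeries_rep (z : SymFun K ⊗[K] SymFun K) (s u) :
    coeff ((rep s).sumElim (rep u)) (tensorToSeries K z) = cf2 s u z := by
  rw [coeff_tensorToSeries]
  congr 2
  · exact Subtype.ext (typ_rep s)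
  · exact Subtype.ext (typ_rep u)

theorem tensorToSeries_injective : Function.Injective (tensorToSeries K) := fun z z' h =>
  ext2 fun s u => by rw [← coeff_tensorToSeries_rep, ← coeff_tensorToSeries_rep, h]

/-- The union of two partitions. -/
def uni (s u : {s : Multiset ℕ // 0 ∉ s}) : {s : Multiset ℕ // 0 ∉ s} :=
  ⟨s.1 + u.1, fun h => (Multiset.mem_add.1 h).elim s.2 u.2⟩

theorem coeff_double (f : SymFun K) (a b : ℕ →₀ ℕ) : coeff (a.sumElim b) (double K f) =
    cf K (uni ⟨typ a, zero_notMem_typ a⟩ ⟨typ b, zero_notMem_typ b⟩) f := by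
  refine (coeff_rename_equiv Equiv.natSumNatEquivNat.symm (val K f) _).trans ?_
  rw [coeff_eq_cf]
  congr 2
  exact Subtype.ext ((typ_mapDomain _ _).trans (typ_sumElim a b))

theorem coeff_double_rep (f : SymFun K) (s u) :
    coeff ((rep s).sumElim (rep u)) (double K f) = cf K (uni s u) f := by
  rw [coeff_double]
  congr 2
  refine Subtype.ext ?_
  simp [uni, typ_rep]

theorem ext_series {F G : MvPowerSeries (ℕ ⊕ ℕ) K}
    (h : ∀ a b : ℕ →₀ ℕ, coeff (a.sumElim b) F = coeff (a.sumElim b) G) : F = G := by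
  ext e
  rw [← Finsupp.comapDomain_sumElim_comapDomain e]
  exact h _ _

theorem double_mem (f : SymFun K) : double K f ∈ (tensorToSeries K).range := by
  classical
  have hf : f ∈ Submodule.span K (Set.range (mono K)) := by rw [(mono K).span_eq]; trivial
  induction hf using Submodule.span_induction with
  | zero => rw [map_zero]; exact Subalgebra.zero_mem _
  | add x y _ _ hx hy => rw [map_add]; exact Subalgebra.add_mem _ hx hy
  | smul c x _ hx => rw [map_smul]; exact Subalgebra.smul_mem _ hx c
  | mem x hx =>
    obtain ⟨l, rfl⟩ := hx
    have hl : ∀ p : Multiset ℕ × Multiset ℕ, p.1 + p.2 = l.1 → 0 ∉ p.1 ∧ 0 ∉ p.2 := fun p hp =>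
      ⟨fun h => l.2 (hp ▸ Multiset.mem_add.2 (Or.inl h)),
        fun h => l.2 (hp ▸ Multiset.mem_add.2 (Or.inr h))⟩
    have hl' : ∀ p : {p // p ∈ (Multiset.antidiagonal l.1).toFinset}, p.1.1 + p.1.2 = l.1 :=
      fun p => by
        have := p.2
        rwa [Multiset.mem_toFinset, Multiset.mem_antidiagonal] at this
    refine ⟨∑ p : {p // p ∈ (Multiset.antidiagonal l.1).toFinset},
      mono K ⟨p.1.1, (hl p.1 (hl' p)).1⟩ ⊗ₜ mono K ⟨p.1.2, (hl p.1 (hl' p)).2⟩, ?_⟩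
    refine ext_series fun a b => ?_
    refine (coeff_tensorToSeries _ a b).trans ?_
    rw [coeff_double, map_sum, cf_mono]
    simp only [cf2_tmul, cf_mono]
    by_cases h : typ a + typ b = l.1
    · have hm : (typ a, typ b) ∈ (Multiset.antidiagonal l.1).toFinset := by
        rwa [Multiset.mem_toFinset, Multiset.mem_antidiagonal]
      rw [Finset.sum_eq_single ⟨(typ a, typ b), hm⟩]
      · have : uni ⟨typ a, zero_notMem_typ a⟩ ⟨typ b, zero_notMem_typ b⟩ = l := Subtype.ext h
        rw [this]; simp
      · rintro ⟨⟨p, q⟩, hpq⟩ _ hne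
        by_cases hp : p = typ a
        · have hq : q ≠ typ b := fun hq => hne (by subst hp; subst hq; rfl)
          rw [Finsupp.single_eq_of_ne (a' := ⟨typ b, _⟩)
            (fun h => hq (congrArg Subtype.val h).symm), mul_zero]
        · rw [Finsupp.single_eq_of_ne (a' := ⟨typ a, _⟩)
            (fun h => hp (congrArg Subtype.val h).symm), zero_mul]
      · simp
    · rw [Finsupp.single_eq_of_ne (fun h' => h (congrArg Subtype.val h')), Finset.sum_eq_zero]
      rintro ⟨⟨p, q⟩, hpq⟩ _
      by_cases hp : p = typ a
      · have hq : q ≠ typ b := fun hq => h (by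
          have := hl' ⟨(p, q), hpq⟩; subst hp; subst hq; exact this)
        rw [Finsupp.single_eq_of_ne (a' := ⟨typ b, _⟩)
          (fun h => hq (congrArg Subtype.val h).symm), mul_zero]
      · rw [Finsupp.single_eq_of_ne (a' := ⟨typ a, _⟩)
          (fun h => hp (congrArg Subtype.val h).symm), zero_mul]

end
end SymFun

namespace SymFun

noncomputable section

open MvPowerSeries

variable (K : Type*) [CommRing K]

/-- The coproduct of `Λ`: if `Δ f = ∑ g ⊗ g'`, then
`∑ g(x₀, x₁, …) g'(y₀, y₁, …) = f(x₀, x₁, …, y₀, y₁, …)`. -/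
def comulHom : SymFun K →ₐ[K] SymFun K ⊗[K] SymFun K :=
  (AlgEquiv.ofInjective (tensorToSeries K) tensorToSeries_injective).symm.toAlgHom.comp
    ((double K).codRestrict _ double_mem)

/-- The counit of `Λ`: the constant term. -/
def counitHom : SymFun K →ₐ[K] K where
  __ := (constantCoeff (R := K)).comp (val K).toRingHom
  commutes' r := by
    change constantCoeff (val K (algebraMap K _ r)) = r
    rw [AlgHom.commutes, MvPowerSeries.algebraMap_apply]
    simp

variable {K}

theorem tensorToSeries_comul (f : SymFun K) : tensorToSeries K (comulHom K f) = double K f :=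
  congrArg Subtype.val ((AlgEquiv.ofInjective (tensorToSeries K)
    tensorToSeries_injective).apply_symm_apply ((double K).codRestrict _ double_mem f))

theorem cf2_comul (s u) (f : SymFun K) : cf2 s u (comulHom K f) = cf K (uni s u) f := by
  rw [← coeff_tensorToSeries_rep, tensorToSeries_comul, coeff_double_rep]

/-- The tensor product of three coefficient functionals. -/
def cf3 (s u v : {s : Multiset ℕ // 0 ∉ s}) : SymFun K ⊗[K] (SymFun K ⊗[K] SymFun K) →ₗ[K] K :=
  LinearMap.mul' K K ∘ₗ TensorProduct.map (cf2 s u) (cf K v) ∘ₗ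
    (TensorProduct.assoc K _ _ _).symm.toLinearMap

theorem cf3_tmul (s u v) (f : SymFun K) (z : SymFun K ⊗[K] SymFun K) :
    cf3 s u v (f ⊗ₜ z) = cf K s f * cf2 u v z := by
  induction z with
  | zero => simp
  | add x y hx hy => rw [TensorProduct.tmul_add, map_add, map_add, hx, hy, mul_add]
  | tmul f g => simp [cf3, cf2_tmul, mul_assoc]

theorem cf3_assoc_tmul (s u v) (z : SymFun K ⊗[K] SymFun K) (f : SymFun K) :
    cf3 s u v (TensorProduct.assoc K _ _ _ (z ⊗ₜ f)) = cf2 s u z * cf K v f := by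
  simp [cf3]

theorem ext3 {z z' : SymFun K ⊗[K] (SymFun K ⊗[K] SymFun K)}
    (h : ∀ s u v, cf3 s u v z = cf3 s u v z') : z = z' := by
  have hb : ∀ s u v (z : SymFun K ⊗[K] (SymFun K ⊗[K] SymFun K)), cf3 s u v z =
      ((mono K).tensorProduct ((mono K).tensorProduct (mono K))).repr z (s, (u, v)) := by
    intro s u v z
    induction z with
    | zero => simp
    | add x y hx hy => simp [hx, hy]
    | tmul f g =>
      rw [cf3_tmul, cf2_eq_repr, Module.Basis.tensorProduct_repr_tmul_apply, mono_repr, mul_comm]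
      rfl
  apply ((mono K).tensorProduct ((mono K).tensorProduct (mono K))).repr.injective
  ext ⟨s, u, v⟩
  rw [← hb, ← hb, h]

theorem ext1 {f g : SymFun K} (h : ∀ s, cf K s f = cf K s g) : f = g := by
  apply (mono K).repr.injective
  ext s
  exact h s

theorem counitHom_eq (f : SymFun K) : counitHom K f = cf K ⟨0, Multiset.notMem_zero 0⟩ f := by
  change constantCoeff (val K f) = _
  rw [← coeff_zero_eq_constantCoeff_apply, coeff_eq_cf]
  rfl

instance : Bialgebra K (SymFun K) := Bialgebra.ofAlgHom (comulHom K) (counitHom K)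
  (AlgHom.ext fun f => ext3 fun s u v => by
    have h1 : ∀ z : SymFun K ⊗[K] SymFun K, cf3 s u v
        (TensorProduct.assoc K _ _ _ (Algebra.TensorProduct.map (comulHom K) (.id K _) z)) =
        cf2 (uni s u) v z := fun z => by
      induction z with
      | zero => simp
      | add x y hx hy => simp only [map_add, hx, hy]
      | tmul f g =>
        rw [Algebra.TensorProduct.map_tmul, cf3_assoc_tmul, cf2_comul, cf2_tmul, AlgHom.id_apply]
    have h2 : ∀ z : SymFun K ⊗[K] SymFun K, cf3 s u v
        (Algebra.TensorProduct.map (.id K _) (comulHom K) z) = cf2 s (uni u v) z := fun z => by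
      induction z with
      | zero => simp
      | add x y hx hy => simp only [map_add, hx, hy]
      | tmul f g =>
        rw [Algebra.TensorProduct.map_tmul, cf3_tmul, cf2_comul, cf2_tmul, AlgHom.id_apply]
    refine (h1 _).trans (Eq.trans ?_ (h2 _).symm)
    refine (cf2_comul _ _ f).trans (Eq.trans ?_ (cf2_comul _ _ f).symm)
    congr 2
    exact Subtype.ext (add_assoc _ _ _))
  (AlgHom.ext fun f => (Algebra.TensorProduct.lid K (SymFun K)).injective (ext1 fun u => by
    have h1 : ∀ z : SymFun K ⊗[K] SymFun K, cf K u (Algebra.TensorProduct.lid K (SymFun K)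
        (Algebra.TensorProduct.map (counitHom K) (.id K _) z)) =
        cf2 ⟨0, Multiset.notMem_zero 0⟩ u z := fun z => by
      induction z with
      | zero => simp
      | add x y hx hy => simp only [map_add, hx, hy]
      | tmul f g => simp [cf2_tmul, counitHom_eq]
    refine (h1 _).trans ?_
    refine (cf2_comul _ _ f).trans ?_
    refine Eq.trans ?_ (congrArg (cf K u) (AlgEquiv.apply_symm_apply _ f).symm)
    simp [uni]))
  (AlgHom.ext fun f => (Algebra.TensorProduct.rid K K (SymFun K)).injective (ext1 fun u => by
    have h1 : ∀ z : SymFun K ⊗[K] SymFun K, cf K u (Algebra.TensorProduct.rid K K (SymFun K)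
        (Algebra.TensorProduct.map (.id K _) (counitHom K) z)) =
        cf2 u ⟨0, Multiset.notMem_zero 0⟩ z := fun z => by
      induction z with
      | zero => simp
      | add x y hx hy => simp only [map_add, hx, hy]
      | tmul f g => simp [cf2_tmul, counitHom_eq, mul_comm]
    refine (h1 _).trans ?_
    refine (cf2_comul _ _ f).trans ?_
    refine Eq.trans ?_ (congrArg (cf K u) (AlgEquiv.apply_symm_apply _ f).symm)
    simp [uni]))

variable (K)

/-- The homogeneous component of degree `n` of `Λ`. -/
def deg (n : ℕ) : Submodule K (SymFun K) where
  carrier := {f | ∀ e : ℕ →₀ ℕ, e.degree ≠ n → coeff e (val K f) = 0}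
  zero_mem' e _ := by rw [map_zero, map_zero]
  add_mem' {f g} hf hg e he := by
    rw [map_add, map_add, hf e he, hg e he, add_zero]
  smul_mem' c f hf e he := by
    rw [map_smul, map_smul, hf e he, smul_zero]

/-- The complete symmetric function `h_n`, the sum of all monomials of degree `n`. -/
def h (n : ℕ) : SymFun K :=
  ofTyp (fun s => if s.sum = n then 1 else 0) n fun s hs => if_neg hs.ne'

/-- The Kostka number `K_{λμ}`: the number of semistandard tableaux of shape `λ` in which, for each
`i`, the number of entries `i` is the `i`-th part of the partition `μ`. -/
def kostka (l : YoungDiagram) (s : Multiset ℕ) : ℕ :=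
  Nat.card {T : SemistandardYoungTableau l // ∀ i,
    (l.cells.filter fun c => T c.1 c.2 = i).card = (s.sort (· ≥ ·)).getD i 0}

theorem kostka_eq_zero (l : YoungDiagram) (s : Multiset ℕ) (hs : l.card < s.sum) :
    kostka l s = 0 := by
  have : IsEmpty {T : SemistandardYoungTableau l // ∀ i,
      (l.cells.filter fun c => T c.1 c.2 = i).card = (s.sort (· ≥ ·)).getD i 0} := by
    refine ⟨fun ⟨T, hT⟩ => not_le.2 hs ?_⟩
    calc s.sum = (s.sort (· ≥ ·)).sum := by rw [← Multiset.sum_coe, Multiset.sort_eq]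
      _ = ∑ i ∈ Finset.range (s.sort (· ≥ ·)).length, (s.sort (· ≥ ·)).getD i 0 := by
        rw [Finset.sum_range, ← List.sum_ofFn]
        congr 1
        refine List.ext_getElem (by simp) fun i h1 h2 => ?_
        simp
      _ = ∑ i ∈ Finset.range (s.sort (· ≥ ·)).length,
          (l.cells.filter fun c => T c.1 c.2 = i).card := Finset.sum_congr rfl fun i _ => (hT i).symm
      _ ≤ l.card := by
        rw [← Finset.card_biUnion]
        · exact Finset.card_le_card (Finset.biUnion_subset.2 fun i _ => Finset.filter_subset _ _)
        · intro i _ j _ hij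
          rw [Function.onFun, Finset.disjoint_filter]
          rintro c _ rfl h; exact hij h
  exact Nat.card_of_isEmpty

/-- The Schur function `s_λ = ∑ K_{λμ} m_μ`, the sum being over the partitions `μ`: the coefficient
of a monomial is the Kostka number of the partition formed by its non-zero exponents. -/
def schur (l : YoungDiagram) : SymFun K :=
  ofTyp (fun s => (kostka l s : K)) l.card fun _ hs => by rw [kostka_eq_zero l _ hs, Nat.cast_zero]

end
end SymFun

/-- The algebra `Λ(B)` of coloured symmetric functions, the tensor product of a family of copies
of `Λ` indexed by `B`. -/
def ColSym (K B : Type*) [CommRing K] : Type _ := ⨂[K] _ : B, SymFun K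

namespace ColSym

noncomputable section

variable (K : Type*) {B : Type*} [CommRing K]

instance : CommRing (ColSym K B) := inferInstanceAs (CommRing (⨂[K] _ : B, SymFun K))
instance : Algebra K (ColSym K B) := inferInstanceAs (Algebra K (⨂[K] _ : B, SymFun K))

variable [DecidableEq B]

/-- The map `f ↦ f(b)` from `Λ` to its copy `Λ(b)` in `Λ(B)`. -/
def single (b : B) : SymFun K →ₐ[K] ColSym K B :=
  PiTensorProduct.singleAlgHom (R := K) (A := fun _ : B => SymFun K) b

variable {K}

theorem algHom_ext [Finite B] {S : Type*} [Semiring S] [Algebra K S] {F G : ColSym K B →ₐ[K] S}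
    (h : ∀ b f, F (single K b f) = G (single K b f)) : F = G :=
  PiTensorProduct.algHom_ext (R := K) (A := fun _ : B => SymFun K)
    fun b => AlgHom.ext fun f => h b f

variable [Fintype B]

/-- The algebra homomorphism that is given on `Λ(b)` by `g b`. -/
def lift {S : Type*} [CommSemiring S] [Algebra K S] (g : B → SymFun K →ₐ[K] S) :
    ColSym K B →ₐ[K] S :=
  PiTensorProduct.liftAlgHom
    ((MultilinearMap.mkPiAlgebra K B S).compLinearMap fun b => (g b).toLinearMap)
    (by simp) (fun x y => by simp [Finset.prod_mul_distrib])

theorem lift_single {S : Type*} [CommSemiring S] [Algebra K S] (g : B → SymFun K →ₐ[K] S)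
    (b : B) (f : SymFun K) : lift g (single K b f) = g b f := by
  change PiTensorProduct.lift _ (PiTensorProduct.tprod K
    (MonoidHom.mulSingle (fun _ : B => SymFun K) b f)) = _
  rw [PiTensorProduct.lift.tprod]
  simp only [MultilinearMap.compLinearMap_apply, MultilinearMap.mkPiAlgebra_apply]
  rw [Finset.prod_eq_single b]
  · simp
  · intro c _ hc
    simp [hc]
  · simp

variable (K B)

/-- The coproduct of `Λ(B)`: on each `Λ(b)` it is the coproduct of `Λ`. -/
def comulHom : ColSym K B →ₐ[K] ColSym K B ⊗[K] ColSym K B :=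
  lift fun b => (Algebra.TensorProduct.map (single K b) (single K b)).comp
    (Bialgebra.comulAlgHom K (SymFun K))

/-- The counit of `Λ(B)`. -/
def counitHom : ColSym K B →ₐ[K] K := lift fun _ => Bialgebra.counitAlgHom K (SymFun K)

variable {K B}

theorem comulHom_single_apply (b : B) (f : SymFun K) : comulHom K B (single K b f) =
    TensorProduct.map (single K b).toLinearMap (single K b).toLinearMap (Coalgebra.comul f) :=
  lift_single _ b f

theorem counitHom_single_apply (b : B) (f : SymFun K) :
    counitHom K B (single K b f) = Coalgebra.counit f := lift_single _ b f

instance : Bialgebra K (ColSym K B) := Bialgebra.ofAlgHom (comulHom K B) (counitHom K B)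
  (algHom_ext fun b f => by
    have e1 : (comulHom K B).toLinearMap ∘ₗ (single K b).toLinearMap =
        TensorProduct.map (single K b).toLinearMap (single K b).toLinearMap ∘ₗ
          Coalgebra.comul := LinearMap.ext (comulHom_single_apply b)
    change TensorProduct.assoc K _ _ _ (TensorProduct.map (comulHom K B).toLinearMap
      LinearMap.id (comulHom K B (single K b f))) = TensorProduct.map LinearMap.id
        (comulHom K B).toLinearMap (comulHom K B (single K b f))
    rw [comulHom_single_apply, ← LinearMap.comp_apply (TensorProduct.map _ LinearMap.id),
      ← LinearMap.comp_apply (TensorProduct.map LinearMap.id _),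
      ← TensorProduct.map_comp, ← TensorProduct.map_comp, e1, LinearMap.id_comp]
    have h1 : TensorProduct.map (TensorProduct.map (single K b).toLinearMap
        (single K b).toLinearMap ∘ₗ Coalgebra.comul) (single K b).toLinearMap =
        TensorProduct.map (TensorProduct.map (single K b).toLinearMap
        (single K b).toLinearMap) (single K b).toLinearMap ∘ₗ
          TensorProduct.map Coalgebra.comul LinearMap.id := by
      rw [← TensorProduct.map_comp, LinearMap.comp_id]
    have h2 : TensorProduct.map (single K b).toLinearMap (TensorProduct.map
        (single K b).toLinearMap (single K b).toLinearMap ∘ₗ Coalgebra.comul) =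
        TensorProduct.map (single K b).toLinearMap (TensorProduct.map (single K b).toLinearMap
        (single K b).toLinearMap) ∘ₗ TensorProduct.map LinearMap.id Coalgebra.comul := by
      rw [← TensorProduct.map_comp, LinearMap.comp_id]
    rw [h1, h2, LinearMap.comp_apply, LinearMap.comp_apply, ← TensorProduct.map_map_assoc]
    congr 1
    exact Coalgebra.coassoc_apply f)
  (algHom_ext fun b f => by
    have e1 : (counitHom K B).toLinearMap ∘ₗ (single K b).toLinearMap = Coalgebra.counit :=
      LinearMap.ext (counitHom_single_apply b)
    change TensorProduct.map (counitHom K B).toLinearMap LinearMap.id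
      (comulHom K B (single K b f)) = 1 ⊗ₜ single K b f
    rw [comulHom_single_apply, ← LinearMap.comp_apply, ← TensorProduct.map_comp, e1,
      LinearMap.id_comp]
    have h1 : TensorProduct.map (Coalgebra.counit (R := K)) (single K b).toLinearMap =
        TensorProduct.map LinearMap.id (single K b).toLinearMap ∘ₗ
          LinearMap.rTensor _ (Coalgebra.counit (R := K) (A := SymFun K)) := by
      rw [LinearMap.rTensor, ← TensorProduct.map_comp, LinearMap.comp_id, LinearMap.id_comp]
    rw [h1, LinearMap.comp_apply, Coalgebra.rTensor_counit_comul, TensorProduct.map_tmul]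
    rfl)
  (algHom_ext fun b f => by
    have e1 : (counitHom K B).toLinearMap ∘ₗ (single K b).toLinearMap = Coalgebra.counit :=
      LinearMap.ext (counitHom_single_apply b)
    change TensorProduct.map LinearMap.id (counitHom K B).toLinearMap
      (comulHom K B (single K b f)) = single K b f ⊗ₜ 1
    rw [comulHom_single_apply, ← LinearMap.comp_apply, ← TensorProduct.map_comp, e1,
      LinearMap.id_comp]
    have h1 : TensorProduct.map (single K b).toLinearMap (Coalgebra.counit (R := K)) =
        TensorProduct.map (single K b).toLinearMap LinearMap.id ∘ₗ
          LinearMap.lTensor _ (Coalgebra.counit (R := K) (A := SymFun K)) := by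
      rw [LinearMap.lTensor, ← TensorProduct.map_comp, LinearMap.comp_id, LinearMap.id_comp]
    rw [h1, LinearMap.comp_apply, Coalgebra.lTensor_counit_comul, TensorProduct.map_tmul]
    rfl)

variable (K)

/-- The homogeneous component of degree `n` of `Λ(B)`: it is spanned by the products of
homogeneous elements of the `Λ(b)`, the sum of whose degrees is `n`. -/
def deg (B : Type*) [Fintype B] [DecidableEq B] (n : ℕ) : Submodule K (ColSym K B) :=
  Submodule.span K {x | ∃ (d : B → ℕ) (f : B → SymFun K),
    ∑ b, d b = n ∧ (∀ b, f b ∈ SymFun.deg K (d b)) ∧ x = ∏ b, single K b (f b)}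

/-- The function `s_λ = ∏ s_{λ_b}(b)` of a family `λ` of partitions. -/
def schur (l : B → YoungDiagram) : ColSym K B := ∏ b, single K b (SymFun.schur K (l b))

end
end ColSym

/-!
The elements of `𝓠(B)` are the elements of `𝓕(K B)` with coefficients that depend only on the
record tableaux (`StdTableau.mem_coplactic`). The proof therefore rests on the behaviour of record
tableaux under the operations by which products and coproducts are formed.

A coloured permutation is treated as the word of its coloured letters, and the record tableau of a
word is encoded by the sequence `rows` of the indices of the rows in which the new boxes appear.
Four properties of Schensted insertion are used. It is a bijection between words and pairs of a
tableau and an admissible sequence of row indices (`ins_rows_injective`, `exists_ins_rows`). Two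
words have the same insertion tableau if and only if they are Knuth equivalent (`knuth_iff`).
Standardisation does not change the sequence of rows (`rows_std`). The record tableau of a
permutation is the insertion tableau of its inverse (`tableaux_snd_eq_ins`, `ColPerm.record_line`),
so that the classes of coloured permutations with the same record tableaux correspond to the Knuth
classes of the inverses (`ColPerm.sameRecord_iff_knuth`).

The coefficient of a coloured permutation in a product `x y` is the sum, over all the ways to cut
its word into two parts, of the products of the coefficients of `x` and `y` at the standardised
parts (`FQSym.co_mul`). The record tableaux of a word determine those of its prefixes and of its
suffixes, the latter because Knuth equivalence is compatible with the restriction to an interval of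
letters (`rows_drop`). Hence `𝓠(B)` is closed under products. The coproduct is dual to the product,
and Knuth equivalence is compatible with concatenation; this gives the coproduct of `𝓠(B)`
(`StdTableau.co2_comul_eq`, `StdTableau.map_inc_comulQ`).

The coefficient of a monomial in `Θ(x)` is the sum of the coefficients of `x` at the
standardisations of all the words with the letters of this monomial (`StdTableau.coeffB_thetaMap`),
because the words with given record tableaux and given letters are in bijection with tableaux of
the given shapes. The multiplicativity of `Θ` is then immediate from the formula for the
coefficients of a product. Here it is used that all the coefficients of a Schur function count
tableaux (`SymFun.coeff_schur`), that is, that these numbers are symmetric. This follows from the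
Pieri rule (`series_mul_h`), itself a consequence of row bumping, which makes the generating series
of tableaux of a given shape a polynomial in the complete symmetric functions (`series_mem`). The
triangularity of the Kostka numbers shows that the Schur functions form a basis
(`SymFun.schurBasis`).

The Robinson-Schensted bijection and its symmetry give the values of `ϖ_tot` on the elements `t_T`
(`StdTableau.pairing_t`), and so the compatibility of `Θ` with the pairings. As `Θ` maps `y_{n,b}`
to `h_n(b)`, and these elements generate `Λ(B)`, it is surjective already on `𝓓(B)`. As the pairing
on `Λ(B)` is nondegenerate, the kernels are the radicals (`StdTableau.thetaMap_eq_zero_iff`).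

Finally, `Θ` is compatible with the coproducts. This is clear at the elements `y_{n,b}`, hence on
`𝓓(B)`. Moreover `𝓠(B)` is the sum of `𝓓(B)` and of the kernel of `Θ`, and `(Θ ⊗ Θ) ∘ Δ` vanishes
on this kernel, because the product is adjoint to the coproduct for `ϖ_tot`
(`StdTableau.map_theta_comul_eq_zero`).
-/

namespace RobinsonSchensted

/-! ### Row insertion -/

/-- The row `r` dominates the row `s` below it: `s` is not longer than `r`, and each entry of `s` is
larger than the entry of `r` above it. -/
def Dom : List ℕ → List ℕ → Prop
  | _, [] => True
  | [], _ :: _ => False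
  | a :: r, b :: s => a < b ∧ Dom r s

/-- A semistandard tableau, given by the list of its rows, none of which is empty. -/
def IsTab : List (List ℕ) → Prop
  | [] => True
  | r :: t => r ≠ [] ∧ r.Pairwise (· ≤ ·) ∧ Dom r (t.headD []) ∧ IsTab t

@[simp] theorem dom_nil (r : List ℕ) : Dom r [] := by cases r <;> trivial

@[simp] theorem dom_cons_cons {a b : ℕ} {r s : List ℕ} :
    Dom (a :: r) (b :: s) ↔ a < b ∧ Dom r s := Iff.rfl

theorem Dom.length_le : ∀ {r s : List ℕ}, Dom r s → s.length ≤ r.length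
  | _, [], _ => by simp
  | [], _ :: _, h => h.elim
  | _ :: r, _ :: s, h => by simpa using Dom.length_le h.2

theorem Dom.exists_lt : ∀ {r s : List ℕ} {a : ℕ}, Dom r s → a ∈ s → ∃ c ∈ r, c < a
  | [], _ :: _, _, h, _ => h.elim
  | _, [], _, _, ha => by simp at ha
  | c :: r, b :: s, a, h, ha => by
    rcases List.mem_cons.1 ha with rfl | ha
    · exact ⟨c, by simp, h.1⟩
    · obtain ⟨d, hd, hda⟩ := Dom.exists_lt h.2 ha
      exact ⟨d, by simp [hd], hda⟩

theorem Dom.getD_lt : ∀ {r s : List ℕ}, Dom r s → ∀ j, j < s.length → r.getD j 0 < s.getD j 0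
  | [], _ :: _, h, _, _ => h.elim
  | _, [], _, _, hj => by simp at hj
  | a :: r, b :: s, h, 0, _ => by simpa using h.1
  | a :: r, b :: s, h, j + 1, hj => by simpa using h.2.getD_lt j (by simpa using hj)

theorem dom_of_getD : ∀ {r s : List ℕ}, s.length ≤ r.length →
    (∀ j, j < s.length → r.getD j 0 < s.getD j 0) → Dom r s
  | _, [], _, _ => by simp
  | [], b :: s, h, _ => by simp at h
  | a :: r, b :: s, h, h' => ⟨by simpa using h' 0 (by simp),
      dom_of_getD (by simpa using h) fun j hj => by simpa using h' (j + 1) (by simpa using hj)⟩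

theorem Dom.prefix : ∀ {r s r' : List ℕ}, Dom (r ++ r') s → s.length ≤ r.length → Dom r s
  | _, [], _, _, _ => by simp
  | [], b :: s, _, _, h => by simp at h
  | a :: r, b :: s, _, h, h' => ⟨h.1, Dom.prefix h.2 (by simpa using h')⟩

theorem Dom.append : ∀ {r s : List ℕ} (r' : List ℕ), Dom r s → Dom (r ++ r') s
  | _, [], _, _ => by simp
  | a :: r, b :: s, r', h => ⟨h.1, Dom.append r' h.2⟩

theorem rowInsert_cons_of_lt {x y : ℕ} {r : List ℕ} (h : x < y) :
    rowInsert x (y :: r) = (x :: r, some y) := by simp [rowInsert, h]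

theorem rowInsert_cons_of_le {x y : ℕ} {r : List ℕ} (h : y ≤ x) :
    rowInsert x (y :: r) = (y :: (rowInsert x r).1, (rowInsert x r).2) := by
  simp [rowInsert, not_lt.2 h]

/-- Row insertion either appends a letter or replaces the leftmost larger one. -/
theorem rowInsert_cases : ∀ (x : ℕ) (r : List ℕ),
    ((∀ z ∈ r, z ≤ x) ∧ rowInsert x r = (r ++ [x], none)) ∨
    ∃ u y v, r = u ++ y :: v ∧ (∀ z ∈ u, z ≤ x) ∧ x < y ∧ rowInsert x r = (u ++ x :: v, some y)
  | x, [] => Or.inl (by simp [rowInsert])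
  | x, a :: r => by
    by_cases h : x < a
    · exact Or.inr ⟨[], a, r, by simp [rowInsert_cons_of_lt h, h]⟩
    · rw [rowInsert_cons_of_le (not_lt.1 h)]
      rcases rowInsert_cases x r with ⟨h1, h2⟩ | ⟨u, y, v, rfl, h1, h2, h3⟩
      · exact Or.inl ⟨by simpa [not_lt.1 h] using h1, by simp [h2]⟩
      · exact Or.inr ⟨a :: u, y, v, by simpa [h3, h2, not_lt.1 h] using h1⟩

theorem rowInsert_lt {x y : ℕ} {r r' : List ℕ} (h : rowInsert x r = (r', some y)) : x < y := by
  rcases rowInsert_cases x r with ⟨_, h2⟩ | ⟨u, z, v, rfl, _, h2, h3⟩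
  · simp [h2] at h
  · rw [h3] at h; simp only [Prod.mk.injEq, Option.some.injEq] at h; omega

theorem rowInsert_perm_some {x y : ℕ} {r r' : List ℕ} (h : rowInsert x r = (r', some y)) :
    (y :: r').Perm (x :: r) := by
  rcases rowInsert_cases x r with ⟨_, h2⟩ | ⟨u, z, v, rfl, _, h2, h3⟩
  · simp [h2] at h
  · rw [h3] at h; simp only [Prod.mk.injEq, Option.some.injEq] at h
    obtain ⟨rfl, rfl⟩ := h
    exact (List.perm_middle.cons z).trans ((List.Perm.swap _ _ _).trans
      (List.perm_middle.symm.cons x))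

theorem rowInsert_none {x : ℕ} {r r' : List ℕ} (h : rowInsert x r = (r', none)) :
    r' = r ++ [x] ∧ ∀ z ∈ r, z ≤ x := by
  rcases rowInsert_cases x r with ⟨h1, h2⟩ | ⟨u, z, v, rfl, _, h2, h3⟩
  · rw [h2] at h; simp only [Prod.mk.injEq, and_true] at h; exact ⟨h.symm, h1⟩
  · simp [h3] at h

theorem rowInsert_length {x y : ℕ} {r r' : List ℕ} (h : rowInsert x r = (r', some y)) :
    r'.length = r.length := by
  have := (rowInsert_perm_some h).length_eq
  simpa using this

theorem rowInsert_sorted {x : ℕ} {r : List ℕ} (hr : r.Pairwise (· ≤ ·)) :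
    (rowInsert x r).1.Pairwise (· ≤ ·) := by
  rcases rowInsert_cases x r with ⟨h1, h2⟩ | ⟨u, y, v, rfl, h1, h2, h3⟩
  · rw [h2]; simp only [List.pairwise_append]; exact ⟨hr, by simp, by simpa using h1⟩
  · rw [h3]
    simp only [List.pairwise_append, List.pairwise_cons, List.mem_cons] at hr ⊢
    refine ⟨hr.1, ⟨fun z hz => h2.le.trans (hr.2.1.1 z hz), hr.2.1.2⟩, ?_⟩
    rintro a ha b (rfl | hb)
    · exact h1 a ha
    · exact hr.2.2 a ha b (Or.inr hb)

theorem rowInsert_ne_nil (x : ℕ) (r : List ℕ) : (rowInsert x r).1 ≠ [] := by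
  cases r with
  | nil => simp [rowInsert]
  | cons a r => rw [rowInsert]; split <;> simp

/-- Row insertion lowers the entries of a row. -/
theorem Dom.rowInsert_left : ∀ {x : ℕ} {r s : List ℕ}, Dom r s → Dom (rowInsert x r).1 s
  | _, _, [], _ => by simp
  | x, a :: r, b :: s, h => by
    by_cases hx : x < a
    · rw [rowInsert_cons_of_lt hx]; exact ⟨hx.trans h.1, h.2⟩
    · rw [rowInsert_cons_of_le (not_lt.1 hx)]; exact ⟨h.1, h.2.rowInsert_left⟩

/-- After the insertion of a letter into `r` and of the bumped letter into the row `s` below `r`,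
the columns are still increasing. -/
theorem Dom.rowInsert_both : ∀ {x y : ℕ} {r r' s : List ℕ}, Dom r s →
    rowInsert x r = (r', some y) → Dom r' (rowInsert y s).1
  | x, y, [], r', s, _, h' => by simp [rowInsert] at h'
  | x, y, a :: r, r', s, h, h' => by
    by_cases hx : x < a
    · rw [rowInsert_cons_of_lt hx] at h'
      simp only [Prod.mk.injEq, Option.some.injEq] at h'
      obtain ⟨rfl, rfl⟩ := h'
      cases s with
      | nil => simp [rowInsert, hx]
      | cons b s => rw [rowInsert_cons_of_lt h.1]; exact ⟨hx, h.2⟩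
    · rw [rowInsert_cons_of_le (not_lt.1 hx)] at h'
      simp only [Prod.mk.injEq] at h'
      obtain ⟨rfl, h2⟩ := h'
      have h3 : rowInsert x r = ((rowInsert x r).1, some y) :=
        Prod.ext rfl h2
      have hy := rowInsert_lt h3
      cases s with
      | nil => simp [rowInsert]; omega
      | cons b s =>
        by_cases hb : y < b
        · rw [rowInsert_cons_of_lt hb]; exact ⟨by omega, h.2.rowInsert_left⟩
        · rw [rowInsert_cons_of_le (not_lt.1 hb)]; exact ⟨h.1, h.2.rowInsert_both h3⟩

/-! ### Insertion into a tableau -/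

theorem insert_nil (x : ℕ) : insert x [] = ([[x]], 0) := rfl

theorem insert_cons_none {x : ℕ} {r r' : List ℕ} {t : List (List ℕ)}
    (h : rowInsert x r = (r', none)) : insert x (r :: t) = (r' :: t, 0) := by
  rw [insert, h]

theorem insert_cons_some {x y : ℕ} {r r' : List ℕ} {t : List (List ℕ)}
    (h : rowInsert x r = (r', some y)) :
    insert x (r :: t) = (r' :: (insert y t).1, (insert y t).2 + 1) := by
  rw [insert, h]

/-- The first row after an insertion. -/
theorem insert_headD (x : ℕ) (t : List (List ℕ)) :
    (insert x t).1.headD [] = (rowInsert x (t.headD [])).1 := by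
  cases t with
  | nil => simp [insert_nil, rowInsert]
  | cons r t =>
    rcases h : rowInsert x r with ⟨r', _ | y⟩
    · simp [insert_cons_none h, h]
    · simp [insert_cons_some h, h]

theorem isTab_insert : ∀ {x : ℕ} {t : List (List ℕ)}, IsTab t → IsTab (insert x t).1
  | x, [], _ => by simp [insert_nil, IsTab]
  | x, r :: t, h => by
    obtain ⟨h1, h2, h3, h4⟩ := h
    have hs := rowInsert_sorted (x := x) h2
    have hn := rowInsert_ne_nil x r
    rcases hr : rowInsert x r with ⟨r', _ | y⟩
    · rw [insert_cons_none hr]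
      rw [hr] at hs hn
      refine ⟨hn, hs, ?_, h4⟩
      rw [(rowInsert_none hr).1]
      exact h3.append _
    · rw [insert_cons_some hr]
      rw [hr] at hs hn
      exact ⟨hn, hs, by rw [insert_headD]; exact h3.rowInsert_both hr, isTab_insert h4⟩

/-- The insertion tableau of a word. -/
def ins (w : List ℕ) : List (List ℕ) := w.foldl (fun t x => (insert x t).1) []

/-- The sequence of the indices of the rows in which the new boxes appear, when the letters of a
word are inserted into `t` successively. -/
def rowsFrom : List (List ℕ) → List ℕ → List ℕ
  | _, [] => []
  | t, x :: w => (insert x t).2 :: rowsFrom (insert x t).1 w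

/-- The sequence of the indices of the rows in which the new boxes appear at the insertion of the
letters of a word; it encodes the record tableau. -/
def rows (w : List ℕ) : List ℕ := rowsFrom [] w

@[simp] theorem ins_nil : ins [] = [] := rfl
@[simp] theorem rows_nil : rows [] = [] := rfl

theorem ins_snoc (w : List ℕ) (x : ℕ) : ins (w ++ [x]) = (insert x (ins w)).1 := by
  simp [ins]

theorem ins_append (u v : List ℕ) :
    ins (u ++ v) = v.foldl (fun t x => (insert x t).1) (ins u) := by simp [ins]

theorem rowsFrom_append (u v : List ℕ) : ∀ t, rowsFrom t (u ++ v) =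
    rowsFrom t u ++ rowsFrom (u.foldl (fun t x => (insert x t).1) t) v := by
  induction u with
  | nil => intro t; simp [rowsFrom]
  | cons x u ih => intro t; simp [rowsFrom, ih]

theorem rows_append (u v : List ℕ) : rows (u ++ v) = rows u ++ rowsFrom (ins u) v :=
  rowsFrom_append u v []

theorem rows_snoc (w : List ℕ) (x : ℕ) : rows (w ++ [x]) = rows w ++ [(insert x (ins w)).2] := by
  rw [rows_append]; rfl

@[simp] theorem length_rowsFrom (w : List ℕ) : ∀ t, (rowsFrom t w).length = w.length := by
  induction w with
  | nil => intro t; rfl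
  | cons x w ih => intro t; simp [rowsFrom, ih]

@[simp] theorem length_rows (w : List ℕ) : (rows w).length = w.length := length_rowsFrom w []

theorem isTab_ins (w : List ℕ) : IsTab (ins w) := by
  induction w using List.reverseRecOn with
  | nil => trivial
  | append_singleton w x ih => rw [ins_snoc]; exact isTab_insert ih

theorem insert_perm : ∀ (x : ℕ) (t : List (List ℕ)),
    (insert x t).1.flatten.Perm (x :: t.flatten)
  | x, [] => by simp [insert_nil]
  | x, r :: t => by
    rcases hr : rowInsert x r with ⟨r', _ | y⟩
    · rw [insert_cons_none hr, (rowInsert_none hr).1]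
      simp only [List.flatten_cons, List.append_assoc, List.singleton_append]
      exact List.perm_middle
    · rw [insert_cons_some hr]
      simp only [List.flatten_cons]
      refine ((insert_perm y t).append_left r').trans (List.perm_middle.trans ?_)
      exact (rowInsert_perm_some hr).append_right t.flatten

theorem ins_perm (w : List ℕ) : (ins w).flatten.Perm w := by
  induction w using List.reverseRecOn with
  | nil => simp
  | append_singleton w x ih =>
    rw [ins_snoc]
    exact (insert_perm _ _).trans ((ih.cons x).trans (List.perm_append_singleton x w).symm)

/-! ### Shapes and corners -/

/-- Add a box at the end of the `i`-th row of a shape, given by the list of the row lengths. -/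
def addShape : ℕ → List ℕ → List ℕ
  | _, [] => [1]
  | 0, a :: s => (a + 1) :: s
  | i + 1, a :: s => a :: addShape i s

/-- The last box of the `i`-th row can be removed from a shape. -/
def Corner : ℕ → List ℕ → Prop
  | _, [] => False
  | 0, a :: s => s.headD 0 < a
  | i + 1, _ :: s => Corner i s

theorem map_length_insert : ∀ (x : ℕ) (t : List (List ℕ)),
    (insert x t).1.map List.length = addShape (insert x t).2 (t.map List.length)
  | x, [] => by simp [insert_nil, addShape]
  | x, r :: t => by
    rcases hr : rowInsert x r with ⟨r', _ | y⟩
    · rw [insert_cons_none hr, (rowInsert_none hr).1]; simp [addShape]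
    · rw [insert_cons_some hr]
      simp [addShape, rowInsert_length hr, map_length_insert y t]

theorem map_length_ins (w : List ℕ) :
    (ins w).map List.length = (rows w).foldl (fun s i => addShape i s) [] := by
  induction w using List.reverseRecOn with
  | nil => rfl
  | append_singleton w x ih => rw [ins_snoc, rows_snoc, map_length_insert, ih]; simp

theorem insert_row_le : ∀ (x : ℕ) (t : List (List ℕ)), (insert x t).2 ≤ t.length
  | x, [] => by simp [insert_nil]
  | x, r :: t => by
    rcases hr : rowInsert x r with ⟨r', _ | y⟩
    · rw [insert_cons_none hr]; simp
    · rw [insert_cons_some hr]; simpa using insert_row_le y t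

theorem IsTab.corner_insert : ∀ {x : ℕ} {t : List (List ℕ)}, IsTab t →
    Corner (insert x t).2 ((insert x t).1.map List.length)
  | x, [], _ => by simp [insert_nil, Corner]
  | x, r :: t, h => by
    obtain ⟨h1, h2, h3, h4⟩ := h
    rcases hr : rowInsert x r with ⟨r', _ | y⟩
    · rw [insert_cons_none hr, (rowInsert_none hr).1]
      have := h3.length_le
      cases t <;> simp_all [Corner]
    · rw [insert_cons_some hr]; exact h4.corner_insert

theorem addShape_ne_nil (i : ℕ) (s : List ℕ) : addShape i s ≠ [] := by
  cases s <;> cases i <;> simp [addShape]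

theorem addShape_injective : ∀ {i : ℕ} {s s' : List ℕ}, 0 ∉ s → 0 ∉ s' →
    addShape i s = addShape i s' → s = s'
  | _, [], [], _, _, _ => rfl
  | 0, [], a :: s', _, h, h' => by simp [addShape] at h'; simp [h'.1] at h
  | 0, a :: s, [], h, _, h' => by simp [addShape] at h'; simp [h'.1] at h
  | 0, a :: s, a' :: s', _, _, h' => by simpa [addShape] using h'
  | i + 1, [], a :: s', _, h, h' => by
    simp only [addShape, List.cons.injEq] at h'
    exact absurd h'.2.symm (addShape_ne_nil _ _)
  | i + 1, a :: s, [], h, _, h' => by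
    simp only [addShape, List.cons.injEq] at h'
    exact absurd h'.2 (addShape_ne_nil _ _)
  | i + 1, a :: s, a' :: s', h1, h2, h' => by
    simp only [addShape, List.cons.injEq] at h'
    simp only [List.mem_cons, not_or] at h1 h2
    rw [h'.1, addShape_injective h1.2 h2.2 h'.2]

theorem IsTab.zero_notMem : ∀ {t : List (List ℕ)}, IsTab t → 0 ∉ t.map List.length
  | [], _ => by simp
  | r :: t, h => by
    have := h.2.2.2.zero_notMem
    have h1 := h.1
    simp only [List.map_cons, List.mem_cons, not_or]
    exact ⟨fun h' => h1 (List.length_eq_zero_iff.1 h'.symm), this⟩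

/-! ### Reverse insertion -/

/-- Reverse row insertion: `y` replaces the rightmost smaller entry of a row. -/
theorem exists_rowInsert_eq : ∀ {y a : ℕ} {r' : List ℕ}, (a :: r').Pairwise (· ≤ ·) → a < y →
    ∃ x r, r.Pairwise (· ≤ ·) ∧ rowInsert x r = (a :: r', some y) ∧ (∀ z ∈ r, a ≤ z)
  | y, a, [], _, h => ⟨a, [y], by simp, by rw [rowInsert_cons_of_lt h], by simp; omega⟩
  | y, a, b :: r', hs, h => by
    by_cases hb : b < y
    · obtain ⟨x, r, h1, h2, h3⟩ := exists_rowInsert_eq (List.Pairwise.of_cons hs) hb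
      have hab : a ≤ b := (List.pairwise_cons.1 hs).1 b (by simp)
      have hx : b ≤ x := by
        have := (rowInsert_perm_some h2).mem_iff (a := x)
        have hx : x ∈ y :: b :: r' := this.2 (by simp)
        rcases List.mem_cons.1 hx with rfl | hx
        · omega
        · rcases List.mem_cons.1 hx with rfl | hx
          · exact le_rfl
          · exact (List.pairwise_cons.1 (List.Pairwise.of_cons hs)).1 x hx
      refine ⟨x, a :: r, List.pairwise_cons.2 ⟨fun z hz => hab.trans (h3 z hz), h1⟩, ?_, ?_⟩
      · rw [rowInsert_cons_of_le (hab.trans hx), h2]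
      · simp only [List.mem_cons, forall_eq_or_imp, le_refl, true_and]
        exact fun z hz => hab.trans (h3 z hz)
    · have hs' := List.pairwise_cons.1 hs
      have hs'' := List.pairwise_cons.1 hs'.2
      refine ⟨a, y :: b :: r', List.pairwise_cons.2 ⟨?_, hs'.2⟩, rowInsert_cons_of_lt h, ?_⟩
      · intro z hz
        rcases List.mem_cons.1 hz with rfl | hz
        · omega
        · exact (not_lt.1 hb).trans (hs''.1 z hz)
      · intro z hz
        rcases List.mem_cons.1 hz with rfl | hz
        · omega
        · exact hs'.1 z hz

theorem dom_of_rowInsert_left : ∀ {x y : ℕ} {r r' s : List ℕ}, rowInsert x r = (r', some y) →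
    Dom r' s → (∀ z ∈ s, y < z) → Dom r s
  | _, _, _, _, [], _, _, _ => by simp
  | x, y, [], _, b :: s, h, _, _ => by simp [rowInsert] at h
  | x, y, a :: r, r', b :: s, h, hd, hy => by
    by_cases hx : x < a
    · rw [rowInsert_cons_of_lt hx] at h
      simp only [Prod.mk.injEq, Option.some.injEq] at h
      obtain ⟨rfl, rfl⟩ := h
      exact ⟨hy b (by simp), hd.2⟩
    · rw [rowInsert_cons_of_le (not_lt.1 hx)] at h
      simp only [Prod.mk.injEq] at h
      obtain ⟨rfl, h2⟩ := h
      exact ⟨hd.1, dom_of_rowInsert_left (Prod.ext rfl h2) hd.2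
        fun z hz => hy z (by simp [hz])⟩

/-- Reverse insertion keeps the columns increasing. -/
theorem dom_of_rowInsert : ∀ {x y : ℕ} {r r' s : List ℕ}, r.Pairwise (· ≤ ·) →
    s.Pairwise (· ≤ ·) → rowInsert x r = (r', some y) → Dom r' (rowInsert y s).1 → Dom r s
  | _, _, _, _, [], _, _, _, _ => by simp
  | x, y, [], _, b :: s, _, _, h, _ => by simp [rowInsert] at h
  | x, y, a :: r, r', b :: s, hr, hs, h, hd => by
    rw [List.pairwise_cons] at hr hs
    by_cases hx : x < a
    · rw [rowInsert_cons_of_lt hx] at h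
      simp only [Prod.mk.injEq, Option.some.injEq] at h
      obtain ⟨rfl, rfl⟩ := h
      by_cases hb : a < b
      · rw [rowInsert_cons_of_lt hb] at hd
        exact ⟨hb, hd.2⟩
      · rw [rowInsert_cons_of_le (not_lt.1 hb)] at hd
        have ha : a ∈ (rowInsert a s).1 := by
          rcases rowInsert_cases a s with ⟨_, h2⟩ | ⟨u, y, v, rfl, _, _, h3⟩ <;> simp [*]
        obtain ⟨c, hc, hca⟩ := hd.2.exists_lt ha
        exact absurd hca (not_lt.2 (hr.1 c hc))
    · rw [rowInsert_cons_of_le (not_lt.1 hx)] at h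
      simp only [Prod.mk.injEq] at h
      obtain ⟨rfl, h2⟩ := h
      have h3 : rowInsert x r = ((rowInsert x r).1, some y) := Prod.ext rfl h2
      have hxy := rowInsert_lt h3
      by_cases hb : y < b
      · rw [rowInsert_cons_of_lt hb] at hd
        exact ⟨by omega, dom_of_rowInsert_left h3 hd.2 fun z hz => hb.trans_le (hs.1 z hz)⟩
      · rw [rowInsert_cons_of_le (not_lt.1 hb)] at hd
        exact ⟨hd.1, dom_of_rowInsert hr.2 hs.2 h3 hd.2⟩

/-- Every removal of a corner box from a tableau reverses an insertion. -/
theorem exists_insert_eq : ∀ {i : ℕ} {t' : List (List ℕ)}, IsTab t' →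
    Corner i (t'.map List.length) → ∃ x t, IsTab t ∧ insert x t = (t', i)
  | _, [], _, h => by simp [Corner] at h
  | 0, r :: s, h, hc => by
    obtain ⟨h1, h2, h3, h4⟩ := h
    obtain ⟨r0, x, rfl⟩ := (List.eq_nil_or_concat' r).resolve_left h1
    rw [List.pairwise_append] at h2
    by_cases hr0 : r0 = []
    · subst hr0
      have hs : s = [] := by
        cases s with
        | nil => rfl
        | cons r' s =>
          simp only [List.nil_append, List.map_cons, List.length_cons, List.length_nil, Corner,
            List.headD_cons] at hc
          exact absurd (List.length_eq_zero_iff.1 (by omega)) h4.1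
      subst hs
      exact ⟨x, [], trivial, rfl⟩
    · have hlen : (s.headD []).length ≤ r0.length := by
        cases s with
        | nil => simp
        | cons r' s => simp [Corner] at hc ⊢; omega
      refine ⟨x, r0 :: s, ⟨hr0, h2.1, h3.prefix hlen, h4⟩, ?_⟩
      rcases rowInsert_cases x r0 with ⟨h5, h6⟩ | ⟨u, y, v, rfl, h5, h6, h7⟩
      · exact insert_cons_none h6
      · have := h2.2.2 y (by simp) x (by simp)
        omega
  | i + 1, r' :: s', h, hc => by
    obtain ⟨h1, h2, h3, h4⟩ := h
    obtain ⟨y, s, hs, hs'⟩ := exists_insert_eq h4 (i := i) hc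
    have hh := insert_headD y s
    rw [hs'] at hh
    have hy : y ∈ s'.headD [] := by
      rw [hh]
      rcases rowInsert_cases y (s.headD []) with ⟨_, h2⟩ | ⟨u, _, v, _, _, _, h3⟩
      · rw [h2]; simp
      · rw [h3]; simp
    obtain ⟨a, r1, rfl⟩ := List.exists_cons_of_ne_nil h1
    have hay : a < y := by
      obtain ⟨c, hc, hcy⟩ := h3.exists_lt hy
      rcases List.mem_cons.1 hc with rfl | hc
      · exact hcy
      · exact ((List.pairwise_cons.1 h2).1 c hc).trans_lt hcy
    obtain ⟨x, r, hr, hxr, _⟩ := exists_rowInsert_eq h2 hay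
    have hsorted : (s.headD []).Pairwise (· ≤ ·) := by
      cases s with
      | nil => simp
      | cons q s => exact hs.2.1
    refine ⟨x, r :: s, ⟨?_, hr, ?_, hs⟩, ?_⟩
    · rintro rfl; simp [rowInsert] at hxr
    · exact dom_of_rowInsert hr hsorted hxr (by rw [← hh]; exact h3)
    · rw [insert_cons_some hxr, hs']

theorem rowInsert_injective : ∀ {x x' : ℕ} {r r' : List ℕ}, r.Pairwise (· ≤ ·) →
    r'.Pairwise (· ≤ ·) → rowInsert x r = rowInsert x' r' → x = x' ∧ r = r'
  | x, x', [], [], _, _, h => by simpa [rowInsert] using h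
  | x, x', [], a :: r, _, _, h => by
    by_cases hx : x' < a
    · simp [rowInsert, hx] at h
    · rw [rowInsert_cons_of_le (not_lt.1 hx)] at h
      simp only [rowInsert, Prod.mk.injEq, List.cons.injEq] at h
      exact absurd h.1.2.symm (rowInsert_ne_nil _ _)
  | x, x', a :: r, [], _, _, h => by
    by_cases hx : x < a
    · simp [rowInsert, hx] at h
    · rw [rowInsert_cons_of_le (not_lt.1 hx)] at h
      simp only [rowInsert, Prod.mk.injEq, List.cons.injEq] at h
      exact absurd h.1.2 (rowInsert_ne_nil _ _)
  | x, x', a :: r, a' :: r', h1, h2, h => by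
    rw [List.pairwise_cons] at h1 h2
    have key : ∀ {x x' a a' : ℕ} {r r' : List ℕ}, (∀ z ∈ r, a ≤ z) → x < a → a' ≤ x' →
        (x :: r, some a) = (a' :: (rowInsert x' r').1, (rowInsert x' r').2) → False := by
      intro x x' a a' r r' h1 hx hx' h
      simp only [Prod.mk.injEq, List.cons.injEq] at h
      have h3 : rowInsert x' r' = (r, some a) := Prod.ext h.1.2.symm h.2.symm
      have h4 := rowInsert_lt h3
      have h5 : x' ∈ a :: r := (rowInsert_perm_some h3).mem_iff.2 (by simp)
      rcases List.mem_cons.1 h5 with rfl | h5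
      · omega
      · have := h1 _ h5; omega
    by_cases hx : x < a <;> by_cases hx' : x' < a'
    · rw [rowInsert_cons_of_lt hx, rowInsert_cons_of_lt hx'] at h
      simp_all
    · rw [rowInsert_cons_of_lt hx, rowInsert_cons_of_le (not_lt.1 hx')] at h
      exact (key h1.1 hx (not_lt.1 hx') h).elim
    · rw [rowInsert_cons_of_le (not_lt.1 hx), rowInsert_cons_of_lt hx'] at h
      exact (key h2.1 hx' (not_lt.1 hx) h.symm).elim
    · rw [rowInsert_cons_of_le (not_lt.1 hx), rowInsert_cons_of_le (not_lt.1 hx')] at h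
      simp only [Prod.mk.injEq, List.cons.injEq] at h
      obtain ⟨e1, e2⟩ := rowInsert_injective h1.2 h2.2 (Prod.ext h.1.2 h.2)
      exact ⟨e1, by rw [e2, h.1.1]⟩

theorem insert_injective : ∀ {x x' : ℕ} {t t' : List (List ℕ)}, IsTab t → IsTab t' →
    insert x t = insert x' t' → x = x' ∧ t = t'
  | x, x', [], [], _, _, h => by simpa [insert_nil] using h
  | x, x', [], r :: t, _, h1, h => by
    rcases hr : rowInsert x' r with ⟨r', _ | y⟩
    · rw [insert_cons_none hr, insert_nil, (rowInsert_none hr).1] at h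
      cases r with
      | nil => exact absurd rfl h1.1
      | cons a r => simp at h
    · rw [insert_cons_some hr, insert_nil] at h
      simp at h
  | x, x', r :: t, [], h1, _, h => by
    rcases hr : rowInsert x r with ⟨r', _ | y⟩
    · rw [insert_cons_none hr, insert_nil, (rowInsert_none hr).1] at h
      cases r with
      | nil => exact absurd rfl h1.1
      | cons a r => simp at h
    · rw [insert_cons_some hr, insert_nil] at h
      simp at h
  | x, x', r :: t, r' :: t', h1, h2, h => by
    rcases hr : rowInsert x r with ⟨q, _ | y⟩ <;> rcases hr' : rowInsert x' r' with ⟨q', _ | y'⟩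
    · rw [insert_cons_none hr, insert_cons_none hr'] at h
      simp only [Prod.mk.injEq, List.cons.injEq, and_true] at h
      obtain ⟨rfl, rfl⟩ := h
      obtain ⟨rfl, rfl⟩ := rowInsert_injective h1.2.1 h2.2.1 (hr.trans hr'.symm)
      exact ⟨rfl, rfl⟩
    · rw [insert_cons_none hr, insert_cons_some hr'] at h
      simp at h
    · rw [insert_cons_some hr, insert_cons_none hr'] at h
      simp at h
    · rw [insert_cons_some hr, insert_cons_some hr'] at h
      simp only [Prod.mk.injEq, List.cons.injEq, Nat.add_right_cancel_iff] at h
      obtain ⟨rfl, rfl⟩ := insert_injective h1.2.2.2 h2.2.2.2 (Prod.ext h.1.2 h.2)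
      obtain ⟨rfl, rfl⟩ := rowInsert_injective h1.2.1 h2.2.1
        (hr.trans ((congrArg (·, some y) h.1.1).trans hr'.symm))
      exact ⟨rfl, rfl⟩

/-- A word is determined by its insertion tableau and its sequence of rows. -/
theorem ins_rows_injective {w w' : List ℕ} (h : ins w = ins w') (h' : rows w = rows w') :
    w = w' := by
  induction w using List.reverseRecOn generalizing w' with
  | nil =>
    have := congrArg List.length h'
    simp only [length_rows, List.length_nil] at this
    exact (List.length_eq_zero_iff.1 this.symm).symm
  | append_singleton w x ih =>
    obtain rfl | ⟨w', x', rfl⟩ := List.eq_nil_or_concat' w'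
    · have := congrArg List.length h'
      simp at this
    · rw [ins_snoc, ins_snoc] at h
      rw [rows_snoc, rows_snoc] at h'
      obtain ⟨h1, h2⟩ := List.append_inj' h' rfl
      obtain ⟨rfl, h3⟩ := insert_injective (isTab_ins w) (isTab_ins w')
        (Prod.ext h (List.singleton_injective h2))
      rw [ih h3 h1]

/-- Schensted's correspondence is surjective: any tableau, of the shape of the insertion tableau of
`w`, is the insertion tableau of a word with the same sequence of rows as `w`. -/
theorem exists_ins_rows (w : List ℕ) {t : List (List ℕ)} (ht : IsTab t)
    (h : t.map List.length = (ins w).map List.length) : ∃ v, ins v = t ∧ rows v = rows w := by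
  induction w using List.reverseRecOn generalizing t with
  | nil => exact ⟨[], by simpa using h.symm, rfl⟩
  | append_singleton w x ih =>
    rw [ins_snoc] at h
    have hc := (isTab_ins w).corner_insert (x := x)
    rw [← h] at hc
    obtain ⟨y, t1, ht1, hy⟩ := exists_insert_eq ht hc
    rw [map_length_insert] at h
    have h2 := map_length_insert y t1
    rw [hy, h] at h2
    obtain ⟨v, hv, hv'⟩ := ih ht1
      (addShape_injective ht1.zero_notMem (isTab_ins w).zero_notMem h2.symm)
    exact ⟨v ++ [y], by rw [ins_snoc, hv, hy], by rw [rows_snoc, rows_snoc, hv, hy, hv']⟩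

theorem corner_last : ∀ {s : List ℕ}, s ≠ [] → 0 ∉ s → Corner (s.length - 1) s
  | [a], _, h => by simp [Corner]; simp at h; omega
  | a :: b :: s, _, h => by
    simp only [List.length_cons, Nat.add_sub_cancel, Corner]
    exact corner_last (s := b :: s) (by simp) (by simp_all)

/-- Every tableau is an insertion tableau. -/
theorem exists_ins_eq {t : List (List ℕ)} (ht : IsTab t) : ∃ w, ins w = t := by
  induction h : t.flatten.length generalizing t with
  | zero =>
    cases t with
    | nil => exact ⟨[], rfl⟩
    | cons r t =>
      have := ht.1
      cases r <;> simp_all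
  | succ n ih =>
    have hne : t.map List.length ≠ [] := by rintro h'; simp at h'; simp [h'] at h
    obtain ⟨x, t1, ht1, hx⟩ := exists_insert_eq ht (corner_last hne ht.zero_notMem)
    have hp := (insert_perm x t1).length_eq
    rw [hx] at hp
    obtain ⟨w, rfl⟩ := ih ht1 (by simp at hp h ⊢; omega)
    exact ⟨w ++ [x], by rw [ins_snoc, hx]⟩

/-! ### Row bumping -/

theorem rowInsert_mem (x : ℕ) (r : List ℕ) : x ∈ (rowInsert x r).1 := by
  rcases rowInsert_cases x r with ⟨_, h⟩ | ⟨u, y, v, _, _, _, h⟩ <;> simp [h]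

theorem rowInsert_append_some {x y : ℕ} {u v : List ℕ} (hu : ∀ z ∈ u, z ≤ x) (h : x < y) :
    rowInsert x (u ++ y :: v) = (u ++ x :: v, some y) := by
  induction u with
  | nil => exact rowInsert_cons_of_lt h
  | cons a u ih =>
    simp only [List.mem_cons, forall_eq_or_imp] at hu
    rw [List.cons_append, rowInsert_cons_of_le hu.1, ih hu.2]; rfl

theorem rowInsert_append_none {x : ℕ} {u : List ℕ} (hu : ∀ z ∈ u, z ≤ x) :
    rowInsert x u = (u ++ [x], none) := by
  induction u with
  | nil => rfl
  | cons a u ih =>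
    simp only [List.mem_cons, forall_eq_or_imp] at hu
    rw [rowInsert_cons_of_le hu.1, ih hu.2]; rfl

theorem rowInsert_none_of_le {x x' : ℕ} {r r1 : List ℕ} (h : rowInsert x r = (r1, none))
    (hx : x ≤ x') : rowInsert x' r1 = (r1 ++ [x'], none) := by
  obtain ⟨rfl, h2⟩ := rowInsert_none h
  exact rowInsert_append_none (by
    simpa [hx, or_imp, forall_and] using fun z hz => (h2 z hz).trans hx)

theorem rowInsert_le_of_le {x x' y y' : ℕ} {r r1 r2 : List ℕ} (hr : r.Pairwise (· ≤ ·))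
    (h : rowInsert x r = (r1, some y)) (h' : rowInsert x' r1 = (r2, some y')) (hx : x ≤ x') :
    y ≤ y' := by
  have h1 := rowInsert_lt h'
  have h2 : y' ∈ x' :: r1 := (rowInsert_perm_some h').mem_iff.1 (by simp)
  rcases rowInsert_cases x r with ⟨_, h3⟩ | ⟨u, z, v, rfl, hu, hz, h3⟩
  · simp [h3] at h
  · rw [h3] at h
    simp only [Prod.mk.injEq, Option.some.injEq] at h
    obtain ⟨rfl, rfl⟩ := h
    simp only [List.pairwise_append, List.pairwise_cons] at hr
    simp only [List.mem_cons, List.mem_append] at h2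
    rcases h2 with h2 | h2 | h2 | h2
    · omega
    · have := hu _ h2; omega
    · omega
    · exact hr.2.1.1 _ h2

theorem exists_rowInsert_of_lt {x' x : ℕ} {r : List ℕ} (hr : r.Pairwise (· ≤ ·)) (hx : x ∈ r)
    (h : x' < x) : ∃ r' y, rowInsert x' r = (r', some y) ∧ y ≤ x ∧ y ∈ r := by
  rcases rowInsert_cases x' r with ⟨h1, _⟩ | ⟨u, y, v, rfl, h1, h2, h3⟩
  · have := h1 x hx; omega
  · refine ⟨_, y, h3, ?_, by simp⟩
    simp only [List.pairwise_append, List.pairwise_cons] at hr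
    simp only [List.mem_append, List.mem_cons] at hx
    rcases hx with hx | rfl | hx
    · have := h1 x hx; omega
    · exact le_rfl
    · exact hr.2.1.1 x hx

/-- The row bumping lemma: the box that appears at the second of two successive insertions is not
below the first one if and only if the second letter is not smaller than the first one. -/
theorem insert_insert_row_le_iff : ∀ {x x' : ℕ} {t : List (List ℕ)}, IsTab t →
    ((insert x' (insert x t).1).2 ≤ (insert x t).2 ↔ x ≤ x')
  | x, x', [], _ => by
    by_cases h : x' < x <;> simp [insert, rowInsert, h]; omega
  | x, x', r :: t, ht => by
    have hs := rowInsert_sorted (x := x) ht.2.1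
    have hm := rowInsert_mem x r
    rcases h : rowInsert x r with ⟨r1, _ | y⟩
    · rw [insert_cons_none h]
      rw [h] at hs hm
      by_cases hx : x ≤ x'
      · rw [insert_cons_none (rowInsert_none_of_le h hx)]; simp [hx]
      · obtain ⟨r2, y', h1, _⟩ := exists_rowInsert_of_lt hs hm (not_le.1 hx)
        rw [insert_cons_some h1]; simp [hx]
    · rw [insert_cons_some h]
      rw [h] at hs hm
      rcases h' : rowInsert x' r1 with ⟨r2, _ | y'⟩
      · rw [insert_cons_none h']
        simp only [Nat.zero_le, true_iff]
        by_contra hx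
        obtain ⟨r2, y', h1, _⟩ := exists_rowInsert_of_lt hs hm (not_le.1 hx)
        simp [h1] at h'
      · rw [insert_cons_some h']
        simp only [Nat.add_le_add_iff_right]
        rw [insert_insert_row_le_iff ht.2.2.2]
        constructor
        · intro hy
          by_contra hx
          obtain ⟨r3, y3, h1, h2, _⟩ := exists_rowInsert_of_lt hs hm (not_le.1 hx)
          have h3 := rowInsert_lt h
          rw [h1] at h'
          simp only [Prod.mk.injEq, Option.some.injEq] at h'
          omega
        · exact rowInsert_le_of_le ht.2.1 h h'

/-! ### Knuth equivalence -/

/-- The elementary Knuth relations on words of length three. -/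
inductive Triple : List ℕ → List ℕ → Prop
  | left {x y z : ℕ} : x < y → y ≤ z → Triple [y, x, z] [y, z, x]
  | right {x y z : ℕ} : x ≤ y → y < z → Triple [x, z, y] [z, x, y]

/-- One elementary Knuth move inside a word. -/
def KnuthStep (w w' : List ℕ) : Prop :=
  ∃ u v a b, Triple a b ∧ w = u ++ a ++ v ∧ w' = u ++ b ++ v

/-- Knuth (or plactic) equivalence of words. -/
def Knuth : List ℕ → List ℕ → Prop := Relation.EqvGen KnuthStep

theorem Knuth.refl (w : List ℕ) : Knuth w w := Relation.EqvGen.refl w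
theorem Knuth.symm {w w' : List ℕ} (h : Knuth w w') : Knuth w' w := Relation.EqvGen.symm _ _ h
theorem Knuth.trans {w w' w'' : List ℕ} (h : Knuth w w') (h' : Knuth w' w'') : Knuth w w'' :=
  Relation.EqvGen.trans _ _ _ h h'

theorem Triple.knuth {a b : List ℕ} (h : Triple a b) (u v : List ℕ) :
    Knuth (u ++ a ++ v) (u ++ b ++ v) := Relation.EqvGen.rel _ _ ⟨u, v, a, b, h, rfl, rfl⟩

theorem Knuth.map_of_step {f : List ℕ → List ℕ}
    (hf : ∀ {w w'}, KnuthStep w w' → Knuth (f w) (f w')) {w w' : List ℕ} (h : Knuth w w') :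
    Knuth (f w) (f w') := by
  induction h with
  | rel _ _ h => exact hf h
  | refl _ => exact .refl _
  | symm _ _ _ ih => exact ih.symm
  | trans _ _ _ _ _ ih1 ih2 => exact ih1.trans ih2

theorem Knuth.append_left (s : List ℕ) {w w' : List ℕ} (h : Knuth w w') :
    Knuth (s ++ w) (s ++ w') := by
  refine h.map_of_step (f := (s ++ ·)) ?_
  rintro _ _ ⟨u, v, a, b, h, rfl, rfl⟩
  simpa using h.knuth (s ++ u) v

theorem Knuth.append_right (s : List ℕ) {w w' : List ℕ} (h : Knuth w w') :
    Knuth (w ++ s) (w' ++ s) := by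
  refine h.map_of_step (f := (· ++ s)) ?_
  rintro _ _ ⟨u, v, a, b, h, rfl, rfl⟩
  simpa using h.knuth u (v ++ s)

theorem Knuth.append {u u' v v' : List ℕ} (h : Knuth u u') (h' : Knuth v v') :
    Knuth (u ++ v) (u' ++ v') := (h.append_right v).trans (h'.append_left u')

/-- Knuth equivalence is compatible with the restriction to an interval of letters. -/
theorem Knuth.filter {p : ℕ → Bool} (hp : ∀ x y z, x ≤ y → y ≤ z → p x → p z → p y)
    {w w' : List ℕ} (h : Knuth w w') : Knuth (w.filter p) (w'.filter p) := by
  refine h.map_of_step (f := List.filter p) ?_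
  rintro _ _ ⟨u, v, a, b, h, rfl, rfl⟩
  simp only [List.filter_append]
  cases h with
  | @left x y z h1 h2 =>
    by_cases hx : p x <;> by_cases hz : p z
    · have hy := hp x y z h1.le h2 hx hz
      simpa [hx, hy, hz] using (Triple.left h1 h2).knuth (u.filter p) (v.filter p)
    all_goals simp only [List.filter_cons, hx, hz]; exact .refl _
  | @right x y z h1 h2 =>
    by_cases hx : p x <;> by_cases hz : p z
    · have hy := hp x y z h1 h2.le hx hz
      simpa [hx, hy, hz] using (Triple.right h1 h2).knuth (u.filter p) (v.filter p)
    all_goals simp only [List.filter_cons, hx, hz]; exact .refl _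

/-- Knuth equivalent words have the same letters. -/
theorem Knuth.perm {w w' : List ℕ} (h : Knuth w w') : w.Perm w' := by
  induction h with
  | rel _ _ h =>
    obtain ⟨u, v, a, b, h, rfl, rfl⟩ := h
    refine List.Perm.append_right _ (List.Perm.append_left _ ?_)
    cases h with
    | left => exact (List.Perm.swap _ _ _).cons _
    | right => exact List.Perm.swap _ _ _
  | refl _ => exact .refl _
  | symm _ _ _ ih => exact ih.symm
  | trans _ _ _ _ _ ih1 ih2 => exact ih1.trans ih2

/-- Knuth equivalence is compatible with order preserving changes of the letters. -/
theorem Knuth.map {f : ℕ → ℕ} {w w' : List ℕ} (h : Knuth w w')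
    (hf : ∀ x ∈ w, ∀ y ∈ w, x < y → f x < f y) : Knuth (w.map f) (w'.map f) := by
  have hle : ∀ {w : List ℕ}, (∀ x ∈ w, ∀ y ∈ w, x < y → f x < f y) →
      ∀ x ∈ w, ∀ y ∈ w, x ≤ y → f x ≤ f y := fun hf x hx y hy h => by
    rcases h.lt_or_eq with h | rfl
    · exact (hf x hx y hy h).le
    · exact le_rfl
  induction h with
  | rel _ _ h =>
    obtain ⟨u, v, a, b, h, rfl, rfl⟩ := h
    simp only [List.map_append]
    cases h with
    | @left x y z h1 h2 =>
      exact (Triple.left (hf x (by simp) y (by simp) h1)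
        (hle hf y (by simp) z (by simp) h2)).knuth _ _
    | @right x y z h1 h2 =>
      exact (Triple.right (hle hf x (by simp) y (by simp) h1)
        (hf y (by simp) z (by simp) h2)).knuth _ _
  | refl _ => exact .refl _
  | symm _ _ h ih =>
    have := Knuth.perm h
    exact (ih fun x hx y hy => hf x (this.mem_iff.1 hx) y (this.mem_iff.1 hy)).symm
  | trans _ _ _ h _ ih1 ih2 =>
    have := Knuth.perm h
    exact (ih1 hf).trans (ih2 fun x hx y hy => hf x (this.mem_iff.2 hx) y (this.mem_iff.2 hy))

/-- The row that results from the successive insertion of the letters of a word, and the word of the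
bumped letters. -/
def rowWord : List ℕ → List ℕ → List ℕ × List ℕ
  | r, [] => (r, [])
  | r, x :: w => ((rowWord (rowInsert x r).1 w).1,
      (rowInsert x r).2.toList ++ (rowWord (rowInsert x r).1 w).2)

/-- The tableau that results from the successive insertion of the letters of a word into `t`. -/
def insFrom (t : List (List ℕ)) (w : List ℕ) : List (List ℕ) :=
  w.foldl (fun t x => (insert x t).1) t

theorem insFrom_cons (r : List ℕ) (w : List ℕ) : ∀ t,
    insFrom (r :: t) w = (rowWord r w).1 :: insFrom t (rowWord r w).2 := by
  induction w generalizing r with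
  | nil => intro t; rfl
  | cons x w ih =>
    intro t
    rcases h : rowInsert x r with ⟨r', _ | y⟩
    · change insFrom (insert x (r :: t)).1 w = _
      rw [insert_cons_none h, ih]; simp [rowWord, h]
    · change insFrom (insert x (r :: t)).1 w = _
      rw [insert_cons_some h, ih]; simp [rowWord, h, insFrom]

/-- A first entry that is not larger than any of the inserted letters is never bumped. -/
theorem rowWord_cons_of_le {a : ℕ} {r w : List ℕ} (h : ∀ x ∈ w, a ≤ x) :
    rowWord (a :: r) w = (a :: (rowWord r w).1, (rowWord r w).2) := by
  induction w generalizing r with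
  | nil => rfl
  | cons x w ih =>
    simp only [List.mem_cons, forall_eq_or_imp] at h
    simp only [rowWord, rowInsert_cons_of_le h.1]
    rw [ih h.2]

/-- The insertion of the two words of a Knuth relation into a row gives the same row, and the words
of the bumped letters are equal or are again related. -/
theorem rowWord_left {x y z : ℕ} (hxy : x < y) (hyz : y ≤ z) : ∀ {r : List ℕ},
    r.Pairwise (· ≤ ·) → (rowWord r [y, x, z]).1 = (rowWord r [y, z, x]).1 ∧
      ((rowWord r [y, x, z]).2 = (rowWord r [y, z, x]).2 ∨
        Triple (rowWord r [y, x, z]).2 (rowWord r [y, z, x]).2)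
  | [], _ => by
    have h1 : ¬ z < x := by omega
    have h2 : ¬ z < y := by omega
    simp [rowWord, rowInsert, hxy, h1, h2]
  | a :: r, hr => by
    rw [List.pairwise_cons] at hr
    by_cases hx : a ≤ x
    · rw [rowWord_cons_of_le (by simp; omega), rowWord_cons_of_le (by simp; omega)]
      simpa using rowWord_left hxy hyz hr.2
    have hx := not_le.1 hx
    by_cases hy : y < a
    · simp only [rowWord, rowInsert_cons_of_lt hy, rowInsert_cons_of_lt hxy,
        rowInsert_cons_of_le hyz, rowInsert_cons_of_le (hxy.le.trans hyz), Option.toList_some,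
        List.append_nil]
      refine ⟨trivial, ?_⟩
      rcases h : rowInsert z r with ⟨r', _ | c⟩
      · left; simp
      · right
        have hc : c ∈ z :: r := (rowInsert_perm_some h).mem_iff.1 (by simp)
        have hlt := rowInsert_lt h
        have hac : a ≤ c := by
          rcases List.mem_cons.1 hc with rfl | hc
          · omega
          · exact hr.1 c hc
        exact Triple.left hy hac
    · have hy := not_lt.1 hy
      simp only [rowWord, rowInsert_cons_of_le hy, rowInsert_cons_of_lt hx,
        rowInsert_cons_of_le (hy.trans hyz), rowInsert_cons_of_le (hxy.le.trans hyz),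
        List.append_nil]
      refine ⟨trivial, ?_⟩
      rcases h : rowInsert y r with ⟨r1, _ | c⟩
      · left
        simp only
        rw [rowInsert_none_of_le h hyz]
        simp
      · rcases h' : rowInsert z r1 with ⟨r2, _ | d⟩
        · left; simp
        · right
          exact Triple.left (hy.trans_lt (rowInsert_lt h)) (rowInsert_le_of_le hr.2 h h' hyz)

/-- The analogue of `rowWord_left` for the other Knuth relation. If all entries of the row exceed
the three letters, then the bumped words are related by the first Knuth relation, with the sides
exchanged. -/
theorem rowWord_right {x y z : ℕ} (hxy : x ≤ y) (hyz : y < z) : ∀ {r : List ℕ},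
    r.Pairwise (· ≤ ·) → (rowWord r [x, z, y]).1 = (rowWord r [z, x, y]).1 ∧
      ((rowWord r [x, z, y]).2 = (rowWord r [z, x, y]).2 ∨
        Triple (rowWord r [x, z, y]).2 (rowWord r [z, x, y]).2 ∨
        Triple (rowWord r [z, x, y]).2 (rowWord r [x, z, y]).2)
  | [], _ => by
    have h1 : ¬ z < x := by omega
    have h2 : ¬ y < x := by omega
    have h3 : x < z := by omega
    simp [rowWord, rowInsert, h1, h2, h3, hyz]
  | a :: r, hr => by
    rw [List.pairwise_cons] at hr
    by_cases hx : a ≤ x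
    · rw [rowWord_cons_of_le (by simp; omega), rowWord_cons_of_le (by simp; omega)]
      simpa using rowWord_right hxy hyz hr.2
    have hx := not_le.1 hx
    by_cases hz : z < a
    · cases r with
      | nil =>
        have h1 : ¬ z < x := by omega
        have h2 : ¬ y < x := by omega
        have h3 : x < z := by omega
        simp [rowWord, rowInsert, h1, h2, h3, hyz, hx, hz]
      | cons b r =>
        have hab := hr.1 b (by simp)
        simp only [rowWord, rowInsert_cons_of_lt hx, rowInsert_cons_of_lt hz,
          rowInsert_cons_of_le (hxy.trans hyz.le), rowInsert_cons_of_lt (hz.trans_le hab),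
          rowInsert_cons_of_le hxy, rowInsert_cons_of_lt hyz,
          rowInsert_cons_of_lt (hxy.trans_lt hyz),
          rowInsert_cons_of_lt (hyz.trans (hz.trans_le hab))]
        exact ⟨trivial, Or.inr (Or.inr (Triple.left hz hab))⟩
    · have hz := not_lt.1 hz
      simp only [rowWord, rowInsert_cons_of_le hz, rowInsert_cons_of_lt hx,
        rowInsert_cons_of_le hxy, rowInsert_cons_of_le (hxy.trans hyz.le), List.append_nil]
      refine ⟨trivial, ?_⟩
      have hs := rowInsert_sorted (x := z) hr.2
      have hm := rowInsert_mem z r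
      rcases h : rowInsert z r with ⟨r1, _ | d⟩
      · left; simp
      · rw [h] at hs hm
        obtain ⟨r2, c, h1, h2, h3⟩ := exists_rowInsert_of_lt hs hm hyz
        right; left
        simp only [h1]
        have hd := rowInsert_lt h
        have hc : c ∈ z :: r := (rowInsert_perm_some h).mem_iff.1 (by simp [h3])
        refine Triple.right ?_ (by omega)
        rcases List.mem_cons.1 hc with rfl | hc
        · exact hz
        · exact hr.1 c hc

/-- Words that are related by a Knuth relation have the same effect on a tableau: by induction on
the rows, as the words of the letters bumped from the first row are equal or related. -/
theorem insFrom_triple : ∀ {t : List (List ℕ)}, (∀ r ∈ t, r.Pairwise (· ≤ ·)) →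
    ∀ {a b : List ℕ}, Triple a b → insFrom t a = insFrom t b
  | [], _, a, b, h => by
    cases h with
    | @left x y z h1 h2 =>
      have h3 : ¬ z < x := by omega
      have h4 : ¬ z < y := by omega
      simp [insFrom, insert, rowInsert, h1, h3, h4]
    | @right x y z h1 h2 =>
      have h3 : ¬ z < x := by omega
      have h4 : ¬ y < x := by omega
      have h5 : x < z := by omega
      simp [insFrom, insert, rowInsert, h2, h3, h4, h5]
  | r :: t, hr, a, b, h => by
    simp only [List.mem_cons, forall_eq_or_imp] at hr
    rw [insFrom_cons, insFrom_cons]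
    cases h with
    | left h1 h2 =>
      obtain ⟨h3, h4⟩ := rowWord_left h1 h2 hr.1
      rw [h3]
      rcases h4 with h4 | h4
      · rw [h4]
      · rw [insFrom_triple hr.2 h4]
    | right h1 h2 =>
      obtain ⟨h3, h4⟩ := rowWord_right h1 h2 hr.1
      rw [h3]
      rcases h4 with h4 | h4 | h4
      · rw [h4]
      · rw [insFrom_triple hr.2 h4]
      · rw [insFrom_triple hr.2 h4]

theorem IsTab.sorted : ∀ {t : List (List ℕ)}, IsTab t → ∀ r ∈ t, r.Pairwise (· ≤ ·)
  | [], _ => by simp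
  | r :: t, h => by
    simp only [List.mem_cons, forall_eq_or_imp]
    exact ⟨h.2.1, h.2.2.2.sorted⟩

theorem Knuth.ins_eq {w w' : List ℕ} (h : Knuth w w') : ins w = ins w' := by
  induction h with
  | rel _ _ h =>
    obtain ⟨u, v, a, b, h, rfl, rfl⟩ := h
    rw [ins_append, ins_append, ins_append _ v, ins_append u b]
    congr 1
    exact insFrom_triple (isTab_ins u).sorted h
  | refl _ => rfl
  | symm _ _ _ ih => exact ih.symm
  | trans _ _ _ _ _ ih1 ih2 => exact ih1.trans ih2

/-- In the row `y :: v`, a smaller letter at the end moves to the left up to the second place. -/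
theorem knuth_move_small {x : ℕ} : ∀ {y : ℕ} {v : List ℕ}, x < y → (y :: v).Pairwise (· ≤ ·) →
    Knuth (y :: v ++ [x]) (y :: x :: v)
  | y, [], _, _ => .refl _
  | y, q :: v, h, hs => by
    rw [List.pairwise_cons] at hs
    have hq := hs.1 q (by simp)
    have h1 := (knuth_move_small (h.trans_le hq) hs.2).append_left [y]
    refine h1.trans ?_
    simpa using ((Triple.left h hq).knuth [] v).symm

/-- The bumped letter `y` moves to the left across the part of the row that precedes it. -/
theorem knuth_move_large {y : ℕ} (u : List ℕ) : ∀ {c : ℕ} {s : List ℕ},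
    (u ++ [c]).Pairwise (· ≤ ·) → c < y → Knuth (u ++ y :: c :: s) (y :: u ++ c :: s) := by
  induction u using List.reverseRecOn with
  | nil => intro c s _ _; exact .refl _
  | append_singleton u p ih =>
    intro c s hs hc
    have hpc : p ≤ c := by
      rw [List.pairwise_append] at hs
      exact hs.2.2 p (by simp) c (by simp)
    have h1 := (Triple.right hpc hc).knuth u s
    have h2 := ih (c := p) (s := c :: s) (List.pairwise_append.1 hs).1 (hpc.trans_lt hc)
    simp only [List.append_assoc, List.cons_append, List.nil_append] at h1 h2 ⊢
    exact h1.trans h2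

/-- Up to Knuth equivalence, row insertion moves the bumped letter in front of the row. -/
theorem knuth_rowInsert {x y : ℕ} {r r' : List ℕ} (hr : r.Pairwise (· ≤ ·))
    (h : rowInsert x r = (r', some y)) : Knuth (r ++ [x]) (y :: r') := by
  rcases rowInsert_cases x r with ⟨_, h2⟩ | ⟨u, z, v, rfl, hu, hz, h3⟩
  · simp [h2] at h
  · rw [h3] at h
    simp only [Prod.mk.injEq, Option.some.injEq] at h
    obtain ⟨rfl, rfl⟩ := h
    rw [List.pairwise_append] at hr
    have h1 := (knuth_move_small hz hr.2.1).append_left u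
    have h2 := knuth_move_large (s := v) u (c := x)
      (List.pairwise_append.2 ⟨hr.1, by simp, by simpa using hu⟩) hz
    simp only [List.append_assoc] at h1 ⊢
    exact h1.trans h2

/-- The word of the entries of a tableau, read by rows from the bottom to the top. -/
def reading (t : List (List ℕ)) : List ℕ := t.reverse.flatten

theorem reading_cons (r : List ℕ) (t : List (List ℕ)) : reading (r :: t) = reading t ++ r := by
  simp [reading]

/-- Up to Knuth equivalence, insertion into a tableau appends a letter to the reading word. -/
theorem knuth_insert : ∀ {x : ℕ} {t : List (List ℕ)}, (∀ r ∈ t, r.Pairwise (· ≤ ·)) →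
    Knuth (reading t ++ [x]) (reading (insert x t).1)
  | x, [], _ => .refl _
  | x, r :: t, h => by
    simp only [List.mem_cons, forall_eq_or_imp] at h
    rcases hr : rowInsert x r with ⟨r', _ | y⟩
    · rw [insert_cons_none hr, (rowInsert_none hr).1]
      simpa [reading_cons] using Knuth.refl _
    · rw [insert_cons_some hr, reading_cons, reading_cons]
      have h1 := (knuth_rowInsert h.1 hr).append_left (reading t)
      have h2 := (knuth_insert (x := y) h.2).append_right r'
      simp only [List.append_assoc, List.cons_append, List.nil_append] at h1 h2 ⊢
      exact h1.trans h2

theorem knuth_reading_ins (w : List ℕ) : Knuth w (reading (ins w)) := by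
  induction w using List.reverseRecOn with
  | nil => exact .refl _
  | append_singleton w x ih =>
    rw [ins_snoc]
    exact (ih.append_right [x]).trans (knuth_insert (isTab_ins w).sorted)

/-- Knuth's theorem: two words have the same insertion tableau if and only if they are
equivalent. -/
theorem knuth_iff {w w' : List ℕ} : Knuth w w' ↔ ins w = ins w' :=
  ⟨Knuth.ins_eq, fun h => (knuth_reading_ins w).trans (h ▸ (knuth_reading_ins w').symm)⟩

/-! ### The symmetry of the correspondence -/

theorem insert_max : ∀ {M : ℕ} {t : List (List ℕ)}, (∀ r ∈ t, ∀ z ∈ r, z < M) →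
    insert M t = (addBox M 0 t, 0)
  | M, [], _ => rfl
  | M, r :: t, h => by
    simp only [List.mem_cons, forall_eq_or_imp] at h
    rw [insert_cons_none (rowInsert_append_none fun z hz => (h.1 z hz).le)]
    rfl

/-- The local rule that underlies the symmetry: the insertion of `x` into a tableau to which a box
with a maximal entry has been added. If the box that appears at the insertion of `x` is the one of
the maximal entry, then the latter is bumped to the next row. -/
theorem insert_addBox : ∀ {x M r : ℕ} {t : List (List ℕ)}, (∀ q ∈ t, ∀ z ∈ q, z < M) → x < M →
    r ≤ t.length → insert x (addBox M r t) =
      if (insert x t).2 = r then (addBox M (r + 1) (insert x t).1, r + 1)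
      else (addBox M r (insert x t).1, (insert x t).2)
  | x, M, r, [], _, hx, hr => by
    obtain rfl : r = 0 := by simpa using hr
    simp [addBox, insert, rowInsert, hx]
  | x, M, 0, q :: t, h, hx, _ => by
    simp only [List.mem_cons, forall_eq_or_imp] at h
    rcases rowInsert_cases x q with ⟨h1, h2⟩ | ⟨u, y, v, rfl, h1, h2, h3⟩
    · have h3 : rowInsert x (q ++ [M]) = (q ++ [x], some M) := rowInsert_append_some h1 hx
      rw [insert_cons_none h2, addBox, insert_cons_some h3, insert_max h.2]
      simp [addBox]
    · have h4 : rowInsert x (u ++ y :: v ++ [M]) = (u ++ x :: v ++ [M], some y) := by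
        simpa using rowInsert_append_some (v := v ++ [M]) h1 h2
      rw [insert_cons_some h3, addBox, insert_cons_some h4]
      simp [addBox]
  | x, M, r + 1, q :: t, h, hx, hr => by
    simp only [List.mem_cons, forall_eq_or_imp] at h
    rw [addBox]
    rcases hq : rowInsert x q with ⟨q', _ | y⟩
    · rw [insert_cons_none hq, insert_cons_none hq]
      simp [addBox]
    · have hy : y < M := by
        have : y ∈ x :: q := (rowInsert_perm_some hq).mem_iff.1 (by simp)
        rcases List.mem_cons.1 this with rfl | hy
        · exact hx
        · exact h.1 y hy
      rw [insert_cons_some hq, insert_cons_some hq,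
        insert_addBox h.2 hy (by simpa using hr)]
      simp only [Nat.add_right_cancel_iff]
      split <;> simp [addBox]

theorem addBox_perm : ∀ (l i : ℕ) (t : List (List ℕ)), (addBox l i t).flatten.Perm (l :: t.flatten)
  | l, i, [] => by simp [addBox]
  | l, 0, r :: t => by simp [addBox]
  | l, i + 1, r :: t => by
    simp only [addBox, List.flatten_cons]
    exact ((addBox_perm l i t).append_left r).trans List.perm_middle

theorem map_length_addBox : ∀ (l i : ℕ) (t : List (List ℕ)),
    (addBox l i t).map List.length = addShape i (t.map List.length)
  | l, i, [] => by simp [addBox, addShape]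
  | l, 0, r :: t => by simp [addBox, addShape]
  | l, i + 1, r :: t => by simp [addBox, addShape, map_length_addBox l i t]

theorem tableaux_snoc (w : List (ℕ × ℕ)) (a : ℕ × ℕ) : tableaux (w ++ [a]) =
    ((insert a.1 (tableaux w).1).1, addBox a.2 (insert a.1 (tableaux w).1).2 (tableaux w).2) := by
  simp [tableaux]

theorem tableaux_fst (w : List (ℕ × ℕ)) : (tableaux w).1 = ins (w.map Prod.fst) := by
  induction w using List.reverseRecOn with
  | nil => rfl
  | append_singleton w a ih => rw [tableaux_snoc, List.map_append, List.map_singleton, ins_snoc, ih]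

theorem tableaux_snd_perm (w : List (ℕ × ℕ)) : (tableaux w).2.flatten.Perm (w.map Prod.snd) := by
  induction w using List.reverseRecOn with
  | nil => simp [tableaux]
  | append_singleton w a ih =>
    rw [tableaux_snoc, List.map_append]
    exact (addBox_perm _ _ _).trans ((ih.cons _).trans (List.perm_append_singleton _ _).symm)

theorem map_length_tableaux (w : List (ℕ × ℕ)) :
    (tableaux w).1.map List.length = (tableaux w).2.map List.length := by
  induction w using List.reverseRecOn with
  | nil => rfl
  | append_singleton w a ih => rw [tableaux_snoc, map_length_insert, map_length_addBox, ih]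

/-- Effect on the two tableaux of the addition of a column with a maximal letter `M` to a two-line
array: a box with the entry `M` appears in the insertion tableau, and the label `p` is inserted into
the record tableau. The local rule `insert_addBox` is used twice in the induction on the columns to
the right of the new one, once for each tableau. -/
theorem tableaux_insert_max {M p : ℕ} {u v : List (ℕ × ℕ)} (hM : ∀ a ∈ u ++ v, a.1 < M)
    (hs : (u ++ (M, p) :: v).Pairwise fun a b => a.2 < b.2) :
    tableaux (u ++ (M, p) :: v) =
      (addBox M (insert p (tableaux (u ++ v)).2).2 (tableaux (u ++ v)).1,
        (insert p (tableaux (u ++ v)).2).1) := by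
  have hP : ∀ {w : List (ℕ × ℕ)} {M : ℕ}, (∀ a ∈ w, a.1 < M) →
      ∀ q ∈ (tableaux w).1, ∀ z ∈ q, z < M := by
    intro w M h q hq z hz
    have : z ∈ (tableaux w).1.flatten := List.mem_flatten.2 ⟨q, hq, hz⟩
    rw [tableaux_fst] at this
    obtain ⟨a, ha, rfl⟩ := List.mem_map.1 ((ins_perm _).mem_iff.1 this)
    exact h a ha
  have hQ : ∀ {w : List (ℕ × ℕ)} {l : ℕ}, (∀ a ∈ w, a.2 < l) →
      ∀ q ∈ (tableaux w).2, ∀ z ∈ q, z < l := by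
    intro w M h q hq z hz
    have : z ∈ (tableaux w).2.flatten := List.mem_flatten.2 ⟨q, hq, hz⟩
    obtain ⟨a, ha, rfl⟩ := List.mem_map.1 ((tableaux_snd_perm w).mem_iff.1 this)
    exact h a ha
  induction v using List.reverseRecOn with
  | nil =>
    rw [List.append_nil] at hM ⊢
    have h1 : ∀ a ∈ u, a.2 < p := fun a ha =>
      (List.pairwise_append.1 hs).2.2 a ha (M, p) (by simp)
    rw [tableaux_snoc, insert_max (hP hM), insert_max (hQ h1)]
  | append_singleton v a ih =>
    have e1 : u ++ (M, p) :: (v ++ [a]) = (u ++ (M, p) :: v) ++ [a] := by simp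
    have e2 : u ++ (v ++ [a]) = (u ++ v) ++ [a] := by simp
    rw [e1] at hs
    rw [e2] at hM
    have hs' := List.pairwise_append.1 hs
    have hM' : ∀ b ∈ u ++ v, b.1 < M := fun b hb => hM b (List.mem_append_left _ hb)
    have hl : ∀ b ∈ u ++ v, b.2 < a.2 := fun b hb => hs'.2.2 b (by simp at hb ⊢; tauto) a (by simp)
    have hpl : p < a.2 := hs'.2.2 (M, p) (by simp) a (by simp)
    have hlen := congrArg List.length (map_length_tableaux (u ++ v))
    simp only [List.length_map] at hlen
    rw [e1, e2, tableaux_snoc, ih hM' hs'.1, tableaux_snoc (u ++ v),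
      insert_addBox (hP hM') (hM a (by simp)) (by rw [hlen]; exact insert_row_le _ _),
      insert_addBox (hQ hl) hpl (by rw [← hlen]; exact insert_row_le _ _)]
    by_cases h : (insert a.1 (tableaux (u ++ v)).1).2 = (insert p (tableaux (u ++ v)).2).2
    · rw [if_pos h, if_pos h.symm, h]
    · rw [if_neg h, if_neg (Ne.symm h)]

/-- The symmetry of the Robinson-Schensted correspondence: the record tableau of a two-line array is
the insertion tableau of the array in which the lines are exchanged. -/
theorem tableaux_snd_eq_ins {w s : List (ℕ × ℕ)} (hw : w.Pairwise fun a b => a.2 < b.2)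
    (hs : s.Pairwise fun a b => a.1 < b.1) (h : s.Perm w) :
    (tableaux w).2 = ins (s.map Prod.snd) := by
  induction s using List.reverseRecOn generalizing w with
  | nil => rw [List.nil_perm.1 h]; rfl
  | append_singleton s a ih =>
    obtain ⟨u, v, rfl⟩ := List.append_of_mem (h.mem_iff.1 (show a ∈ s ++ [a] by simp))
    have h1 : s.Perm (u ++ v) := List.Perm.cons_inv
      ((List.perm_append_singleton a s).symm.trans (h.trans List.perm_middle))
    have hs' := List.pairwise_append.1 hs
    rw [tableaux_insert_max (fun b hb => hs'.2.2 b (h1.mem_iff.2 hb) a (by simp)) hw,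
      List.map_append, List.map_singleton, ins_snoc,
      ih (hw.sublist (List.Sublist.append_left (List.sublist_cons_self _ _) _)) hs'.1 h1]

/-! ### Standardisation -/

/-- The relation between an earlier letter `a` and a later letter `b` of a word of pairs, which says
that the word of the first components is standardised like the word of the second components. -/
def Std (a b : ℕ × ℕ) : Prop := (a.1 < b.1 ∧ a.2 ≤ b.2) ∨ (b.1 < a.1 ∧ b.2 < a.2)

/-- The insertion of the two letters of the pair `p` into the two components of a row of pairs
proceeds in parallel, and the bumped letters form a pair `q` for which the relations `Std` persist.
-/
theorem rowInsert_std {p : ℕ × ℕ} {r : List (ℕ × ℕ)} (hr : (r.map Prod.fst).Pairwise (· ≤ ·))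
    (h : (r ++ [p]).Pairwise Std) :
    (rowInsert p.1 (r.map Prod.fst) = ((r ++ [p]).map Prod.fst, none) ∧
      rowInsert p.2 (r.map Prod.snd) = ((r ++ [p]).map Prod.snd, none)) ∨
    ∃ q r', rowInsert p.1 (r.map Prod.fst) = (r'.map Prod.fst, some q.1) ∧
      rowInsert p.2 (r.map Prod.snd) = (r'.map Prod.snd, some q.2) ∧
      (q :: r').Pairwise Std ∧ (q :: r').Perm (p :: r) := by
  rw [List.pairwise_append] at h
  have hp : ∀ z ∈ r, Std z p := fun z hz => h.2.2 z hz p (by simp)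
  rcases rowInsert_cases p.1 (r.map Prod.fst) with ⟨h1, h2⟩ | ⟨u, y, v, h0, h1, h2, h3⟩
  · left
    refine ⟨by simp [h2], ?_⟩
    rw [rowInsert_append_none]
    · simp
    · intro z hz
      obtain ⟨a, ha, rfl⟩ := List.mem_map.1 hz
      have := h1 a.1 (List.mem_map_of_mem ha)
      rcases hp a ha with h | h <;> omega
  · right
    obtain ⟨u', w', rfl, rfl, hw'⟩ := List.map_eq_append_iff.1 h0
    obtain ⟨q, v', rfl, rfl, rfl⟩ := List.map_eq_cons_iff.1 hw'
    have hq : p.2 < q.2 := by rcases hp q (by simp) with h | h <;> omega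
    have hu : ∀ z ∈ u', z.1 ≤ p.1 := fun z hz => h1 z.1 (List.mem_map_of_mem hz)
    have hu2 : ∀ z ∈ u', z.1 < p.1 ∧ z.2 ≤ p.2 := fun z hz => by
      have := hu z hz
      rcases hp z (by simp [hz]) with h | h
      · exact h
      · omega
    refine ⟨q, u' ++ p :: v', by rw [h3]; simp, ?_, ?_, ?_⟩
    · rw [List.map_append, List.map_cons, rowInsert_append_some _ hq]
      · simp
      · intro z hz
        obtain ⟨a, ha, rfl⟩ := List.mem_map.1 hz
        exact (hu2 a ha).2
    · have h := h.1
      simp only [List.map_append, List.map_cons, List.pairwise_append, List.pairwise_cons] at hr h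
      simp only [List.pairwise_cons, List.pairwise_append, List.mem_append, List.mem_cons]
      have hv : ∀ z ∈ v', p.1 < z.1 ∧ p.2 < z.2 := fun z hz => by
        have h5 := hr.2.1.1 z.1 (List.mem_map_of_mem hz)
        rcases hp z (by simp [hz]) with h | h
        · omega
        · exact h
      refine ⟨?_, h.1, ⟨fun z hz => Or.inl ⟨(hv z hz).1, (hv z hz).2.le⟩, h.2.1.2⟩, ?_⟩
      · rintro z (hz | rfl | hz)
        · have := hu2 z hz
          exact Or.inr (by omega)
        · exact Or.inr ⟨h2, hq⟩
        · exact h.2.1.1 z hz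
      · rintro z hz b (rfl | hb)
        · exact Or.inl (hu2 z hz)
        · exact h.2.2 z hz b (List.mem_cons_of_mem _ hb)
    · exact (List.perm_middle.cons q).trans ((List.Perm.swap _ _ _).trans
        (List.perm_middle.symm.cons p))

/-- The insertion of the two letters of the pair `p` into the two components of a tableau of pairs
proceeds in parallel. The relations `Std` between the letters of the reading word are the invariant
that makes this work for all rows. -/
theorem insert_std : ∀ {p : ℕ × ℕ} {t : List (List (ℕ × ℕ))},
    (∀ r ∈ t, (r.map Prod.fst).Pairwise (· ≤ ·)) → (t.reverse.flatten ++ [p]).Pairwise Std →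
    ∃ (t' : List (List (ℕ × ℕ))) (i : ℕ),
      insert p.1 (t.map (List.map Prod.fst)) = (t'.map (List.map Prod.fst), i) ∧
      insert p.2 (t.map (List.map Prod.snd)) = (t'.map (List.map Prod.snd), i) ∧
      t'.reverse.flatten.Pairwise Std ∧ t'.reverse.flatten.Perm (p :: t.reverse.flatten)
  | p, [], _, _ => ⟨[[p]], 0, by simp [insert_nil]⟩
  | p, r :: t, h, hs => by
    simp only [List.mem_cons, forall_eq_or_imp] at h
    simp only [List.reverse_cons, List.flatten_append, List.flatten_singleton,
      List.append_assoc] at hs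
    have hs' := List.pairwise_append.1 hs
    rcases rowInsert_std h.1 hs'.2.1 with ⟨h1, h2⟩ | ⟨q, r', h1, h2, h3, h4⟩
    · refine ⟨(r ++ [p]) :: t, 0, ?_, ?_, ?_, ?_⟩
      · rw [List.map_cons, insert_cons_none h1]; simp
      · rw [List.map_cons, insert_cons_none h2]; simp
      · simpa using hs
      · simp only [List.reverse_cons, List.flatten_append, List.flatten_singleton,
          ← List.append_assoc]
        exact List.perm_append_singleton _ _
    · have hq : ∀ z ∈ t.reverse.flatten, ∀ b ∈ q :: r', Std z b := fun z hz b hb =>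
        hs'.2.2 z hz b ((List.perm_append_singleton p r).mem_iff.2 (h4.mem_iff.1 hb))
      obtain ⟨t', i, h5, h6, h7, h8⟩ := insert_std (p := q) h.2 (List.pairwise_append.2
        ⟨hs'.1, by simp, fun z hz b hb => hq z hz b (by simp_all)⟩)
      refine ⟨r' :: t', i + 1, ?_, ?_, ?_, ?_⟩
      · rw [List.map_cons, insert_cons_some h1, h5]; simp
      · rw [List.map_cons, insert_cons_some h2, h6]; simp
      · simp only [List.reverse_cons, List.flatten_append, List.flatten_singleton]
        rw [List.pairwise_cons] at h3
        refine List.pairwise_append.2 ⟨h7, h3.2, fun z hz b hb => ?_⟩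
        rcases List.mem_cons.1 (h8.mem_iff.1 hz) with rfl | hz
        · exact h3.1 b hb
        · exact hq z hz b (by simp [hb])
      · simp only [List.reverse_cons, List.flatten_append, List.flatten_singleton]
        refine (h8.append_right r').trans ?_
        rw [List.cons_append]
        refine List.perm_middle.symm.trans ((h4.append_left _).trans List.perm_middle)

/-- Standardisation does not change the sequence of rows. -/
theorem rows_std {z : List (ℕ × ℕ)} (hz : z.Pairwise Std) :
    rows (z.map Prod.fst) = rows (z.map Prod.snd) := by
  suffices h : ∃ t : List (List (ℕ × ℕ)), t.map (List.map Prod.fst) = ins (z.map Prod.fst) ∧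
      t.map (List.map Prod.snd) = ins (z.map Prod.snd) ∧ t.reverse.flatten.Pairwise Std ∧
      t.reverse.flatten.Perm z ∧ rows (z.map Prod.fst) = rows (z.map Prod.snd) by
    obtain ⟨t, h⟩ := h; exact h.2.2.2.2
  induction z using List.reverseRecOn with
  | nil => exact ⟨[], by simp⟩
  | append_singleton z p ih =>
    have hz' := List.pairwise_append.1 hz
    obtain ⟨t, h1, h2, h3, h4, h5⟩ := ih hz'.1
    obtain ⟨t', i, h6, h7, h8, h9⟩ := insert_std (p := p) (t := t)
      (fun r hr => by
        have := (isTab_ins (z.map Prod.fst)).sorted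
        rw [← h1] at this
        exact this _ (List.mem_map_of_mem hr))
      (List.pairwise_append.2 ⟨h3, by simp, fun a ha b hb => hz'.2.2 a (h4.mem_iff.1 ha) b hb⟩)
    rw [h1] at h6
    rw [h2] at h7
    refine ⟨t', ?_, ?_, h8, h9.trans ((h4.cons p).trans (List.perm_append_singleton _ _).symm), ?_⟩
    · rw [List.map_append, List.map_singleton, ins_snoc, h6]
    · rw [List.map_append, List.map_singleton, ins_snoc, h7]
    · rw [List.map_append, List.map_append, List.map_singleton, List.map_singleton, rows_snoc,
        rows_snoc, h5, h6, h7]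

/-! ### Tableaux as lists of rows and as functions -/

/-- The entry in row `i` and column `j`, and `0` outside the tableau. -/
def entry (t : List (List ℕ)) (i j : ℕ) : ℕ := (t.getD i []).getD j 0

theorem IsTab.entry_le {t : List (List ℕ)} (ht : IsTab t) (i : ℕ) {j j' : ℕ} (h : j ≤ j')
    (hj : j' < (t.getD i []).length) : entry t i j ≤ entry t i j' := by
  have hi : i < t.length := by
    by_contra hi
    rw [List.getD_eq_default _ _ (not_lt.1 hi)] at hj
    simp at hj
  rw [List.getD_eq_getElem _ _ hi] at hj
  rw [entry, entry, List.getD_eq_getElem _ _ hi, List.getD_eq_getElem _ _ (h.trans_lt hj),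
    List.getD_eq_getElem _ _ hj]
  exact (ht.sorted _ (List.getElem_mem hi)).rel_get_of_le (a := ⟨j, h.trans_lt hj⟩)
    (b := ⟨j', hj⟩) h

theorem IsTab.dom : ∀ {t : List (List ℕ)}, IsTab t → ∀ i, Dom (t.getD i []) (t.getD (i + 1) [])
  | [], _, i => by simp
  | [r], _, 0 => by simp
  | r :: s :: t, h, 0 => by simpa using h.2.2.1
  | r :: t, h, i + 1 => by simpa using h.2.2.2.dom i

theorem isTab_of_dom : ∀ {t : List (List ℕ)}, (∀ r ∈ t, r ≠ [] ∧ r.Pairwise (· ≤ ·)) →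
    (∀ i, Dom (t.getD i []) (t.getD (i + 1) [])) → IsTab t
  | [], _, _ => trivial
  | r :: t, h, h' => by
    simp only [List.mem_cons, forall_eq_or_imp] at h
    refine ⟨h.1.1, h.1.2, ?_, isTab_of_dom h.2 fun i => by simpa using h' (i + 1)⟩
    have := h' 0
    cases t <;> simp_all

theorem eq_of_entry {t t' : List (List ℕ)} (h : t.map List.length = t'.map List.length)
    (he : ∀ i j, entry t i j = entry t' i j) : t = t' := by
  have hl : t.length = t'.length := by simpa using congrArg List.length h
  refine List.ext_getElem hl fun i h1 h2 => ?_
  have hr : (t[i]).length = (t'[i]).length := by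
    have := List.getElem_of_eq h (i := i) (by simpa using h1)
    simpa using this
  refine List.ext_getElem hr fun j h3 h4 => ?_
  have := he i j
  rw [entry, entry, List.getD_eq_getElem _ _ h1, List.getD_eq_getElem _ _ h2,
    List.getD_eq_getElem _ _ h3, List.getD_eq_getElem _ _ h4] at this
  exact this

/-- The list of the rows of a semistandard tableau. -/
def rowList {l : YoungDiagram} (T : SemistandardYoungTableau l) : List (List ℕ) :=
  (List.range (l.colLen 0)).map fun i => (List.range (l.rowLen i)).map (T i)

theorem rowLen_eq_zero {l : YoungDiagram} {i : ℕ} (h : l.colLen 0 ≤ i) : l.rowLen i = 0 := by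
  by_contra h0
  have h1 : (i, 0) ∈ l := YoungDiagram.mem_iff_lt_rowLen.2 (Nat.pos_of_ne_zero h0)
  exact absurd (YoungDiagram.mem_iff_lt_colLen.1 h1) (not_lt.2 h)

theorem rowLen_pos {l : YoungDiagram} {i : ℕ} (h : i < l.colLen 0) : 0 < l.rowLen i :=
  YoungDiagram.mem_iff_lt_rowLen.1 (YoungDiagram.mem_iff_lt_colLen.2 h)

theorem getD_rowLens (l : YoungDiagram) (i : ℕ) : l.rowLens.getD i 0 = l.rowLen i := by
  rw [YoungDiagram.rowLens]
  by_cases h : i < l.colLen 0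
  · rw [List.getD_eq_getElem _ _ (by simpa using h)]; simp
  · rw [List.getD_eq_default _ _ (by simpa using h), rowLen_eq_zero (not_lt.1 h)]

theorem rowList_getD {l : YoungDiagram} (T : SemistandardYoungTableau l) (i : ℕ) :
    (rowList T).getD i [] = (List.range (l.rowLen i)).map (T i) := by
  by_cases h : i < l.colLen 0
  · rw [List.getD_eq_getElem _ _ (by simpa [rowList] using h)]; simp [rowList]
  · rw [List.getD_eq_default _ _ (by simpa [rowList] using h), rowLen_eq_zero (not_lt.1 h)]
    simp

theorem entry_rowList {l : YoungDiagram} (T : SemistandardYoungTableau l) (i j : ℕ) :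
    entry (rowList T) i j = T i j := by
  rw [entry, rowList_getD]
  by_cases h : j < l.rowLen i
  · rw [List.getD_eq_getElem _ _ (by simpa using h)]; simp
  · rw [List.getD_eq_default _ _ (by simpa using h), T.zeros]
    rwa [YoungDiagram.mem_iff_lt_rowLen]

theorem map_length_rowList {l : YoungDiagram} (T : SemistandardYoungTableau l) :
    (rowList T).map List.length = l.rowLens := by
  simp [rowList, YoungDiagram.rowLens]

theorem isTab_rowList {l : YoungDiagram} (T : SemistandardYoungTableau l) : IsTab (rowList T) := by
  refine isTab_of_dom (fun r hr => ?_) fun i => ?_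
  · obtain ⟨i, hi, rfl⟩ := List.mem_map.1 hr
    have := rowLen_pos (List.mem_range.1 hi)
    refine ⟨by simp; omega, ?_⟩
    rw [List.pairwise_map]
    refine List.pairwise_lt_range.imp_of_mem fun {a b} _ hb hab => ?_
    exact T.row_weak hab (YoungDiagram.mem_iff_lt_rowLen.2 (List.mem_range.1 hb))
  · have hanti := l.rowLen_anti i (i + 1) (by omega)
    rw [rowList_getD, rowList_getD]
    refine dom_of_getD (by simpa using hanti) fun j hj => ?_
    simp only [List.length_map, List.length_range] at hj
    rw [List.getD_eq_getElem _ _ (by simp; omega), List.getD_eq_getElem _ _ (by simpa using hj)]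
    simpa using T.col_strict (Nat.lt_succ_self i) (YoungDiagram.mem_iff_lt_rowLen.2 hj)

theorem rowList_injective {l : YoungDiagram} :
    Function.Injective (rowList : SemistandardYoungTableau l → _) := fun T T' h =>
  SemistandardYoungTableau.ext fun i j => by rw [← entry_rowList, h, entry_rowList]

theorem exists_rowList {l : YoungDiagram} {t : List (List ℕ)} (ht : IsTab t)
    (h : t.map List.length = l.rowLens) : ∃ T : SemistandardYoungTableau l, rowList T = t := by
  have hlen : ∀ i, (t.getD i []).length = l.rowLen i := fun i => by
    rw [← getD_rowLens, ← h]
    by_cases hi : i < t.length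
    · rw [List.getD_eq_getElem _ _ hi, List.getD_eq_getElem _ _ (by simpa using hi)]; simp
    · rw [List.getD_eq_default _ _ (not_lt.1 hi),
        List.getD_eq_default _ _ (by simpa using not_lt.1 hi)]; simp
  refine ⟨⟨entry t, ?_, ?_, ?_⟩, eq_of_entry (by rw [map_length_rowList, h]) fun i j => ?_⟩
  · intro i j1 j2 hj hm
    exact ht.entry_le i hj.le (by rw [hlen]; exact YoungDiagram.mem_iff_lt_rowLen.1 hm)
  · intro i1 i2 j hi hm
    induction i2, hi using Nat.le_induction with
    | base =>
      exact (ht.dom i1).getD_lt j (by rw [hlen]; exact YoungDiagram.mem_iff_lt_rowLen.1 hm)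
    | succ i2 hi ih =>
      refine (ih (l.up_left_mem (Nat.le_succ i2) le_rfl hm)).trans ?_
      exact (ht.dom i2).getD_lt j (by rw [hlen]; exact YoungDiagram.mem_iff_lt_rowLen.1 hm)
  · intro i j hm
    rw [entry, List.getD_eq_default]
    rw [hlen]
    exact not_lt.1 fun h => hm (YoungDiagram.mem_iff_lt_rowLen.2 h)
  · rw [entry_rowList]; rfl

theorem count_map_range (n : ℕ) (f : ℕ → ℕ) (k : ℕ) :
    ((List.range n).map f).count k = ((Finset.range n).filter fun j => f j = k).card := by
  rw [List.count_eq_countP, List.countP_map, List.countP_eq_length_filter]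
  change _ = Multiset.card (Multiset.filter (fun j => f j = k) (Multiset.range n))
  rw [← Multiset.coe_range, Multiset.filter_coe, Multiset.coe_card]
  congr 1

theorem card_filter_eq_count {l : YoungDiagram} (T : SemistandardYoungTableau l) (k : ℕ) :
    (l.cells.filter fun c => T c.1 c.2 = k).card = (rowList T).flatten.count k := by
  rw [Finset.card_eq_sum_card_fiberwise (f := Prod.fst) (t := Finset.range (l.colLen 0)),
    List.count_flatten, rowList, List.map_map]
  · change _ = ∑ i ∈ Finset.range (l.colLen 0), (List.count k ∘ fun i =>
      List.map (T i) (List.range (l.rowLen i))) i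
    refine Finset.sum_congr rfl fun i _ => ?_
    rw [Function.comp_apply, count_map_range]
    refine (Finset.card_bij (fun j _ => (i, j)) (fun j hj => ?_) (fun _ _ _ _ h => by simpa using h)
      fun c hc => ?_).symm
    · simp only [Finset.mem_filter, Finset.mem_range] at hj
      simp only [Finset.mem_filter, YoungDiagram.mem_cells, and_true]
      exact ⟨YoungDiagram.mem_iff_lt_rowLen.2 hj.1, hj.2⟩
    · simp only [Finset.mem_filter, YoungDiagram.mem_cells] at hc
      obtain ⟨⟨h1, h2⟩, rfl⟩ := hc
      exact ⟨c.2, by simpa [h2] using YoungDiagram.mem_iff_lt_rowLen.1 h1, rfl⟩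
  · intro c hc
    simp only [Finset.coe_filter, Set.mem_ofPred_eq, YoungDiagram.mem_cells] at hc
    have h : (c.1, 0) ∈ l := l.up_left_mem le_rfl (Nat.zero_le _) hc.1
    simpa using YoungDiagram.mem_iff_lt_colLen.1 h

/-! ### Counting tableaux and words -/

/-- The number of semistandard tableaux with the row lengths `s`, in which the entries form the
multiset `M`. -/
noncomputable def tabCount (s : List ℕ) (M : Multiset ℕ) : ℕ :=
  Nat.card {t : List (List ℕ) // IsTab t ∧ t.map List.length = s ∧ (t.flatten : Multiset ℕ) = M}

/-- The Kostka numbers of Young diagrams in terms of lists of rows. -/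
theorem kostka_eq_tabCount (l : YoungDiagram) {s M : Multiset ℕ}
    (h : ∀ i, M.count i = (s.sort (· ≥ ·)).getD i 0) :
    SymFun.kostka l s = tabCount l.rowLens M := by
  have key : ∀ T : SemistandardYoungTableau l,
      (∀ i, (l.cells.filter fun c => T c.1 c.2 = i).card = (s.sort (· ≥ ·)).getD i 0) ↔
        ((rowList T).flatten : Multiset ℕ) = M := fun T => by
    simp only [card_filter_eq_count, Multiset.ext, h, Multiset.coe_count]
  refine Nat.card_congr (Equiv.ofBijective (fun T => ⟨rowList T.1, isTab_rowList _,
    map_length_rowList _, (key T.1).1 T.2⟩) ⟨fun T T' h => ?_, fun t => ?_⟩)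
  · exact Subtype.ext (rowList_injective (congrArg Subtype.val h))
  · obtain ⟨T, hT⟩ := exists_rowList t.2.1 t.2.2.1
    exact ⟨⟨T, (key T).2 (by rw [hT]; exact t.2.2.2)⟩, Subtype.ext hT⟩

/-- The words with a given sequence of rows and with given letters are counted by their insertion
tableaux. -/
theorem card_rows_eq (w : List ℕ) (M : Multiset ℕ) :
    Nat.card {v : List ℕ // rows v = rows w ∧ (v : Multiset ℕ) = M} =
      tabCount ((ins w).map List.length) M := by
  refine Nat.card_congr (Equiv.ofBijective (fun v => ⟨ins v.1, isTab_ins _, ?_, ?_⟩)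
    ⟨fun v v' h => ?_, fun t => ?_⟩)
  · rw [map_length_ins, map_length_ins, v.2.1]
  · exact (Multiset.coe_eq_coe.2 (ins_perm _)).trans v.2.2
  · exact Subtype.ext (ins_rows_injective (congrArg Subtype.val h) (v.2.1.trans v'.2.1.symm))
  · obtain ⟨v, h1, h2⟩ := exists_ins_rows w t.2.1 t.2.2.1
    refine ⟨⟨v, h2, ?_⟩, Subtype.ext h1⟩
    rw [← t.2.2.2, ← h1]
    exact (Multiset.coe_eq_coe.2 (ins_perm v)).symm

theorem exists_shape_ins (l : YoungDiagram) : ∃ w, (ins w).map List.length = l.rowLens := by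
  obtain ⟨w, hw⟩ := exists_ins_eq (isTab_rowList (default : SemistandardYoungTableau l))
  exact ⟨w, by rw [hw, map_length_rowList]⟩

/-! ### Coloured words -/

section Coloured

variable {B : Type*} [DecidableEq B]

/-- The subword of the letters of colour `b`. -/
def sub (b : B) (v : List (ℕ × B)) : List ℕ := (v.filter fun p => p.2 = b).map Prod.fst

@[simp] theorem sub_nil (b : B) : sub b [] = [] := rfl

theorem sub_append (b : B) (u v : List (ℕ × B)) : sub b (u ++ v) = sub b u ++ sub b v := by
  simp [sub]

theorem sub_cons (b : B) (x : ℕ) (c : B) (v : List (ℕ × B)) :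
    sub b ((x, c) :: v) = if c = b then x :: sub b v else sub b v := by
  by_cases h : c = b <;> simp [sub, h]

theorem length_sub (b : B) (v : List (ℕ × B)) : (sub b v).length = (v.map Prod.snd).count b := by
  rw [sub, List.length_map, List.count_eq_countP, List.countP_map, List.countP_eq_length_filter]
  congr 1

theorem sub_map (b : B) (f : ℕ → ℕ) (v : List (ℕ × B)) :
    sub b (v.map fun p => (f p.1, p.2)) = (sub b v).map f := by
  simp [sub, List.filter_map, Function.comp_def]

theorem mem_sub {b : B} {v : List (ℕ × B)} {x : ℕ} : x ∈ sub b v ↔ (x, b) ∈ v := by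
  simp [sub]

theorem count_sub (b : B) (x : ℕ) (v : List (ℕ × B)) : (sub b v).count x = v.count (x, b) := by
  induction v with
  | nil => rfl
  | cons p v ih =>
    obtain ⟨y, c⟩ := p
    rw [sub_cons]
    by_cases hc : c = b
    · rw [if_pos hc, List.count_cons, List.count_cons, ih]; simp [hc]
    · rw [if_neg hc, List.count_cons, ih]; simp [hc]

theorem perm_iff_sub {u v : List (ℕ × B)} : u.Perm v ↔ ∀ b, (sub b u).Perm (sub b v) := by
  simp only [List.perm_iff_count, count_sub, Prod.forall]
  exact forall_comm

/-- A coloured word is determined by its colours and by its subwords of given colours. -/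
theorem eq_of_sub {u v : List (ℕ × B)} (h : u.map Prod.snd = v.map Prod.snd)
    (hs : ∀ b, sub b u = sub b v) : u = v := by
  induction u generalizing v with
  | nil => simpa using h.symm
  | cons p u ih =>
    cases v with
    | nil => simp at h
    | cons q v =>
      obtain ⟨x, c⟩ := p
      obtain ⟨y, d⟩ := q
      simp only [List.map_cons, List.cons.injEq] at h
      obtain ⟨rfl, h⟩ := h
      have hc := hs c
      simp only [sub_cons, if_true, List.cons.injEq] at hc
      rw [hc.1, ih h fun b => ?_]
      have hb := hs b
      simp only [sub_cons] at hb
      by_cases hcb : c = b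
      · simpa [hcb, hc.1] using hb
      · simpa [hcb] using hb

/-- A coloured word can be assembled from its colours and from prescribed subwords. -/
theorem exists_sub {c : List B} {w : B → List ℕ} (h : ∀ b, (w b).length = c.count b) :
    ∃ v : List (ℕ × B), v.map Prod.snd = c ∧ ∀ b, sub b v = w b := by
  induction c generalizing w with
  | nil => exact ⟨[], rfl, fun b => (List.length_eq_zero_iff.1 (by simpa using h b)).symm⟩
  | cons a c ih =>
    obtain ⟨x, r, hx⟩ := List.exists_cons_of_length_pos (l := w a) (by rw [h a]; simp)
    obtain ⟨v, h1, h2⟩ := ih (w := Function.update w a r) fun b => by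
      by_cases hb : b = a
      · subst hb; have := h b; rw [hx] at this; simpa using this
      · rw [Function.update_of_ne hb, h b, List.count_cons_of_ne (Ne.symm hb)]
    refine ⟨(x, a) :: v, by simp [h1], fun b => ?_⟩
    rw [sub_cons, h2]
    by_cases hb : a = b
    · subst hb; simp [hx]
    · rw [if_neg hb, Function.update_of_ne (Ne.symm hb)]

/-- The part of colour `b` of a multiset of coloured letters. -/
def msub (b : B) (M : Multiset (ℕ × B)) : Multiset ℕ :=
  (M.filter fun p => p.2 = b).map Prod.fst

theorem msub_coe (b : B) (v : List (ℕ × B)) :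
    msub b (v : Multiset (ℕ × B)) = (sub b v : Multiset ℕ) := by
  simp [msub, sub]

theorem coe_eq_iff_msub {v : List (ℕ × B)} {M : Multiset (ℕ × B)} :
    (v : Multiset (ℕ × B)) = M ↔ ∀ b, (sub b v : Multiset ℕ) = msub b M := by
  induction M using Quotient.inductionOn with
  | h u =>
    simp only [Multiset.quot_mk_to_coe, msub_coe, Multiset.coe_eq_coe]
    exact perm_iff_sub

/-- Two coloured words with the same record tableaux: the colours of the letters agree, and so do
the sequences of rows for each colour. -/
def SameRecord (u v : List (ℕ × B)) : Prop :=
  u.map Prod.snd = v.map Prod.snd ∧ ∀ b, rows (sub b u) = rows (sub b v)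

/-- Coloured words with given letters and the same record tableaux as `w` are counted by their
insertion tableaux. -/
theorem card_sameRecord_eq [Fintype B] (w : List (ℕ × B)) (M : Multiset (ℕ × B)) :
    Nat.card {v : List (ℕ × B) // SameRecord v w ∧ (v : Multiset (ℕ × B)) = M} =
      ∏ b, tabCount ((ins (sub b w)).map List.length) (msub b M) := by
  simp only [tabCount]
  rw [← Nat.card_pi]
  refine Nat.card_congr (Equiv.ofBijective (fun v b => ⟨ins (sub b v.1), isTab_ins _, ?_, ?_⟩)
    ⟨fun v v' h => ?_, fun t => ?_⟩)
  · rw [map_length_ins, map_length_ins, v.2.1.2]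
  · exact (Multiset.coe_eq_coe.2 (ins_perm _)).trans (coe_eq_iff_msub.1 v.2.2 b)
  · refine Subtype.ext (eq_of_sub (v.2.1.1.trans v'.2.1.1.symm) fun b => ?_)
    exact ins_rows_injective (congrArg Subtype.val (congrFun h b))
      ((v.2.1.2 b).trans (v'.2.1.2 b).symm)
  · choose x h1 h2 using fun b => exists_ins_rows (sub b w) (t b).2.1 (t b).2.2.1
    obtain ⟨v, h3, h4⟩ := exists_sub (c := w.map Prod.snd) (w := x) fun b => by
      rw [← length_rows, h2, length_rows, length_sub]
    refine ⟨⟨v, ⟨h3, fun b => by rw [h4, h2]⟩, ?_⟩, ?_⟩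
    · rw [coe_eq_iff_msub]
      intro b
      rw [h4, ← (t b).2.2.2, ← h1]
      exact (Multiset.coe_eq_coe.2 (ins_perm (x b))).symm
    · funext b
      exact Subtype.ext ((congrArg ins (h4 b)).trans (h1 b))

/-! ### Record tableaux -/

theorem addBox_injective : ∀ {l i i' : ℕ} {t t' : List (List ℕ)}, i ≤ t.length → i' ≤ t'.length →
    (∀ r ∈ t, r ≠ [] ∧ l ∉ r) → (∀ r ∈ t', r ≠ [] ∧ l ∉ r) → addBox l i t = addBox l i' t' →
    i = i' ∧ t = t'
  | l, i, i', [], [], h, h', _, _, _ => by simp at h h'; simp [h, h']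
  | l, i, 0, [], r :: t, _, _, _, h, h' => by
    simp only [addBox, List.cons.injEq] at h'
    have := (h r (by simp)).1
    cases r <;> simp_all
  | l, i, i' + 1, [], r :: t, _, _, _, h, h' => by
    simp only [addBox, List.cons.injEq] at h'
    have := (h r (by simp)).2
    simp [← h'.1] at this
  | l, 0, i', r :: t, [], _, _, h, _, h' => by
    simp only [addBox, List.cons.injEq] at h'
    have := (h r (by simp)).1
    cases r <;> simp_all
  | l, i + 1, i', r :: t, [], _, _, h, _, h' => by
    simp only [addBox, List.cons.injEq] at h'
    have := (h r (by simp)).2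
    simp [h'.1] at this
  | l, 0, 0, r :: t, r' :: t', _, _, _, _, h => by simpa [addBox] using h
  | l, 0, i + 1, r :: t, r' :: t', _, _, _, h', h => by
    simp only [addBox, List.cons.injEq] at h
    have := (h' r' (by simp)).2
    simp [← h.1] at this
  | l, i + 1, 0, r :: t, r' :: t', _, _, h', _, h => by
    simp only [addBox, List.cons.injEq] at h
    have := (h' r (by simp)).2
    simp [h.1] at this
  | l, i + 1, i' + 1, r :: t, r' :: t', h1, h2, h3, h4, h => by
    simp only [addBox, List.cons.injEq] at h
    obtain ⟨e1, e2⟩ := addBox_injective (by simpa using h1) (by simpa using h2)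
      (fun r hr => h3 r (by simp [hr])) (fun r hr => h4 r (by simp [hr])) h.2
    rw [e1, e2, h.1]; simp

/-- For fixed labels, the record tableau and the sequence of row indices determine each other. -/
theorem tableaux_snd_eq_iff {w w' : List (ℕ × ℕ)} (h : w.map Prod.snd = w'.map Prod.snd)
    (hn : (w.map Prod.snd).Nodup) :
    (tableaux w).2 = (tableaux w').2 ↔ rows (w.map Prod.fst) = rows (w'.map Prod.fst) := by
  induction w using List.reverseRecOn generalizing w' with
  | nil => obtain rfl : w' = [] := by simpa using h.symm
           simp
  | append_singleton w a ih =>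
    obtain rfl | ⟨w', a', rfl⟩ := List.eq_nil_or_concat' w'
    · simp at h
    · simp only [List.map_append, List.map_singleton] at h hn ⊢
      obtain ⟨h1, h2⟩ := List.append_inj' h rfl
      have h2 : a.2 = a'.2 := List.singleton_injective h2
      rw [tableaux_snoc, tableaux_snoc, rows_snoc, rows_snoc, tableaux_fst, tableaux_fst]
      have hn' := List.nodup_append.1 hn
      have hw : ∀ (w : List (ℕ × ℕ)) l, l ∉ w.map Prod.snd →
          ∀ r ∈ (tableaux w).2, r ≠ [] ∧ l ∉ r := by
        intro w l hl r hr
        constructor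
        · rintro rfl
          have := (isTab_ins (w.map Prod.fst)).zero_notMem
          rw [← tableaux_fst, map_length_tableaux] at this
          exact this (List.mem_map.2 ⟨[], hr, rfl⟩)
        · intro hl'
          exact hl ((tableaux_snd_perm w).mem_iff.1 (List.mem_flatten.2 ⟨r, hr, hl'⟩))
      have hlen : ∀ w : List (ℕ × ℕ), (ins (w.map Prod.fst)).length = (tableaux w).2.length :=
        fun w => by
          rw [← tableaux_fst]; simpa using congrArg List.length (map_length_tableaux w)
      have ha : a.2 ∉ w.map Prod.snd := fun h => hn'.2.2 _ h _ (by simp) rfl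
      constructor
      · intro h
        simp only at h
        rw [← h2] at h
        obtain ⟨h3, h4⟩ := addBox_injective ((insert_row_le _ _).trans (hlen w).le)
          ((insert_row_le _ _).trans (hlen w').le) (hw w _ ha)
          (hw w' _ (by rw [← h1]; exact ha)) h
        rw [h3, (ih h1 hn'.1).1 h4]
      · intro h
        obtain ⟨h3, h4⟩ := List.append_inj' h rfl
        rw [List.singleton_injective h4, (ih h1 hn'.1).2 h3, h2]

/-- The two-line array of the letters of colour `b` of a coloured word and of their positions,
counted from `1`. -/
def arr (b : B) (v : List (ℕ × B)) : List (ℕ × ℕ) :=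
  (v.zipIdx.filter fun p => p.1.2 = b).map fun p => (p.1.1, p.2 + 1)

theorem arr_map_fst (b : B) (v : List (ℕ × B)) : (arr b v).map Prod.fst = sub b v := by
  conv_rhs => rw [← List.zipIdx_map_fst 0 v]
  simp only [arr, sub, List.filter_map, List.map_map, Function.comp_def]

theorem arr_map_snd (b : B) (v : List (ℕ × B)) : (arr b v).map Prod.snd =
    ((v.map Prod.snd).zipIdx.filter fun p => p.1 = b).map fun p => p.2 + 1 := by
  simp [arr, List.zipIdx_map, List.filter_map, Function.comp_def]

theorem mem_arr {b : B} {v : List (ℕ × B)} {x l : ℕ} :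
    (x, l) ∈ arr b v ↔ ∃ j, l = j + 1 ∧ v[j]? = some (x, b) := by
  simp only [arr, List.mem_map, List.mem_filter, List.mem_zipIdx_iff_getElem?, Prod.exists,
    decide_eq_true_eq, Prod.mk.injEq]
  constructor
  · rintro ⟨y, c, j, ⟨h1, rfl⟩, rfl, rfl⟩
    exact ⟨j, rfl, h1⟩
  · rintro ⟨j, rfl, h⟩
    exact ⟨x, b, j, ⟨h, rfl⟩, rfl, rfl⟩

theorem arr_pairwise (b : B) (v : List (ℕ × B)) : (arr b v).Pairwise fun a c => a.2 < c.2 := by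
  rw [arr, List.pairwise_map]
  refine List.Pairwise.filter _ ?_
  have h := List.pairwise_lt_range' (s := 0) (n := v.length)
  rw [← List.zipIdx_map_snd, List.pairwise_map] at h
  exact h.imp fun h => by simpa using h

/-- The component of colour `b` of the record tableau of a coloured word. -/
def record (v : List (ℕ × B)) (b : B) : List (List ℕ) := (tableaux (arr b v)).2

/-- The labels in the component of colour `b` are the positions, counted from `1`, of the letters of
colour `b`. -/
theorem mem_record_flatten {v : List (ℕ × B)} {b : B} {l : ℕ} :
    l ∈ (record v b).flatten ↔ ∃ j, l = j + 1 ∧ (v.map Prod.snd)[j]? = some b := by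
  rw [record, (tableaux_snd_perm _).mem_iff]
  constructor
  · intro h
    obtain ⟨⟨x, l⟩, ha, rfl⟩ := List.mem_map.1 h
    obtain ⟨j, h1, h2⟩ := mem_arr.1 ha
    exact ⟨j, h1, by simp [h2]⟩
  · rintro ⟨j, rfl, h⟩
    rw [List.getElem?_map, Option.map_eq_some_iff] at h
    obtain ⟨⟨x, c⟩, h, rfl⟩ := h
    exact List.mem_map.2 ⟨(x, j + 1), mem_arr.2 ⟨j, rfl, h⟩, rfl⟩

/-- The sequences of rows encode the record tableaux; the colours of the letters can be read off
from the distribution of the labels among the components. -/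
theorem sameRecord_iff {u v : List (ℕ × B)} : SameRecord u v ↔ ∀ b, record u b = record v b := by
  have key : u.map Prod.snd = v.map Prod.snd →
      ((∀ b, rows (sub b u) = rows (sub b v)) ↔ ∀ b, record u b = record v b) := fun h => by
    refine forall_congr' fun b => ?_
    rw [record, record, tableaux_snd_eq_iff, arr_map_fst, arr_map_fst]
    · rw [arr_map_snd, arr_map_snd, h]
    · rw [List.Nodup, List.pairwise_map]
      exact (arr_pairwise b u).imp fun h => h.ne
  constructor
  · intro h
    exact (key h.1).1 h.2
  · intro h
    have hc : u.map Prod.snd = v.map Prod.snd := by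
      refine List.ext_getElem?_iff.2 fun j => Option.ext fun b => ?_
      have := mem_record_flatten (v := u) (b := b) (l := j + 1)
      rw [h, mem_record_flatten] at this
      simpa using this.symm
    exact ⟨hc, (key hc).2 h⟩

theorem map_length_record (v : List (ℕ × B)) (b : B) :
    (record v b).map List.length = (ins (sub b v)).map List.length := by
  rw [record, ← map_length_tableaux, tableaux_fst, arr_map_fst]

end Coloured

/-! ### Standardisation of coloured words -/

theorem rowInsert_map {f : ℕ → ℕ} (hf : StrictMono f) (x : ℕ) (r : List ℕ) :
    rowInsert (f x) (r.map f) = ((rowInsert x r).1.map f, (rowInsert x r).2.map f) := by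
  induction r with
  | nil => rfl
  | cons a r ih =>
    by_cases h : x < a
    · rw [List.map_cons, rowInsert_cons_of_lt h, rowInsert_cons_of_lt (hf h)]; rfl
    · have h := not_lt.1 h
      rw [List.map_cons, rowInsert_cons_of_le h, rowInsert_cons_of_le (hf.monotone h), ih]; rfl

theorem insert_map {f : ℕ → ℕ} (hf : StrictMono f) (x : ℕ) (t : List (List ℕ)) :
    insert (f x) (t.map (List.map f)) = ((insert x t).1.map (List.map f), (insert x t).2) := by
  induction t generalizing x with
  | nil => rfl
  | cons r t ih =>
    have hr' := rowInsert_map hf x r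
    rcases hr : rowInsert x r with ⟨r', _ | y⟩
    · rw [hr] at hr'
      rw [List.map_cons, insert_cons_none hr', insert_cons_none hr]; rfl
    · rw [hr] at hr'
      rw [List.map_cons, insert_cons_some hr', insert_cons_some hr, ih]; rfl

theorem ins_map {f : ℕ → ℕ} (hf : StrictMono f) (w : List ℕ) :
    ins (w.map f) = (ins w).map (List.map f) := by
  induction w using List.reverseRecOn with
  | nil => rfl
  | append_singleton w x ih =>
    rw [List.map_append, List.map_singleton, ins_snoc, ins_snoc, ih, insert_map hf]

theorem IsTab.exists_rowLens {t : List (List ℕ)} (ht : IsTab t) :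
    ∃ l : YoungDiagram, l.rowLens = t.map List.length := by
  have hs : ∀ {t : List (List ℕ)}, IsTab t → (t.map List.length).Pairwise (· ≥ ·) := by
    intro t
    induction t with
    | nil => simp
    | cons r t ih =>
      intro h
      have h1 := ih h.2.2.2
      refine List.pairwise_cons.2 ⟨fun a ha => ?_, h1⟩
      have h2 := h.2.2.1.length_le
      cases t with
      | nil => simp at ha
      | cons s t =>
        simp only [List.map_cons, List.pairwise_cons, List.mem_cons, List.headD_cons] at h1 h2 ha
        rcases ha with rfl | ha
        · exact h2
        · exact (h1.1 a ha).trans h2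
  refine ⟨YoungDiagram.ofRowLens _ (List.Pairwise.sortedGE (hs ht)),
    YoungDiagram.rowLens_ofRowLens_eq_self fun x hx => ?_⟩
  exact Nat.pos_of_ne_zero fun h => ht.zero_notMem (h ▸ hx)

section Coloured

variable {B : Type*} [DecidableEq B]

/-- `u` is a standardisation of the coloured word `v`: the two words have the same colours, and the
letters of `u` are compared like those of `v`, where of two equal letters of `v` the left one is
regarded as smaller. The letters of `u` need not be the numbers from `0` on. -/
def StdOf {B : Type*} (u v : List (ℕ × B)) : Prop := ∃ z : List ((ℕ × ℕ) × B),
  z.map (fun p => (p.1.1, p.2)) = u ∧ z.map (fun p => (p.1.2, p.2)) = v ∧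
    (z.map Prod.fst).Pairwise Std

theorem StdOf.take {B : Type*} {u v : List (ℕ × B)} (h : StdOf u v) (k : ℕ) :
    StdOf (u.take k) (v.take k) := by
  obtain ⟨z, rfl, rfl, h⟩ := h
  refine ⟨z.take k, by simp, by simp, ?_⟩
  rw [List.map_take]
  exact h.sublist (List.take_sublist _ _)

theorem StdOf.drop {B : Type*} {u v : List (ℕ × B)} (h : StdOf u v) (k : ℕ) :
    StdOf (u.drop k) (v.drop k) := by
  obtain ⟨z, rfl, rfl, h⟩ := h
  refine ⟨z.drop k, by simp, by simp, ?_⟩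
  rw [List.map_drop]
  exact h.sublist (List.drop_sublist _ _)

open ShuffleAlg in
theorem StdOf.st {B : Type*} {u v : List (ℕ × B)} (h : StdOf u v) : StdOf (st u) v := by
  obtain ⟨z, rfl, rfl, h⟩ := h
  set u := z.map fun p => (p.1.1, p.2) with hu
  have hm : ∀ p ∈ z, (p.1.1, p.2) ∈ u := fun p hp => List.mem_map.2 ⟨p, hp, rfl⟩
  refine ⟨z.map fun p => (((rk u (p.1.1, p.2)).1, p.1.2), p.2), ?_, ?_, ?_⟩
  · rw [ShuffleAlg.st]
    conv_rhs => rw [hu, List.map_map]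
    rw [List.map_map]
    rfl
  · rw [List.map_map]; rfl
  · rw [List.pairwise_map] at h
    rw [List.map_map, List.pairwise_map]
    refine h.imp_of_mem fun {p q} hp hq h => ?_
    have h1 := rk_lt_iff u (hm p hp) (hm q hq)
    have h2 := rk_lt_iff u (hm q hq) (hm p hp)
    simp only [Std, Function.comp_apply] at h h1 h2 ⊢
    rw [h1, h2]
    exact h

/-- Standardisation does not change the record tableaux. -/
theorem StdOf.sameRecord {u v : List (ℕ × B)} (h : StdOf u v) : SameRecord u v := by
  obtain ⟨z, rfl, rfl, h⟩ := h
  refine ⟨by simp, fun b => ?_⟩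
  have h1 := rows_std (z := (z.filter fun p => p.2 = b).map Prod.fst)
    (h.sublist (List.Sublist.map _ (List.filter_sublist)))
  simp only [sub, List.filter_map, List.map_map, Function.comp_def] at h1 ⊢
  exact h1

theorem SameRecord.symm {u v : List (ℕ × B)} (h : SameRecord u v) : SameRecord v u :=
  ⟨h.1.symm, fun b => (h.2 b).symm⟩

theorem SameRecord.trans {u v w : List (ℕ × B)} (h : SameRecord u v) (h' : SameRecord v w) :
    SameRecord u w := ⟨h.1.trans h'.1, fun b => (h.2 b).trans (h'.2 b)⟩

theorem nodup_record (v : List (ℕ × B)) (b : B) :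
    (record v b).flatten.Nodup := by
  rw [record, (tableaux_snd_perm _).nodup_iff, List.Nodup, List.pairwise_map]
  exact (arr_pairwise b v).imp fun h => h.ne

end Coloured

end RobinsonSchensted

/-! ### Coloured permutations as words -/

namespace ColPerm

open RobinsonSchensted

section

variable {B : Type*} {n m : ℕ}

/-- The word `(σ(1), b_{σ(1)}) ⋯ (σ(n), b_{σ(n)})`, if `α = (b₁, …, bₙ; σ)`. -/
def line (α : ColPerm B n) : List (ℕ × B) :=
  List.ofFn fun j => ((α.perm j : ℕ), α.colour (α.perm j))

@[simp] theorem length_line (α : ColPerm B n) : α.line.length = n := by simp [line]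

theorem dual_perm (star : B → B) (α : ColPerm B n) : (α.dual star).perm = α.perm.symm := by
  simp [dual, act]

theorem dual_colour (star : B → B) (α : ColPerm B n) (i : Fin n) :
    (α.dual star).colour i = star (α.colour (α.perm i)) := by
  simp [dual, act]

theorem dual_dual {star : B → B} (h : Function.Involutive star) (α : ColPerm B n) :
    (α.dual star).dual star = α := by
  ext i
  · simp [dual_colour, dual_perm, h _]
  · simp [dual_perm]

theorem line_dual_id (α : ColPerm B n) : (α.dual id).line = α.word := by
  simp only [line, word, dual_perm, dual_colour]
  simp

theorem word_dual_id (α : ColPerm B n) : (α.dual id).word = α.line := by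
  rw [← line_dual_id, dual_dual fun _ => rfl]

theorem word_dual (star : B → B) (α : ColPerm B n) :
    (α.dual star).word = α.line.map fun p => (p.1, star p.2) := by
  simp only [line, word, dual_perm, dual_colour, List.map_ofFn, Equiv.symm_symm]
  rfl

theorem line_dual (star : B → B) (α : ColPerm B n) :
    (α.dual star).line = α.word.map fun p => (p.1, star p.2) := by
  simp only [line, word, dual_perm, dual_colour, List.map_ofFn, Equiv.apply_symm_apply]
  rfl

theorem line_injective : Function.Injective fun α : Σ n, ColPerm B n => α.2.line := by
  intro α β h
  have h1 : (⟨α.1, α.2.dual id⟩ : Σ n, ColPerm B n) = ⟨β.1, β.2.dual id⟩ := by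
    apply word_injective
    simpa [word_dual_id] using h
  obtain ⟨n, α⟩ := α
  obtain ⟨m, β⟩ := β
  simp only [Sigma.mk.injEq] at h1
  obtain ⟨rfl, h1⟩ := h1
  have := eq_of_heq h1
  rw [← dual_dual (star := id) (fun _ => rfl) α, this, dual_dual (fun _ => rfl)]

theorem exists_word {v : List (ℕ × B)} (h : (v.map Prod.fst).Perm (List.range n)) :
    ∃ α : ColPerm B n, α.word = v := by
  have hl : v.length = n := by simpa using h.length_eq
  subst hl
  have hlt : ∀ i : Fin v.length, (v[i]).1 < v.length := fun i => by
    have : (v[i]).1 ∈ v.map Prod.fst := List.mem_map.2 ⟨_, List.getElem_mem _, rfl⟩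
    simpa using h.mem_iff.1 this
  have hnd : (v.map Prod.fst).Nodup := h.nodup_iff.2 List.nodup_range
  have hinj : Function.Injective fun i : Fin v.length => (⟨(v[i]).1, hlt i⟩ : Fin v.length) := by
    intro i j hij
    have h1 : (v.map Prod.fst)[(i : ℕ)]'(by simp) = (v.map Prod.fst)[(j : ℕ)]'(by simp) := by
      simpa using hij
    exact Fin.ext ((hnd.getElem_inj_iff).1 h1)
  refine ⟨⟨fun i => (v[i]).2, (Equiv.ofBijective _
    (Finite.injective_iff_bijective.1 hinj)).symm⟩, ?_⟩
  rw [word]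
  refine List.ext_getElem (by simp) fun i h1 h2 => ?_
  simp

theorem exists_line {v : List (ℕ × B)} (h : (v.map Prod.fst).Perm (List.range n)) :
    ∃ α : ColPerm B n, α.line = v := by
  obtain ⟨α, rfl⟩ := exists_word h
  exact ⟨α.dual id, line_dual_id α⟩

theorem map_fst_line_perm (α : ColPerm B n) : (α.line.map Prod.fst).Perm (List.range n) := by
  have h : α.line.map Prod.fst = List.ofFn ((fun i : Fin n => (i : ℕ)) ∘ α.perm) := by
    rw [line, List.map_ofFn]; rfl
  rw [h]
  refine (Equiv.Perm.ofFn_comp_perm α.perm _).trans ?_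
  rw [List.ofFn_eq_map]
  simp

theorem map_fst_word_perm (α : ColPerm B n) : (α.word.map Prod.fst).Perm (List.range n) := by
  rw [← line_dual_id]; exact map_fst_line_perm _

theorem stdOf_iff {α : ColPerm B n} {v : List (ℕ × B)} (hv : v.length = n) :
    StdOf α.line v ↔ (∀ j : Fin n, α.colour (α.perm j) = (v[j]).2) ∧
      ∀ i j : Fin n, i < j → (α.perm i < α.perm j ∧ (v[i]).1 ≤ (v[j]).1) ∨
        (α.perm j < α.perm i ∧ (v[j]).1 < (v[i]).1) := by
  constructor
  · rintro ⟨z, h1, rfl, h3⟩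
    have hz : z.length = n := by simpa using hv
    have key : ∀ j : Fin n, (z[j]).1.1 = α.perm j ∧ (z[j]).2 = α.colour (α.perm j) := fun j => by
      have h := List.getElem_of_eq h1 (i := j) (by simp [hz])
      simp only [List.getElem_map, line, List.getElem_ofFn, Prod.mk.injEq] at h
      exact h
    refine ⟨fun j => by simpa using (key j).2.symm, fun i j hij => ?_⟩
    rw [List.pairwise_map, List.pairwise_iff_getElem] at h3
    have h := h3 i j (by simp [hz]) (by simp [hz]) hij
    have h4 := (key i).1
    have h5 := (key j).1
    simp only [Fin.getElem_fin] at h4 h5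
    simp only [Std, h4, h5, Fin.val_fin_lt] at h
    simpa using h
  · rintro ⟨h1, h2⟩
    refine ⟨List.ofFn fun j : Fin n => (((α.perm j : ℕ), (v[j]).1), (v[j]).2), ?_, ?_, ?_⟩
    · rw [List.map_ofFn, line]
      congr 1
      funext j
      simp [h1]
    · rw [List.map_ofFn]
      refine List.ext_getElem (by simp [hv]) fun i h1 h2 => ?_
      simp
    · rw [List.map_ofFn, List.pairwise_ofFn]
      intro i j hij
      simpa [Std] using h2 i j hij

theorem exists_stdOf (v : List (ℕ × B)) : ∃ α : ColPerm B v.length, StdOf α.line v := by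
  let x : Fin v.length → ℕ := fun i => (v[i]).1
  obtain ⟨h1, h2⟩ := Tuple.eq_sort_iff.1 (rfl : Tuple.sort x = Tuple.sort x)
  refine ⟨⟨fun i => (v[Tuple.sort x i]).2, (Tuple.sort x).symm⟩, (stdOf_iff rfl).2 ⟨?_, ?_⟩⟩
  · intro j
    simp
  · intro i j hij
    obtain ⟨a, rfl⟩ := (Tuple.sort x).surjective i
    obtain ⟨b, rfl⟩ := (Tuple.sort x).surjective j
    simp only [Equiv.symm_apply_apply]
    rcases lt_trichotomy a b with h | rfl | h
    · exact Or.inl ⟨h, h1 h.le⟩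
    · exact absurd hij (lt_irrefl _)
    · refine Or.inr ⟨h, lt_of_le_of_ne (h1 h.le) fun he => ?_⟩
      exact absurd (h2 b a h he) (not_lt.2 hij.le)

theorem stdOf_unique {α : ColPerm B n} {β : ColPerm B m} {v : List (ℕ × B)}
    (hα : StdOf α.line v) (hβ : StdOf β.line v) :
    (⟨n, α⟩ : Σ n, ColPerm B n) = ⟨m, β⟩ := by
  have hl : ∀ {n} {α : ColPerm B n}, StdOf α.line v → v.length = n := fun {n α} h => by
    obtain ⟨z, h1, rfl, _⟩ := h
    simpa using congrArg List.length h1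
  obtain rfl : n = m := (hl hα).symm.trans (hl hβ)
  obtain ⟨h1, h2⟩ := (stdOf_iff (hl hα)).1 hα
  obtain ⟨h3, h4⟩ := (stdOf_iff (hl hα)).1 hβ
  have hlt : ∀ i j, α.perm i < α.perm j ↔ β.perm i < β.perm j := fun i j => by
    rcases lt_trichotomy i j with h | rfl | h
    · have := h2 i j h; have := h4 i j h; omega
    · simp
    · have := h2 j i h; have := h4 j i h; omega
  have hmono : StrictMono (β.perm ∘ α.perm.symm) := fun i j hij => by
    simpa using (hlt (α.perm.symm i) (α.perm.symm j)).1 (by simpa using hij)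
  have hid : ∀ i, β.perm (α.perm.symm i) = i := fun i => by
    let e : Fin n ≃o Fin n := StrictMono.orderIsoOfSurjective _ hmono
      (β.perm.surjective.comp α.perm.symm.surjective)
    have : e = OrderIso.refl _ := Subsingleton.elim _ _
    exact congrArg (fun f : Fin n ≃o Fin n => f i) this
  have hp : α.perm = β.perm := by
    ext1 i
    simpa using (hid (α.perm i)).symm
  have hab : α = β := by
    ext1
    · funext i
      obtain ⟨j, rfl⟩ := α.perm.surjective i
      rw [h1, hp, h3]
    · exact hp
  rw [hab]

/-- The standardisation of a coloured word. -/
noncomputable def std (v : List (ℕ × B)) : Σ n, ColPerm B n :=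
  ⟨v.length, (exists_stdOf v).choose⟩

theorem stdOf_std (v : List (ℕ × B)) : StdOf (std v).2.line v := (exists_stdOf v).choose_spec

theorem std_eq {α : ColPerm B n} {v : List (ℕ × B)} (h : StdOf α.line v) : std v = ⟨n, α⟩ :=
  stdOf_unique (stdOf_std v) h

theorem stdOf_line_self (α : ColPerm B n) : StdOf α.line α.line :=
  (stdOf_iff (length_line α)).2 ⟨fun j => by simp [line], fun i j hij => by
    have h : α.perm i ≠ α.perm j := fun h => hij.ne (α.perm.injective h)
    simp only [line, Fin.getElem_fin, List.getElem_ofFn, Fin.eta, Fin.val_fin_le,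
      Fin.val_fin_lt]
    omega⟩

variable [DecidableEq B]

theorem record_eq (α : ColPerm B n) (b : B) : α.record b = RobinsonSchensted.record α.line b := by
  have h : α.line.zipIdx = (List.finRange n).map fun j =>
      (((α.perm j : ℕ), α.colour (α.perm j)), (j : ℕ)) := by
    refine List.ext_getElem (by simp) fun i h1 h2 => ?_
    simp [line]
  rw [ColPerm.record, RobinsonSchensted.record, arr, h]
  simp only [List.filter_map, List.map_map, Function.comp_def]

/-- The record tableaux are the insertion tableaux of the inverse. -/
theorem record_line (α : ColPerm B n) (b : B) :
    RobinsonSchensted.record α.line b = (ins (sub b α.word)).map (List.map (· + 1)) := by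
  have hs : ((arr b α.word).map fun p => (p.2 - 1, p.1 + 1)).map Prod.snd =
      (sub b α.word).map (· + 1) := by
    rw [← arr_map_fst, List.map_map, List.map_map]; rfl
  rw [← ins_map (fun a b h => by simpa using h), ← hs, RobinsonSchensted.record]
  refine tableaux_snd_eq_ins (arr_pairwise b _) ?_ ?_
  · rw [List.pairwise_map]
    refine (arr_pairwise b α.word).imp_of_mem fun {p q} hp hq h => ?_
    obtain ⟨j, hj, _⟩ := mem_arr.1 hp
    simp only
    omega
  · have hnd : ∀ v : List (ℕ × B), (arr b v).Nodup := fun v =>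
      (arr_pairwise b v).imp fun h h' => by rw [h'] at h; exact lt_irrefl _ h
    refine (List.perm_ext_iff_of_nodup ?_ (hnd _)).2 fun p => ?_
    · refine List.Nodup.map_on ?_ (hnd _)
      rintro ⟨x, l⟩ hp ⟨y, k⟩ hq h
      obtain ⟨j, hj, _⟩ := mem_arr.1 hp
      obtain ⟨i, hi, _⟩ := mem_arr.1 hq
      simp only [Prod.mk.injEq] at h ⊢
      omega
    · obtain ⟨x, l⟩ := p
      have key : ∀ {β : ColPerm B n} {j x : ℕ}, β.word[j]? = some (x, b) →
          β.line[x]? = some (j, b) := by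
        intro β j x h
        rw [word, List.getElem?_ofFn] at h
        split at h
        · rename_i hj
          simp only [Option.some.injEq, Prod.mk.injEq] at h
          obtain ⟨rfl, rfl⟩ := h
          simp [line]
        · simp at h
      constructor
      · intro h
        obtain ⟨⟨y, k⟩, hp, h⟩ := List.mem_map.1 h
        obtain ⟨j, rfl, hj⟩ := mem_arr.1 hp
        simp only [Prod.mk.injEq, Nat.add_sub_cancel] at h
        obtain ⟨rfl, rfl⟩ := h
        exact mem_arr.2 ⟨y, rfl, key hj⟩
      · intro h
        obtain ⟨j, rfl, hj⟩ := mem_arr.1 h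
        rw [← word_dual_id] at hj
        have := key hj
        rw [line_dual_id] at this
        exact List.mem_map.2 ⟨(j, x + 1), mem_arr.2 ⟨x, rfl, this⟩, rfl⟩

/-- Two coloured permutations have the same record tableaux if and only if the words of their
inverses are Knuth equivalent, colour by colour. -/
theorem sameRecord_iff_knuth {α : ColPerm B n} {β : ColPerm B m} :
    SameRecord α.line β.line ↔ ∀ b, Knuth (sub b α.word) (sub b β.word) := by
  rw [sameRecord_iff]
  refine forall_congr' fun b => ?_
  rw [record_line, record_line, knuth_iff]
  exact (List.map_injective_iff.2 (List.map_injective_iff.2 (add_left_injective 1))).eq_iff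

end

end ColPerm

/-! ### The record tableau of a coloured permutation -/

namespace StdTableau

open RobinsonSchensted ColPerm

variable {B : Type*} [Fintype B]

theorem tab_ne_zero (T : StdTableau B) (b : B) {i j : ℕ} (h : (i, j) ∈ T.shape b) :
    T.tab b i j ≠ 0 := by
  intro h0
  have := T.standard 0
  rw [if_neg (by omega), Finset.sum_eq_zero_iff] at this
  have := this b (Finset.mem_univ b)
  rw [Finset.card_eq_zero, Finset.filter_eq_empty_iff] at this
  exact this h h0

theorem ext_rowList {T T' : StdTableau B}
    (h : ∀ b, rowList (T.tab b) = rowList (T'.tab b)) : T = T' := by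
  obtain ⟨s, t, ht⟩ := T
  obtain ⟨s', t', ht'⟩ := T'
  have hs : s = s' := by
    funext b
    rw [← YoungDiagram.ofRowLens_to_rowLens_eq_self (μ := s b),
      ← YoungDiagram.ofRowLens_to_rowLens_eq_self (μ := s' b)]
    congr 1
    rw [← map_length_rowList (t b), ← map_length_rowList (t' b), h b]
  subst hs
  have : t = t' := funext fun b => rowList_injective (h b)
  subst this
  rfl

variable [DecidableEq B]

/-- The predicate `IsRecord` in terms of lists of rows. As `IsRecord` compares entries, with the
value `0` outside the tableaux, the shape has to be recovered: it consists of the boxes with nonzero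
entries. -/
theorem isRecord_iff {n : ℕ} {α : ColPerm B n} {T : StdTableau B} :
    IsRecord α T ↔ ∀ b, RobinsonSchensted.record α.line b = rowList (T.tab b) := by
  constructor
  · intro h b
    have ht : IsTab (RobinsonSchensted.record α.line b) := by
      rw [record_line, ← ins_map (fun a b h => by simpa using h)]; exact isTab_ins _
    obtain ⟨l, hl⟩ := ht.exists_rowLens
    obtain ⟨T', hT'⟩ := exists_rowList ht hl.symm
    have hpos : ∀ i j, (i, j) ∈ l → T' i j ≠ 0 := by
      intro i j hij
      rw [YoungDiagram.mem_iff_lt_rowLen] at hij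
      have h1 : T' i j ∈ (rowList T').flatten := by
        rw [← entry_rowList, entry, rowList_getD]
        rw [List.getD_eq_getElem _ _ (by simpa using hij)]
        refine List.mem_flatten.2 ⟨(List.range (l.rowLen i)).map (T' i), ?_, List.getElem_mem _⟩
        refine List.mem_map.2 ⟨i, List.mem_range.2 ?_, rfl⟩
        by_contra hi
        rw [rowLen_eq_zero (not_lt.1 hi)] at hij
        omega
      rw [hT', mem_record_flatten] at h1
      obtain ⟨k, h2, _⟩ := h1
      omega
    have he : ∀ i j, T.tab b i j = T' i j := fun i j => by
      rw [h b i j, record_eq, ← hT', ← entry_rowList T']; rfl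
    have hsh : T.shape b = l := by
      refine YoungDiagram.ext (Finset.ext fun ⟨i, j⟩ => ?_)
      rw [YoungDiagram.mem_cells, YoungDiagram.mem_cells]
      constructor
      · intro hm
        by_contra hm'
        exact T.tab_ne_zero b hm (by rw [he, T'.zeros hm'])
      · intro hm
        by_contra hm'
        exact hpos i j hm (by rw [← he, (T.tab b).zeros hm'])
    subst hsh
    rw [← hT', SemistandardYoungTableau.ext he]
  · intro h b i j
    rw [record_eq, h b, ← entry_rowList]; rfl

theorem isRecord_unique {n : ℕ} {α : ColPerm B n} {T T' : StdTableau B} (h : IsRecord α T)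
    (h' : IsRecord α T') : T = T' :=
  ext_rowList fun b => by rw [← isRecord_iff.1 h, isRecord_iff.1 h']

theorem card_eq_length {l : YoungDiagram} (T : SemistandardYoungTableau l) :
    l.card = (rowList T).flatten.length := by
  rw [List.length_flatten, map_length_rowList, YoungDiagram.rowLens]
  change l.cells.card = ∑ i ∈ Finset.range (l.colLen 0), l.rowLen i
  rw [Finset.card_eq_sum_card_fiberwise (f := Prod.fst) (t := Finset.range (l.colLen 0))]
  · refine Finset.sum_congr rfl fun i _ => ?_
    rw [YoungDiagram.rowLen_eq_card]; rfl
  · intro c hc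
    have h : (c.1, 0) ∈ l := l.up_left_mem le_rfl (Nat.zero_le _) hc
    simpa using YoungDiagram.mem_iff_lt_colLen.1 h

theorem card_shape {n : ℕ} {α : ColPerm B n} {T : StdTableau B} (h : IsRecord α T) (b : B) :
    (T.shape b).card = (sub b α.line).length := by
  rw [card_eq_length (T.tab b), ← isRecord_iff.1 h, List.length_flatten, map_length_record,
    ← List.length_flatten, (ins_perm _).length_eq]

theorem sum_length_sub (v : List (ℕ × B)) : ∑ b, (sub b v).length = v.length := by
  simp only [length_sub]
  have h := Multiset.sum_count_eq_card (s := Finset.univ)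
    (m := ((v.map Prod.snd : List B) : Multiset B)) fun _ _ => Finset.mem_univ _
  simpa using h

theorem sum_count_sub (v : List (ℕ × B)) (x : ℕ) :
    ∑ b, (sub b v).count x = (v.map Prod.fst).count x := by
  induction v with
  | nil => simp
  | cons p v ih =>
    obtain ⟨y, c⟩ := p
    have h : ∀ b, (sub b ((y, c) :: v)).count x =
        (sub b v).count x + if c = b then (if y = x then 1 else 0) else 0 := fun b => by
      rw [sub_cons]
      split <;> simp [List.count_cons]
    simp only [h, Finset.sum_add_distrib, ih, List.map_cons, List.count_cons]
    simp

theorem size_eq {n : ℕ} {α : ColPerm B n} {T : StdTableau B} (h : IsRecord α T) : T.size = n := by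
  rw [size, Finset.sum_congr rfl fun b _ => card_shape h b, sum_length_sub, length_line]

theorem exists_isRecord_tableau {n : ℕ} (α : ColPerm B n) : ∃ T : StdTableau B, IsRecord α T := by
  have ht : ∀ b, IsTab (RobinsonSchensted.record α.line b) := fun b => by
    rw [record_line, ← ins_map (fun a b h => by simpa using h)]; exact isTab_ins _
  choose l hl using fun b => (ht b).exists_rowLens
  choose T hT using fun b => exists_rowList (ht b) (hl b).symm
  have hcard : ∑ b, (l b).card = n := by
    have h : ∀ b, (l b).card = (sub b α.line).length := fun b => by
      rw [card_eq_length (T b), hT, List.length_flatten, map_length_record,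
        ← List.length_flatten, (ins_perm _).length_eq]
    rw [Finset.sum_congr rfl fun b _ => h b, sum_length_sub, length_line]
  refine ⟨⟨l, T, fun m => ?_⟩, isRecord_iff.2 fun b => (hT b).symm⟩
  rw [hcard]
  simp only [card_filter_eq_count, hT, (nodup_record _ _).count]
  by_cases hm : 1 ≤ m ∧ m ≤ n
  · obtain ⟨j, rfl⟩ := Nat.exists_eq_add_of_le' hm.1
    have hj : j < n := hm.2
    rw [if_pos hm, Finset.sum_eq_single (α.colour (α.perm ⟨j, hj⟩))]
    · rw [if_pos (mem_record_flatten.2 ⟨j, rfl, by simp [line, hj]⟩)]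
    · rintro b - hb
      refine if_neg fun h => ?_
      obtain ⟨i, hi, h⟩ := mem_record_flatten.1 h
      obtain rfl : j = i := by omega
      simp [line, hj] at h
      exact hb h.symm
    · simp
  · rw [if_neg hm]
    refine Finset.sum_eq_zero fun b _ => if_neg fun h => ?_
    obtain ⟨i, rfl, hi⟩ := mem_record_flatten.1 h
    have := (List.getElem?_eq_some_iff.1 hi).1
    simp at this
    omega

/-- Every standard `B`-tableau is a record tableau: its components are insertion tableaux, and the
coloured permutation is assembled from words with these insertion tableaux. -/
theorem exists_isRecord (T : StdTableau B) : ∃ α : ColPerm B T.size, IsRecord α T := by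
  choose w hw using fun b => exists_ins_eq (isTab_rowList (T.tab b))
  have hc : ∀ b x, (w b).count x = (rowList (T.tab b)).flatten.count x := fun b x => by
    rw [← hw, (ins_perm _).count_eq]
  have hpos : ∀ b, 0 ∉ w b := fun b h0 => by
    have h := T.standard 0
    simp only [card_filter_eq_count, ← hc] at h
    rw [if_neg (by omega), Finset.sum_eq_zero_iff] at h
    exact List.count_pos_iff.2 h0 |>.ne' (h b (Finset.mem_univ b))
  have hw' : ∀ b, ((w b).map (· - 1)).map (· + 1) = w b := fun b => by
    rw [List.map_map]
    refine (List.map_congr_left fun x hx => ?_).trans (List.map_id _)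
    have : x ≠ 0 := fun h => hpos b (h ▸ hx)
    simp only [Function.comp_apply, id]
    omega
  obtain ⟨v, -, hv⟩ := exists_sub (w := fun b => (w b).map (· - 1))
    (c := (∑ b, Multiset.replicate (w b).length b).toList) fun b => by
      rw [← Multiset.coe_count, Multiset.coe_toList, Multiset.count_sum']
      simp [Multiset.count_replicate]
  obtain ⟨α, rfl⟩ := exists_word (n := T.size) (v := v) <| by
    rw [List.perm_iff_count]
    intro x
    have h := T.standard (x + 1)
    simp only [card_filter_eq_count, ← hc] at h
    rw [← sum_count_sub, List.nodup_range.count]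
    have h2 : ∀ b, (sub b v).count x = (w b).count (x + 1) := fun b => by
      rw [hv, ← hw' b, List.count_map_of_injective _ (· + 1) (add_left_injective 1), hw']
    simp only [h2, h, List.mem_range, size]
    exact if_congr (by omega) rfl rfl
  refine ⟨α, isRecord_iff.2 fun b => ?_⟩
  rw [record_line, hv, ← ins_map (fun a b h => by simpa using h), hw', hw]

end StdTableau

/-! ### Record tableaux of prefixes and suffixes -/

namespace RobinsonSchensted

theorem zipIdx_drop {A : Type*} (w : List A) (k : ℕ) :
    w.zipIdx.drop k = w.zipIdx.filter fun p => k ≤ p.2 := by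
  conv_rhs => rw [← List.take_append_drop k w.zipIdx, List.filter_append]
  have h1 : (w.zipIdx.take k).filter (fun p => k ≤ p.2) = [] := by
    rw [List.filter_eq_nil_iff]
    intro p hp
    obtain ⟨i, hi, rfl⟩ := List.getElem_of_mem hp
    simp at hi ⊢
    omega
  have h2 : (w.zipIdx.drop k).filter (fun p => k ≤ p.2) = w.zipIdx.drop k := by
    rw [List.filter_eq_self]
    intro p hp
    obtain ⟨i, hi, rfl⟩ := List.getElem_of_mem hp
    simp
  rw [h1, h2, List.nil_append]

/-- The letters of a suffix of a word form an interval of positions; by the symmetry of the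
correspondence, the record tableau of the suffix is the insertion tableau of the restriction of
the inverse to this interval. -/
theorem rows_drop {u v : List ℕ} (hu : u.Nodup) (hv : v.Nodup) (h : rows u = rows v) (k : ℕ) :
    rows (u.drop k) = rows (v.drop k) := by
  have hl : u.length = v.length := by simpa using congrArg List.length h
  have key : ∀ w : List ℕ, w.Nodup → ∃ s : List ℕ, (tableaux w.zipIdx).2 = ins s ∧
      (tableaux (w.zipIdx.drop k)).2 = ins (s.filter fun i => k ≤ i) := by
    intro w hw
    have hp : w.zipIdx.Pairwise fun a b => a.2 < b.2 := by
      have h := List.pairwise_lt_range' (s := 0) (n := w.length)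
      rw [← List.zipIdx_map_snd, List.pairwise_map] at h
      exact h
    let s := w.zipIdx.insertionSort fun a b => a.1 ≤ b.1
    have hs : s.Perm w.zipIdx := List.perm_insertionSort _ _
    have hs1 : s.Pairwise fun a b => a.1 < b.1 := by
      have h1 : s.Pairwise fun a b => a.1 ≤ b.1 := List.pairwise_insertionSort _ _
      have h2 : (s.map Prod.fst).Nodup := by
        rw [(hs.map Prod.fst).nodup_iff, List.zipIdx_map_fst]; exact hw
      rw [List.Nodup, List.pairwise_map] at h2
      exact h1.imp₂ (fun a b h h' => lt_of_le_of_ne h h') h2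
    refine ⟨s.map Prod.snd, tableaux_snd_eq_ins hp hs1 hs, ?_⟩
    rw [tableaux_snd_eq_ins (s := s.filter fun p => k ≤ p.2)
      (hp.sublist (List.drop_sublist _ _)) (hs1.filter _) (by rw [zipIdx_drop]; exact hs.filter _),
      List.filter_map]
    rfl
  obtain ⟨s, h1, h2⟩ := key u hu
  obtain ⟨s', h3, h4⟩ := key v hv
  have hn : ∀ w : List ℕ, (w.zipIdx.map Prod.snd).Nodup := fun w => by
    rw [List.zipIdx_map_snd]; exact List.nodup_range'
  have hsnd : u.zipIdx.map Prod.snd = v.zipIdx.map Prod.snd := by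
    rw [List.zipIdx_map_snd, List.zipIdx_map_snd, hl]
  have h5 : ins s = ins s' := by
    rw [← h1, ← h3, tableaux_snd_eq_iff hsnd (hn u), List.zipIdx_map_fst, List.zipIdx_map_fst, h]
  have h6 : (tableaux (u.zipIdx.drop k)).2 = (tableaux (v.zipIdx.drop k)).2 := by
    rw [h2, h4]
    refine Knuth.ins_eq (Knuth.filter ?_ (knuth_iff.2 h5))
    intro x y z hxy _ hx _
    simp only [decide_eq_true_eq] at *
    omega
  rw [tableaux_snd_eq_iff (by rw [List.map_drop, List.map_drop, hsnd])
    (by rw [List.map_drop]; exact (hn u).sublist (List.drop_sublist _ _)), List.map_drop,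
    List.map_drop, List.zipIdx_map_fst, List.zipIdx_map_fst] at h6
  exact h6

section

variable {B : Type*} [DecidableEq B]

theorem sub_take (b : B) (v : List (ℕ × B)) (k : ℕ) :
    sub b (v.take k) = (sub b v).take (((v.map Prod.snd).take k).count b) := by
  have h : sub b v = sub b (v.take k) ++ sub b (v.drop k) := by
    rw [← sub_append, List.take_append_drop]
  rw [h, ← List.map_take, ← length_sub, List.take_left]

theorem sub_drop (b : B) (v : List (ℕ × B)) (k : ℕ) :
    sub b (v.drop k) = (sub b v).drop (((v.map Prod.snd).take k).count b) := by
  have h : sub b v = sub b (v.take k) ++ sub b (v.drop k) := by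
    rw [← sub_append, List.take_append_drop]
  rw [h, ← List.map_take, ← length_sub, List.drop_left]

/-- The sequence of rows of a prefix is the prefix of the sequence of rows. -/
theorem rows_take (w : List ℕ) (k : ℕ) : rows (w.take k) = (rows w).take k := by
  by_cases h : k ≤ w.length
  · have h1 := rows_append (w.take k) (w.drop k)
    rw [List.take_append_drop] at h1
    rw [h1, List.take_left' (by simp [h])]
  · rw [List.take_of_length_le (by omega), List.take_of_length_le (by simp; omega)]

theorem SameRecord.take {u v : List (ℕ × B)} (h : SameRecord u v) (k : ℕ) :
    SameRecord (u.take k) (v.take k) :=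
  ⟨by rw [List.map_take, List.map_take, h.1], fun b => by
    rw [sub_take, sub_take, rows_take, rows_take, h.1, h.2]⟩

theorem nodup_sub {v : List (ℕ × B)} (h : (v.map Prod.fst).Nodup) (b : B) : (sub b v).Nodup :=
  h.sublist (List.filter_sublist.map _)

theorem SameRecord.drop {u v : List (ℕ × B)} (h : SameRecord u v) (hu : (u.map Prod.fst).Nodup)
    (hv : (v.map Prod.fst).Nodup) (k : ℕ) : SameRecord (u.drop k) (v.drop k) :=
  ⟨by rw [List.map_drop, List.map_drop, h.1], fun b => by
    rw [sub_drop, sub_drop, h.1]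
    exact rows_drop (nodup_sub hu b) (nodup_sub hv b) (h.2 b) _⟩

end

/-! ### Transitivity of standardisation -/

theorem stdOf_iff_getElem {B : Type*} {u v : List (ℕ × B)} : StdOf u v ↔
    ∃ h : u.length = v.length, (∀ i (hi : i < u.length), u[i].2 = v[i].2) ∧
      ∀ i j (hij : i < j) (hj : j < u.length), Std (u[i].1, v[i].1) (u[j].1, v[j].1) := by
  constructor
  · rintro ⟨z, rfl, rfl, h⟩
    rw [List.pairwise_map, List.pairwise_iff_getElem] at h
    refine ⟨by simp, fun i hi => by simp, fun i j hij hj => ?_⟩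
    simpa using h i j (by simp at hj; omega) (by simpa using hj) hij
  · rintro ⟨h, h1, h2⟩
    refine ⟨List.ofFn fun i : Fin u.length => ((u[i].1, (v[i]).1), u[i].2), ?_, ?_, ?_⟩
    · rw [List.map_ofFn]
      exact List.ext_getElem (by simp) fun i _ _ => by simp
    · rw [List.map_ofFn]
      exact List.ext_getElem (by simp [h]) fun i _ _ => by simp [h1]
    · rw [List.map_ofFn, List.pairwise_ofFn]
      exact fun i j hij => h2 i j hij j.2

theorem StdOf.trans {B : Type*} {u v w : List (ℕ × B)} (h : StdOf u v) (h' : StdOf v w) :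
    StdOf u w := by
  obtain ⟨h1, h2, h3⟩ := stdOf_iff_getElem.1 h
  obtain ⟨h4, h5, h6⟩ := stdOf_iff_getElem.1 h'
  refine stdOf_iff_getElem.2 ⟨h1.trans h4, fun i hi => (h2 i hi).trans (h5 i (h1 ▸ hi)),
    fun i j hij hj => ?_⟩
  have h7 := h3 i j hij hj
  have h8 := h6 i j hij (h1 ▸ hj)
  simp only [Std] at h7 h8 ⊢
  omega

end RobinsonSchensted

namespace ColPerm

open RobinsonSchensted

variable {B : Type*} {n m : ℕ}

theorem nodup_fst_line (α : ColPerm B n) : (α.line.map Prod.fst).Nodup :=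
  (map_fst_line_perm α).nodup_iff.2 List.nodup_range

@[simp] theorem std_fst (v : List (ℕ × B)) : (std v).1 = v.length := rfl

theorem std_take (v : List (ℕ × B)) (k : ℕ) : std ((std v).2.line.take k) = std (v.take k) :=
  (std_eq ((stdOf_std _).trans ((stdOf_std v).take k))).symm

theorem std_drop (v : List (ℕ × B)) (k : ℕ) : std ((std v).2.line.drop k) = std (v.drop k) :=
  (std_eq ((stdOf_std _).trans ((stdOf_std v).drop k))).symm

/-! ### Coordinates of products and coproducts -/

theorem line_act_juxt (ρ : Equiv.Perm (Fin (n + m))) (α : ColPerm B n) (β : ColPerm B m) :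
    (act ρ (juxt α β)).line =
      List.ofFn (fun i => ((ρ (Fin.castAdd m (α.perm i)) : ℕ), α.colour (α.perm i))) ++
        List.ofFn (fun i => ((ρ (Fin.natAdd n (β.perm i)) : ℕ), β.colour (β.perm i))) := by
  rw [line, ← List.ofFn_fin_append]
  congr 1
  funext i
  refine Fin.addCases (fun i => ?_) (fun i => ?_) i <;> simp [act, juxt]

theorem act_juxt_injective (α : ColPerm B n) (β : ColPerm B m) :
    Function.Injective fun ρ => act ρ (juxt α β) := fun ρ ρ' h => by
  have := congrArg perm h
  simpa [act] using this

/-- The prefix and the suffix of a term of the product of `α` and `β` standardise to `α` and to `β`.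
-/
theorem stdOf_act_juxt {ρ : Equiv.Perm (Fin (n + m))} (hρ : ρ ∈ X n m) (α : ColPerm B n)
    (β : ColPerm B m) : StdOf α.line ((act ρ (juxt α β)).line.take n) ∧
      StdOf β.line ((act ρ (juxt α β)).line.drop n) := by
  simp only [X, Finset.mem_filter, Finset.mem_univ, true_and] at hρ
  rw [line_act_juxt, List.take_left' (by simp), List.drop_left' (by simp)]
  constructor
  · refine (stdOf_iff (by simp)).2 ⟨fun j => by simp, fun i j hij => ?_⟩
    have h : α.perm i ≠ α.perm j := fun h => hij.ne (α.perm.injective h)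
    have h1 : ∀ a b, ρ (Fin.castAdd m a) < ρ (Fin.castAdd m b) ↔ a < b := fun a b => hρ.1.lt_iff_lt
    have h2 : ∀ a b, ρ (Fin.castAdd m a) ≤ ρ (Fin.castAdd m b) ↔ a ≤ b := fun a b => hρ.1.le_iff_le
    simp only [Fin.getElem_fin, List.getElem_ofFn, Fin.eta, Fin.val_fin_le, Fin.val_fin_lt, h1, h2]
    omega
  · refine (stdOf_iff (by simp)).2 ⟨fun j => by simp, fun i j hij => ?_⟩
    have h : β.perm i ≠ β.perm j := fun h => hij.ne (β.perm.injective h)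
    have h1 : ∀ a b, ρ (Fin.natAdd n a) < ρ (Fin.natAdd n b) ↔ a < b := fun a b => hρ.2.lt_iff_lt
    have h2 : ∀ a b, ρ (Fin.natAdd n a) ≤ ρ (Fin.natAdd n b) ↔ a ≤ b := fun a b => hρ.2.le_iff_le
    simp only [Fin.getElem_fin, List.getElem_ofFn, Fin.eta, Fin.val_fin_le, Fin.val_fin_lt, h1, h2]
    omega

/-- The terms of the product of `α` and `β` are the coloured permutations whose prefix and suffix
standardise to `α` and to `β`. -/
theorem exists_act_juxt {α : ColPerm B n} {β : ColPerm B m} {γ : ColPerm B (n + m)}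
    (hα : StdOf α.line (γ.line.take n)) (hβ : StdOf β.line (γ.line.drop n)) :
    ∃ ρ ∈ X n m, act ρ (juxt α β) = γ := by
  obtain ⟨h1, h2⟩ := (stdOf_iff (by simp)).1 hα
  obtain ⟨h3, h4⟩ := (stdOf_iff (by simp)).1 hβ
  simp only [Fin.getElem_fin, List.getElem_take, List.getElem_drop, line,
    List.getElem_ofFn] at h1 h2 h3 h4
  have hp : ∀ i : Fin n, (juxt α β).perm.symm (Fin.castAdd m i) = Fin.castAdd m (α.perm.symm i) :=
    fun i => by rw [Equiv.symm_apply_eq]; simp [juxt]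
  have hp' : ∀ i : Fin m, (juxt α β).perm.symm (Fin.natAdd n i) = Fin.natAdd n (β.perm.symm i) :=
    fun i => by rw [Equiv.symm_apply_eq]; simp [juxt]
  refine ⟨γ.perm * (juxt α β).perm⁻¹, ?_, ?_⟩
  · simp only [X, Finset.mem_filter, Finset.mem_univ, true_and]
    constructor
    · intro i j hij
      obtain ⟨a, rfl⟩ := α.perm.surjective i
      obtain ⟨b, rfl⟩ := α.perm.surjective j
      have hne : a ≠ b := fun h => hij.ne (by rw [h])
      have e : ∀ a : Fin n, (⟨a, by omega⟩ : Fin (n + m)) = Fin.castAdd m a := fun _ => rfl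
      simp only [e, Fin.val_fin_lt, Fin.val_fin_le] at h2
      have hne' : γ.perm (Fin.castAdd m a) ≠ γ.perm (Fin.castAdd m b) := fun h =>
        hne (Fin.castAdd_injective _ _ (γ.perm.injective h))
      simp only [Function.comp_apply, Equiv.Perm.mul_apply, Equiv.Perm.inv_def, hp,
        Equiv.symm_apply_apply]
      rcases lt_or_gt_of_ne hne with h | h
      · have := h2 a b h
        omega
      · have := h2 b a h
        omega
    · intro i j hij
      obtain ⟨a, rfl⟩ := β.perm.surjective i
      obtain ⟨b, rfl⟩ := β.perm.surjective j
      have hne : a ≠ b := fun h => hij.ne (by rw [h])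
      have e : ∀ a : Fin m, (⟨n + a, by omega⟩ : Fin (n + m)) = Fin.natAdd n a := fun _ => rfl
      simp only [e, Fin.val_fin_lt, Fin.val_fin_le] at h4
      have hne' : γ.perm (Fin.natAdd n a) ≠ γ.perm (Fin.natAdd n b) := fun h =>
        hne (Fin.natAdd_injective _ _ (γ.perm.injective h))
      simp only [Function.comp_apply, Equiv.Perm.mul_apply, Equiv.Perm.inv_def, hp',
        Equiv.symm_apply_apply]
      rcases lt_or_gt_of_ne hne with h | h
      · have := h4 a b h
        omega
      · have := h4 b a h
        omega
  · have hs : ∀ i, (γ.perm * (juxt α β).perm⁻¹).symm (γ.perm i) = (juxt α β).perm i := fun i => by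
      rw [Equiv.symm_apply_eq]; simp
    ext1
    · funext i
      obtain ⟨j, rfl⟩ := γ.perm.surjective i
      simp only [act, hs]
      refine Fin.addCases (fun j => ?_) (fun j => ?_) j
      · rw [show (juxt α β).perm (Fin.castAdd m j) = Fin.castAdd m (α.perm j) by simp [juxt]]
        simp only [juxt, Fin.append_left]
        exact h1 j
      · rw [show (juxt α β).perm (Fin.natAdd n j) = Fin.natAdd n (β.perm j) by simp [juxt]]
        simp only [juxt, Fin.append_right]
        exact h3 j
    · simp [act]

open ShuffleAlg

theorem _root_.RobinsonSchensted.StdOf.map_colour {u v : List (ℕ × B)} (h : StdOf u v)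
    (f : B → B) : StdOf (u.map fun p => (p.1, f p.2)) (v.map fun p => (p.1, f p.2)) := by
  obtain ⟨z, rfl, rfl, h⟩ := h
  exact ⟨z.map fun p => (p.1, f p.2), by simp [Function.comp_def], by simp [Function.comp_def],
    by simpa [Function.comp_def] using h⟩

theorem stdOf_word_self (α : ColPerm B n) : StdOf α.word α.word := by
  rw [← line_dual_id]; exact stdOf_line_self _

/-- The first factors of the terms of the coproduct of `α` are the duals of the standardised
prefixes of the dual of `α`. -/
theorem std_take_dual (star : B → B) (α : ColPerm B n) (k : ℕ) (h : k ≤ n) :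
    std (((α.dual star).line).take k) = ⟨k, (α.low k h).dual star⟩ := by
  refine std_eq ?_
  rw [line_dual, line_dual, word_low, ← List.map_take]
  exact ((stdOf_word_self α).take k).st.map_colour star

/-- The second factors of the terms of the coproduct of `α` are the duals of the standardised
suffixes of the dual of `α`. -/
theorem std_drop_dual (star : B → B) (α : ColPerm B n) (k : ℕ) (h : k ≤ n) :
    std (((α.dual star).line).drop k) = ⟨n - k, (α.high k h).dual star⟩ := by
  refine std_eq ?_
  rw [line_dual, line_dual, word_high, ← List.map_drop]
  exact ((stdOf_word_self α).drop k).st.map_colour star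

theorem dual_inj {star : B → B} (h : Function.Involutive star) {α : ColPerm B n}
    {β : ColPerm B m} : (⟨n, α.dual star⟩ : Σ n, ColPerm B n) = ⟨m, β.dual star⟩ ↔
      (⟨n, α⟩ : Σ n, ColPerm B n) = ⟨m, β⟩ := by
  constructor
  · intro h1
    have := congrArg (fun g : Σ n, ColPerm B n => (⟨g.1, g.2.dual star⟩ : Σ n, ColPerm B n)) h1
    simpa [dual_dual h] using this
  · intro h1
    exact congrArg (fun g : Σ n, ColPerm B n => (⟨g.1, g.2.dual star⟩ : Σ n, ColPerm B n)) h1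

end ColPerm

namespace FQSym

open ColPerm RobinsonSchensted

noncomputable section

variable {K B : Type*} [CommRing K]

variable (K B) in
/-- The coefficient of a coloured permutation. -/
def co (g : Σ n, ColPerm B n) : FQSym K B →ₗ[K] K := (basis K B).coord g

open Classical in
theorem co_of (g : Σ n, ColPerm B n) {n : ℕ} (α : ColPerm B n) :
    co K B g (of K α) = if (⟨n, α⟩ : Σ n, ColPerm B n) = g then 1 else 0 := by
  rw [co, of, Module.Basis.coord_apply, Module.Basis.repr_self, Finsupp.single_apply]

theorem ext_co {x y : FQSym K B} (h : ∀ g, co K B g x = co K B g y) : x = y :=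
  (basis K B).ext_elem h

variable (K B) in
/-- The coefficient of a tensor product of two coloured permutations. -/
def co2 (g h : Σ n, ColPerm B n) : FQSym K B ⊗[K] FQSym K B →ₗ[K] K :=
  LinearMap.mul' K K ∘ₗ TensorProduct.map (co K B g) (co K B h)

@[simp] theorem co2_tmul (g h : Σ n, ColPerm B n) (x y : FQSym K B) :
    co2 K B g h (x ⊗ₜ y) = co K B g x * co K B h y := rfl

theorem ext_co2 {x y : FQSym K B ⊗[K] FQSym K B} (H : ∀ g h, co2 K B g h x = co2 K B g h y) :
    x = y := by
  refine ((basis K B).tensorProduct (basis K B)).ext_elem fun ⟨g, h⟩ => ?_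
  have key : ∀ z, ((basis K B).tensorProduct (basis K B)).repr z (g, h) = co2 K B g h z := by
    intro z
    induction z using TensorProduct.induction_on with
    | zero => simp
    | tmul x y => simp [co, mul_comm]
    | add x y hx hy => simp [hx, hy]
  rw [key, key, H]

open Classical in
theorem co_of_mul_of (g : Σ n, ColPerm B n) {n m : ℕ} (α : ColPerm B n) (β : ColPerm B m) :
    co K B g (of K α * of K β) = if std (g.2.line.take n) = ⟨n, α⟩ ∧ std (g.2.line.drop n) = ⟨m, β⟩
      then 1 else 0 := by
  rw [of_mul_of, map_sum]
  simp only [co_of]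
  split_ifs with h
  · obtain ⟨N, γ⟩ := g
    obtain ⟨h1, h2⟩ := h
    have hN : N = n + m := by
      have h3 := congrArg Sigma.fst h1
      have h4 := congrArg Sigma.fst h2
      simp at h3 h4
      omega
    subst hN
    have h5 := stdOf_std (γ.line.take n)
    have h6 := stdOf_std (γ.line.drop n)
    rw [h1] at h5
    rw [h2] at h6
    obtain ⟨ρ, hρ, rfl⟩ := exists_act_juxt h5 h6
    rw [Finset.sum_eq_single ρ]
    · rw [if_pos rfl]
    · intro ρ' _ hne
      refine if_neg fun h => hne (act_juxt_injective α β ?_)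
      simpa using h
    · exact fun h => absurd hρ h
  · refine Finset.sum_eq_zero fun ρ hρ => if_neg ?_
    rintro rfl
    obtain ⟨h1, h2⟩ := stdOf_act_juxt hρ α β
    exact h ⟨std_eq h1, std_eq h2⟩

/-- The coefficient of a coloured permutation in a product: the word of the coloured permutation is
cut into a prefix and a suffix, which are standardised. -/
theorem co_mul (g : Σ n, ColPerm B n) (x y : FQSym K B) :
    co K B g (x * y) = ∑ k ∈ Finset.range (g.1 + 1),
      co K B (std (g.2.line.take k)) x * co K B (std (g.2.line.drop k)) y := by
  classical
  induction x using ind with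
  | h0 => simp
  | ha x x' h h' => simp only [add_mul, map_add, h, h', Finset.sum_add_distrib]
  | hs c x h => simp only [smul_mul_assoc, map_smul, h, Finset.smul_sum]
  | hw n u =>
  induction y using ind with
  | h0 => simp
  | ha x x' h h' => simp only [mul_add, map_add, h, h', Finset.sum_add_distrib]
  | hs c x h => simp only [mul_smul_comm, map_smul, h, Finset.smul_sum]
  | hw m v =>
    rw [co_of_mul_of]
    simp only [co_of, ← ite_and, mul_ite, mul_one, mul_zero]
    obtain ⟨N, γ⟩ := g
    split_ifs with h
    · have h1 := congrArg Sigma.fst h.1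
      simp at h1
      rw [Finset.sum_eq_single n, if_pos ⟨h.2.symm, h.1.symm⟩]
      · intro k hk hkn
        refine if_neg fun h' => hkn ?_
        have h2 := congrArg Sigma.fst h'.2
        simp at h2 hk
        omega
      · intro hn
        simp at hn
        omega
    · refine (Finset.sum_eq_zero fun k hk => if_neg fun h' => h ?_).symm
      have h2 := congrArg Sigma.fst h'.2
      simp at h2 hk
      obtain rfl : k = n := by omega
      exact ⟨h'.2.symm, h'.1.symm⟩

/-- The coefficients of a coproduct. By duality, they are sums of coefficients over the terms of a
product. -/
theorem co2_comul {n m : ℕ} (α : ColPerm B n) (β : ColPerm B m) (x : FQSym K B) :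
    co2 K B ⟨n, α⟩ ⟨m, β⟩ (Coalgebra.comul x) = ∑ ρ ∈ X n m,
      co K B ⟨n + m, (act ρ (juxt (α.dual id) (β.dual id))).dual id⟩ x := by
  classical
  have hid : Function.Involutive (id : B → B) := fun _ => rfl
  induction x using ind with
  | h0 => simp
  | ha x x' h h' => simp only [map_add, h, h', Finset.sum_add_distrib]
  | hs c x h => simp only [map_smul, h, Finset.smul_sum]
  | hw N γ =>
    have h1 : ∑ ρ ∈ X n m, co K B ⟨n + m, (act ρ (juxt (α.dual id) (β.dual id))).dual id⟩ (of K γ) =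
        co K B ⟨N, γ.dual id⟩ (of K (α.dual id) * of K (β.dual id)) := by
      rw [of_mul_of, map_sum]
      refine Finset.sum_congr rfl fun ρ _ => ?_
      rw [co_of, co_of]
      refine if_congr ?_ rfl rfl
      rw [← dual_inj hid, dual_dual hid, eq_comm]
    rw [h1, co_mul, ← Fin.sum_univ_eq_sum_range
      (fun k => co K B (std ((γ.dual id).line.take k)) (of K (α.dual id)) *
        co K B (std ((γ.dual id).line.drop k)) (of K (β.dual id))) (N + 1)]
    change co2 K B ⟨n, α⟩ ⟨m, β⟩ (comulMap (of K γ)) = _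
    rw [comulMap_of, map_sum]
    refine Finset.sum_congr rfl fun k _ => ?_
    rw [co2_tmul, std_take_dual id γ k k.is_le, std_drop_dual id γ k k.is_le]
    simp only [co_of, dual_inj hid, eq_comm (a := (⟨n, α⟩ : Σ n, ColPerm B n)),
      eq_comm (a := (⟨m, β⟩ : Σ n, ColPerm B n))]

end

end FQSym

/-! ### The coplactic bialgebra -/

namespace StdTableau

open RobinsonSchensted ColPerm

variable {B : Type*} [Fintype B] [DecidableEq B]

/-- The record tableau of a coloured permutation. -/
noncomputable def recTab (g : Σ n, ColPerm B n) : StdTableau B :=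
  (exists_isRecord_tableau g.2).choose

/-- A coloured permutation with a given record tableau. -/
noncomputable def rep (T : StdTableau B) : Σ n, ColPerm B n := ⟨T.size, (exists_isRecord T).choose⟩

theorem isRecord_recTab (g : Σ n, ColPerm B n) : IsRecord g.2 (recTab g) :=
  (exists_isRecord_tableau g.2).choose_spec

theorem isRecord_iff_recTab {n : ℕ} {α : ColPerm B n} {T : StdTableau B} :
    IsRecord α T ↔ recTab ⟨n, α⟩ = T :=
  ⟨fun h => isRecord_unique (isRecord_recTab ⟨n, α⟩) h, fun h => h ▸ isRecord_recTab ⟨n, α⟩⟩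

@[simp] theorem recTab_rep (T : StdTableau B) : recTab (rep T) = T :=
  isRecord_iff_recTab.1 (exists_isRecord T).choose_spec

theorem size_recTab (g : Σ n, ColPerm B n) : (recTab g).size = g.1 := size_eq (isRecord_recTab g)

theorem recTab_eq_iff {g h : Σ n, ColPerm B n} :
    recTab g = recTab h ↔ SameRecord g.2.line h.2.line := by
  rw [sameRecord_iff]
  constructor
  · intro e b
    rw [isRecord_iff.1 (isRecord_recTab g), isRecord_iff.1 (isRecord_recTab h), e]
  · intro e
    refine isRecord_iff_recTab.1 (isRecord_iff.2 fun b => ?_)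
    rw [e, isRecord_iff.1 (isRecord_recTab h)]

theorem rowLens_shape (g : Σ n, ColPerm B n) (b : B) :
    ((recTab g).shape b).rowLens = (ins (sub b g.2.line)).map List.length := by
  rw [← map_length_record, isRecord_iff.1 (isRecord_recTab g), map_length_rowList]

end StdTableau

namespace FQSym

open ColPerm RobinsonSchensted

noncomputable section

variable {K B : Type*} [CommRing K]

theorem pairing_of {star : B → B} (hstar : Function.Involutive star) {n : ℕ} (β : ColPerm B n)
    (x : FQSym K B) : pairing K star x (of K β) = co K B ⟨n, β.dual star⟩ x := by
  classical
  induction x using ind with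
  | h0 => simp
  | ha x x' h h' => simp only [map_add, LinearMap.add_apply, h, h']
  | hs c x h => simp only [map_smul, LinearMap.smul_apply, h]
  | hw m α =>
    rw [co_of, pairing, of, of, Module.Basis.constr_basis, Module.Basis.constr_basis]
    refine if_congr ?_ rfl rfl
    rw [← dual_inj hstar, dual_dual hstar, eq_comm]

/-- The product is adjoint to the coproduct. -/
theorem pairing_mul {star : B → B} (hstar : Function.Involutive star) (x y z : FQSym K B) :
    pairing K star (x * y) z = LinearMap.mul' K K
      (TensorProduct.map (pairing K star x) (pairing K star y) (Coalgebra.comul z)) := by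
  induction z using ind with
  | h0 => simp
  | ha z z' h h' => simp only [map_add, h, h']
  | hs c z h => simp only [map_smul, h]
  | hw n γ =>
    change _ = LinearMap.mul' K K (TensorProduct.map _ _ (comulMap (of K γ)))
    rw [pairing_of hstar, co_mul, comulMap_of, map_sum, map_sum, ← Fin.sum_univ_eq_sum_range
      (fun k => co K B (std ((γ.dual star).line.take k)) x *
        co K B (std ((γ.dual star).line.drop k)) y) (n + 1)]
    refine Finset.sum_congr rfl fun k _ => ?_
    rw [TensorProduct.map_tmul, LinearMap.mul'_apply, pairing_of hstar, pairing_of hstar,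
      std_take_dual star γ k k.is_le, std_drop_dual star γ k k.is_le]

end

end FQSym

namespace StdTableau

open RobinsonSchensted ColPerm FQSym

noncomputable section

variable {K B : Type*} [CommRing K] [Fintype B] [DecidableEq B]

open Classical in
theorem co_t (g : Σ n, ColPerm B n) (T : StdTableau B) :
    co K B g (t K T) = if recTab g = T then 1 else 0 := by
  rw [t, map_sum]
  simp only [co_of]
  obtain ⟨n, γ⟩ := g
  by_cases h : recTab ⟨n, γ⟩ = T
  · rw [if_pos h]
    obtain rfl : n = T.size := by rw [← h, size_recTab]
    rw [Finset.sum_eq_single γ]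
    · rw [if_pos rfl]
    · intro α _ hα
      exact if_neg fun h' => hα (by simpa using h')
    · intro hγ
      exact absurd (by simpa using isRecord_iff_recTab.2 h) hγ
  · rw [if_neg h]
    refine Finset.sum_eq_zero fun α hα => if_neg fun h' => h ?_
    rw [← h', ← isRecord_iff_recTab]
    exact (Finset.mem_filter.1 hα).2

open Classical in
variable (K B) in
/-- The projection onto the coplactic submodule that evaluates the coefficients at the chosen
representatives of the coplactic classes. -/
def proj : FQSym K B →ₗ[K] FQSym K B := (basis K B).constr K fun g =>
  if g = rep (recTab g) then t K (recTab g) else 0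

open Classical in
theorem proj_of {n : ℕ} (α : ColPerm B n) : proj K B (of K α) =
    if ⟨n, α⟩ = rep (recTab ⟨n, α⟩) then t K (recTab ⟨n, α⟩) else 0 := by
  rw [proj, of, Module.Basis.constr_basis]

theorem co_proj (g : Σ n, ColPerm B n) (x : FQSym K B) :
    co K B g (proj K B x) = co K B (rep (recTab g)) x := by
  classical
  induction x using ind with
  | h0 => simp
  | ha x x' h h' => simp only [map_add, h, h']
  | hs c x h => simp only [map_smul, h]
  | hw m α =>
    rw [proj_of, co_of]
    split_ifs with h1 h2 h2
    · rw [co_t, if_pos]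
      rw [h2, recTab_rep]
    · rw [co_t, if_neg]
      rintro h3
      exact h2 (h3 ▸ h1)
    · rw [h2, recTab_rep] at h1
      exact absurd rfl h1
    · rw [map_zero]

theorem proj_mem (x : FQSym K B) : proj K B x ∈ coplactic K B := by
  classical
  induction x using ind with
  | h0 => rw [map_zero]; exact zero_mem _
  | ha x x' h h' => rw [map_add]; exact add_mem h h'
  | hs c x h => rw [map_smul]; exact Submodule.smul_mem _ _ h
  | hw m α =>
    rw [proj_of]
    split_ifs
    · exact Submodule.subset_span ⟨_, rfl⟩
    · exact zero_mem _

theorem t_mem (T : StdTableau B) : t K T ∈ coplactic K B := Submodule.subset_span ⟨T, rfl⟩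

/-- The coplactic submodule consists of the elements with coefficients that depend only on the
record tableaux. -/
theorem mem_coplactic {x : FQSym K B} :
    x ∈ coplactic K B ↔ ∀ g h, recTab g = recTab h → co K B g x = co K B h x := by
  classical
  constructor
  · intro hx g h e
    induction hx using Submodule.span_induction with
    | mem x hx => obtain ⟨T, rfl⟩ := hx; rw [co_t, co_t, e]
    | zero => simp
    | add x y _ _ hx hy => simp only [map_add, hx, hy]
    | smul c x _ hx => simp only [map_smul, hx]
  · intro h
    have : proj K B x = x := ext_co fun g => by rw [co_proj]; exact h _ _ (by simp)
    rw [← this]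
    exact proj_mem x

theorem proj_eq_self {x : FQSym K B} (h : x ∈ coplactic K B) : proj K B x = x :=
  ext_co fun g => by rw [co_proj]; exact mem_coplactic.1 h _ _ (by simp)

/-- The record tableaux of a coloured permutation determine those of the standardised prefixes and
suffixes of its word. -/
theorem mul_mem_coplactic {x y : FQSym K B} (hx : x ∈ coplactic K B) (hy : y ∈ coplactic K B) :
    x * y ∈ coplactic K B := by
  rw [mem_coplactic] at *
  intro g h e
  have hn : g.1 = h.1 := by rw [← size_recTab, ← size_recTab, e]
  rw [co_mul, co_mul]
  refine Finset.sum_congr (by rw [hn]) fun k _ => ?_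
  have hr := recTab_eq_iff.1 e
  congr 1
  · exact hx _ _ (recTab_eq_iff.2 (((stdOf_std _).sameRecord.trans (hr.take k)).trans
      (stdOf_std _).sameRecord.symm))
  · exact hy _ _ (recTab_eq_iff.2 (((stdOf_std _).sameRecord.trans
      (hr.drop (nodup_fst_line _) (nodup_fst_line _) k)).trans (stdOf_std _).sameRecord.symm))

theorem one_mem_coplactic : (1 : FQSym K B) ∈ coplactic K B := by
  classical
  rw [mem_coplactic]
  intro g h e
  have hn : g.1 = h.1 := by rw [← size_recTab, ← size_recTab, e]
  obtain ⟨n, α⟩ := g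
  obtain ⟨m, β⟩ := h
  obtain rfl : n = m := hn
  change co K B _ (of K _) = co K B _ (of K _)
  rw [co_of, co_of]
  have h0 : ∀ {n : ℕ} {α : ColPerm B n} {β : ColPerm B 0},
      (⟨0, β⟩ : Σ n, ColPerm B n) = ⟨n, α⟩ ↔ n = 0 := by
    intro n α β
    refine ⟨fun h => (congrArg Sigma.fst h).symm, ?_⟩
    rintro rfl
    congr 1
    ext i
    · exact i.elim0
    · exact i.elim0
  simp only [h0]

variable (K B) in
/-- The coplactic submodule as a subalgebra. -/
def coplacticAlg : Subalgebra K (FQSym K B) where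
  carrier := coplactic K B
  mul_mem' := mul_mem_coplactic
  one_mem' := one_mem_coplactic
  add_mem' := add_mem
  zero_mem' := zero_mem _
  algebraMap_mem' r := by
    rw [Algebra.algebraMap_eq_smul_one]
    exact Submodule.smul_mem _ _ one_mem_coplactic

/-- The terms of a coproduct correspond to concatenations of words with letters that are changed in
an order preserving way, and such concatenations are compatible with Knuth equivalence. -/
theorem recTab_act_juxt {n m : ℕ} {α : ColPerm B n} {β : ColPerm B m} {α' : ColPerm B n}
    {β' : ColPerm B m} (hα : recTab ⟨n, α⟩ = recTab ⟨n, α'⟩) (hβ : recTab ⟨m, β⟩ = recTab ⟨m, β'⟩)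
    {ρ : Equiv.Perm (Fin (n + m))} (hρ : ρ ∈ X n m) :
    recTab ⟨n + m, (act ρ (juxt (α.dual id) (β.dual id))).dual id⟩ =
      recTab ⟨n + m, (act ρ (juxt (α'.dual id) (β'.dual id))).dual id⟩ := by
  rw [recTab_eq_iff, sameRecord_iff_knuth] at *
  simp only [X, Finset.mem_filter, Finset.mem_univ, true_and] at hρ
  let f : ℕ → ℕ := fun x => if h : x < n then ρ (Fin.castAdd m ⟨x, h⟩) else 0
  let g : ℕ → ℕ := fun x => if h : x < m then ρ (Fin.natAdd n ⟨x, h⟩) else 0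
  have key : ∀ (α : ColPerm B n) (β : ColPerm B m),
      ((act ρ (juxt (α.dual id) (β.dual id))).dual id).word =
        (α.word.map fun p => (f p.1, p.2)) ++ β.word.map fun p => (g p.1, p.2) := by
    intro α β
    rw [word_dual_id, line_act_juxt, word, word, List.map_ofFn, List.map_ofFn]
    congr 2 <;> funext i <;> simp [f, g, dual_perm, dual_colour] <;> rfl
  intro b
  rw [key, key, sub_append, sub_append, sub_map, sub_map, sub_map, sub_map]
  refine Knuth.append ((hα b).map ?_) ((hβ b).map ?_)
  · intro x hx y hy hxy
    have h1 := lt_of_mem_word (mem_sub.1 hx)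
    have h2 := lt_of_mem_word (mem_sub.1 hy)
    simp only at h1 h2
    simp only [f, dif_pos h1, dif_pos h2]
    exact hρ.1 (show (⟨x, h1⟩ : Fin n) < ⟨y, h2⟩ from hxy)
  · intro x hx y hy hxy
    have h1 := lt_of_mem_word (mem_sub.1 hx)
    have h2 := lt_of_mem_word (mem_sub.1 hy)
    simp only at h1 h2
    simp only [g, dif_pos h1, dif_pos h2]
    exact hρ.2 (show (⟨x, h1⟩ : Fin m) < ⟨y, h2⟩ from hxy)

/-- The coefficients of the coproduct of a coplactic element depend only on the record tableaux. -/
theorem co2_comul_eq {x : FQSym K B} (hx : x ∈ coplactic K B) {g g' h h' : Σ n, ColPerm B n}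
    (hg : recTab g = recTab g') (hh : recTab h = recTab h') :
    co2 K B g h (Coalgebra.comul x) = co2 K B g' h' (Coalgebra.comul x) := by
  have hn : g.1 = g'.1 := by rw [← size_recTab, ← size_recTab, hg]
  have hm : h.1 = h'.1 := by rw [← size_recTab, ← size_recTab, hh]
  obtain ⟨n, α⟩ := g
  obtain ⟨_, α'⟩ := g'
  obtain ⟨m, β⟩ := h
  obtain ⟨_, β'⟩ := h'
  obtain rfl := hn
  obtain rfl := hm
  rw [co2_comul, co2_comul]
  exact Finset.sum_congr rfl fun ρ hρ =>
    mem_coplactic.1 hx _ _ (recTab_act_juxt hg hh hρ)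

theorem co2_map_proj (g h : Σ n, ColPerm B n) (z : FQSym K B ⊗[K] FQSym K B) :
    co2 K B g h (TensorProduct.map (proj K B) (proj K B) z) =
      co2 K B (rep (recTab g)) (rep (recTab h)) z := by
  induction z using TensorProduct.induction_on with
  | zero => simp
  | tmul x y => simp [co_proj]
  | add x y hx hy => simp only [map_add, hx, hy]

/-- The coproduct of a coplactic element lies in the image of `𝓠(B) ⊗ 𝓠(B)`. -/
theorem map_proj_comul {x : FQSym K B} (hx : x ∈ coplactic K B) :
    TensorProduct.map (proj K B) (proj K B) (Coalgebra.comul x) = Coalgebra.comul (R := K) x :=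
  ext_co2 fun g h => by
    rw [co2_map_proj]
    exact co2_comul_eq hx (by simp) (by simp)

variable (K B) in
/-- The inclusion of the coplactic algebra. -/
def inc : coplacticAlg K B →ₗ[K] FQSym K B := (coplacticAlg K B).val.toLinearMap

@[simp] theorem inc_apply (x : coplacticAlg K B) : inc K B x = x := rfl

variable (K B) in
/-- A left inverse of the inclusion of the coplactic algebra. Because of it, the tensor powers of
the inclusion are injective, over any commutative ring. -/
def retr : FQSym K B →ₗ[K] coplacticAlg K B :=
  (proj K B).codRestrict (Subalgebra.toSubmodule (coplacticAlg K B)) proj_mem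

theorem retr_comp_inc : retr K B ∘ₗ inc K B = LinearMap.id :=
  LinearMap.ext fun x => Subtype.ext (proj_eq_self x.2)

theorem inc_comp_retr : inc K B ∘ₗ retr K B = proj K B := rfl

theorem inc2_injective : Function.Injective (TensorProduct.map (inc K B) (inc K B)) :=
  Function.LeftInverse.injective (g := TensorProduct.map (retr K B) (retr K B)) fun x => by
    rw [← LinearMap.comp_apply, ← TensorProduct.map_comp, retr_comp_inc, TensorProduct.map_id]; rfl

theorem inc3_injective :
    Function.Injective (TensorProduct.map (inc K B) (TensorProduct.map (inc K B) (inc K B))) :=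
  Function.LeftInverse.injective
    (g := TensorProduct.map (retr K B) (TensorProduct.map (retr K B) (retr K B))) fun x => by
      rw [← LinearMap.comp_apply, ← TensorProduct.map_comp, ← TensorProduct.map_comp, retr_comp_inc,
        TensorProduct.map_id, TensorProduct.map_id]; rfl

variable (K B) in
/-- The coproduct of the coplactic algebra: the coproduct of `𝓕(K B)`, followed by a retraction. By
`map_inc_comulQ`, it is the restriction of the coproduct of `𝓕(K B)`. -/
def comulQ : coplacticAlg K B →ₗ[K] coplacticAlg K B ⊗[K] coplacticAlg K B :=
  TensorProduct.map (retr K B) (retr K B) ∘ₗ Coalgebra.comul ∘ₗ inc K B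

theorem map_inc_comulQ :
    TensorProduct.map (inc K B) (inc K B) ∘ₗ comulQ K B = Coalgebra.comul ∘ₗ inc K B :=
  LinearMap.ext fun x => by
    rw [comulQ, ← LinearMap.comp_assoc, ← TensorProduct.map_comp, inc_comp_retr]
    exact map_proj_comul x.2

instance : Coalgebra K (coplacticAlg K B) where
  comul := comulQ K B
  counit := Coalgebra.counit ∘ₗ inc K B
  coassoc := by
    refine LinearMap.ext fun x => inc3_injective ?_
    have h := LinearMap.congr_fun (Coalgebra.coassoc (R := K) (A := FQSym K B)) (inc K B x)
    simp only [LinearMap.comp_apply, LinearEquiv.coe_coe] at h ⊢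
    have e := LinearMap.congr_fun (map_inc_comulQ (K := K) (B := B)) x
    simp only [LinearMap.comp_apply] at e
    rw [TensorProduct.map_map_assoc, LinearMap.rTensor, LinearMap.lTensor,
      ← LinearMap.comp_apply, ← LinearMap.comp_apply (TensorProduct.map _ _),
      ← TensorProduct.map_comp, ← TensorProduct.map_comp, map_inc_comulQ,
      LinearMap.comp_id]
    rw [← e, LinearMap.rTensor, LinearMap.lTensor, ← LinearMap.comp_apply,
      ← LinearMap.comp_apply (TensorProduct.map _ _), ← TensorProduct.map_comp,
      ← TensorProduct.map_comp, LinearMap.id_comp] at h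
    exact h
  rTensor_counit_comp_comul := by
    refine LinearMap.ext fun x => ?_
    have h := LinearMap.congr_fun
      (Coalgebra.rTensor_counit_comp_comul (R := K) (A := FQSym K B)) (inc K B x)
    have e := LinearMap.congr_fun (map_inc_comulQ (K := K) (B := B)) x
    simp only [LinearMap.comp_apply] at h e ⊢
    rw [← e, LinearMap.rTensor, ← LinearMap.comp_apply, ← TensorProduct.map_comp,
      LinearMap.id_comp] at h
    have h' := congrArg (TensorProduct.map LinearMap.id (retr K B)) h
    rw [← LinearMap.comp_apply, ← TensorProduct.map_comp, retr_comp_inc, LinearMap.id_comp] at h'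
    rw [LinearMap.rTensor, h']
    simp only [TensorProduct.mk_apply, TensorProduct.map_tmul, LinearMap.id_apply]
    rw [← LinearMap.comp_apply, retr_comp_inc, LinearMap.id_apply]
  lTensor_counit_comp_comul := by
    refine LinearMap.ext fun x => ?_
    have h := LinearMap.congr_fun
      (Coalgebra.lTensor_counit_comp_comul (R := K) (A := FQSym K B)) (inc K B x)
    have e := LinearMap.congr_fun (map_inc_comulQ (K := K) (B := B)) x
    simp only [LinearMap.comp_apply] at h e ⊢
    rw [← e, LinearMap.lTensor, ← LinearMap.comp_apply, ← TensorProduct.map_comp,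
      LinearMap.id_comp] at h
    have h' := congrArg (TensorProduct.map (retr K B) LinearMap.id) h
    rw [← LinearMap.comp_apply, ← TensorProduct.map_comp, retr_comp_inc, LinearMap.id_comp] at h'
    rw [LinearMap.lTensor, h']
    simp only [LinearMap.flip_apply, TensorProduct.mk_apply, TensorProduct.map_tmul,
      LinearMap.id_apply]
    rw [← LinearMap.comp_apply, retr_comp_inc, LinearMap.id_apply]

theorem map_inc_comul (x : coplacticAlg K B) :
    TensorProduct.map (inc K B) (inc K B) (Coalgebra.comul x) =
      Coalgebra.comul (R := K) (x : FQSym K B) := LinearMap.congr_fun map_inc_comulQ x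

theorem counit_coplactic (x : coplacticAlg K B) :
    Coalgebra.counit (R := K) x = Coalgebra.counit (R := K) (x : FQSym K B) := rfl

instance : Bialgebra K (coplacticAlg K B) := Bialgebra.mk' K (coplacticAlg K B)
  (by rw [counit_coplactic]; exact Bialgebra.counit_one)
  (fun {x y} => by
    rw [counit_coplactic, counit_coplactic, counit_coplactic]; exact Bialgebra.counit_mul _ _)
  (by
    apply inc2_injective
    rw [map_inc_comul, Algebra.TensorProduct.one_def, TensorProduct.map_tmul]
    exact Bialgebra.comul_one)
  (fun {x y} => by
    apply inc2_injective
    have h := map_mul (Algebra.TensorProduct.map (coplacticAlg K B).val (coplacticAlg K B).val)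
      (Coalgebra.comul (R := K) x) (Coalgebra.comul (R := K) y)
    refine Eq.trans ?_ h.symm
    refine (map_inc_comul _).trans ?_
    refine Eq.trans ?_ (congrArg₂ (· * ·) (map_inc_comul x) (map_inc_comul y)).symm
    exact Bialgebra.comul_mul _ _)

end

end StdTableau

/-! ### Generating series of functions on words -/

namespace RobinsonSchensted

section

variable {A K : Type*} [DecidableEq A]

/-- The words in which each letter `a` occurs `e a` times. -/
noncomputable def words (e : A →₀ ℕ) : Finset (List A) :=
  (Multiset.lists (Finsupp.toMultiset e)).toFinset

theorem mem_words {e : A →₀ ℕ} {v : List A} :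
    v ∈ words e ↔ (v : Multiset A) = Finsupp.toMultiset e := by
  rw [words, Multiset.mem_toFinset, Multiset.mem_lists_iff, eq_comm]
  rfl

theorem mem_words_iff {e : A →₀ ℕ} {v : List A} :
    v ∈ words e ↔ Multiset.toFinsupp (v : Multiset A) = e := by
  rw [mem_words, ← Multiset.toFinsupp_symm_apply]
  exact AddEquiv.eq_symm_apply _

/-- Summation over the words with given letters turns the convolution of functions on words, with
respect to the deconcatenation of words, into the product of series. -/
theorem sum_words_conv [CommSemiring K] (e : A →₀ ℕ) (f g : List A → K) :
    ∑ v ∈ words e, ∑ k ∈ Finset.range (v.length + 1), f (v.take k) * g (v.drop k) =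
      ∑ p ∈ Finset.HasAntidiagonal.antidiagonal e,
        (∑ u ∈ words p.1, f u) * ∑ w ∈ words p.2, g w := by
  simp only [Finset.sum_mul_sum, ← Finset.sum_product']
  rw [Finset.sum_sigma', Finset.sum_sigma']
  refine Finset.sum_bij' (fun x _ => ⟨(Multiset.toFinsupp (x.1.take x.2 : Multiset A),
      Multiset.toFinsupp (x.1.drop x.2 : Multiset A)), (x.1.take x.2, x.1.drop x.2)⟩)
    (fun y _ => ⟨y.2.1 ++ y.2.2, y.2.1.length⟩) ?_ ?_ ?_ ?_ ?_
  · rintro ⟨v, k⟩ h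
    simp only [Finset.mem_sigma, mem_words_iff, Finset.mem_range] at h
    simp only [Finset.mem_sigma, Finset.HasAntidiagonal.mem_antidiagonal, Finset.mem_product,
      mem_words_iff, and_true]
    rw [← map_add, Multiset.coe_add, List.take_append_drop, h.1]
  · rintro ⟨⟨p, q⟩, ⟨u, w⟩⟩ h
    simp only [Finset.mem_sigma, Finset.HasAntidiagonal.mem_antidiagonal, Finset.mem_product,
      mem_words_iff] at h
    simp only [Finset.mem_sigma, mem_words_iff, Finset.mem_range, List.length_append]
    refine ⟨?_, by omega⟩
    rw [← Multiset.coe_add, map_add, h.2.1, h.2.2, h.1]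
  · rintro ⟨v, k⟩ h
    simp only [Finset.mem_sigma, mem_words_iff, Finset.mem_range] at h
    simp only [List.take_append_drop, List.length_take]
    rw [min_eq_left (by omega)]
  · rintro ⟨⟨p, q⟩, ⟨u, w⟩⟩ h
    simp only [Finset.mem_sigma, Finset.HasAntidiagonal.mem_antidiagonal, Finset.mem_product,
      mem_words_iff] at h
    simp [h.2.1, h.2.2]
  · rintro ⟨v, k⟩ _
    rfl

end

end RobinsonSchensted

/-! ### The Pieri rule and Schur functions -/

namespace RobinsonSchensted

theorem addShape_getD : ∀ {i : ℕ} {s : List ℕ} (j : ℕ), i ≤ s.length →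
    (addShape i s).getD j 0 = s.getD j 0 + if i = j then 1 else 0
  | i, [], j, h => by
    obtain rfl : i = 0 := by simpa using h
    cases j <;> simp [addShape]
  | 0, a :: s, j, _ => by cases j <;> simp [addShape]
  | i + 1, a :: s, 0, _ => by simp [addShape]
  | i + 1, a :: s, j + 1, h => by
    have := addShape_getD (i := i) (s := s) j (by simpa using h)
    simpa [addShape] using this

/-- The length of a row is the number of boxes that have been added to it. -/
theorem getD_shape_ins (w : List ℕ) (j : ℕ) :
    ((ins w).map List.length).getD j 0 = (rows w).count j := by
  induction w using List.reverseRecOn with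
  | nil => simp
  | append_singleton w x ih =>
    rw [ins_snoc, map_length_insert, addShape_getD _ (by simpa using insert_row_le x (ins w)), ih,
      rows_snoc, List.count_append, List.count_singleton]
    simp

theorem eq_of_getD {s s' : List ℕ} (h0 : 0 ∉ s) (h0' : 0 ∉ s')
    (h : ∀ i, s.getD i 0 = s'.getD i 0) : s = s' := by
  have hl : ∀ {s s' : List ℕ}, 0 ∉ s → (∀ i, s.getD i 0 = s'.getD i 0) → s.length ≤ s'.length := by
    intro s s' h0 h
    by_contra hlt
    have h1 := h s'.length
    rw [List.getD_eq_default _ _ le_rfl, List.getD_eq_getElem _ _ (not_le.1 hlt)] at h1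
    exact h0 (h1 ▸ List.getElem_mem _)
  have he := le_antisymm (hl h0 h) (hl h0' fun i => (h i).symm)
  refine List.ext_getElem he fun i h1 h2 => ?_
  rw [← List.getD_eq_getElem _ 0 h1, h, List.getD_eq_getElem _ 0 h2]

theorem length_ins_le {w : List ℕ} {r : ℕ} (h : ∀ i ∈ rows w, i < r) : (ins w).length ≤ r := by
  by_contra hr
  have h1 := getD_shape_ins w r
  rw [List.getD_eq_getElem _ _ (by simpa using hr),
    List.count_eq_zero.2 fun h2 => (h r h2).ne rfl] at h1
  exact (isTab_ins w).zero_notMem (h1 ▸ List.getElem_mem _)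

theorem lt_of_mem_rows {w : List ℕ} : ∀ {i : ℕ}, i ∈ rows w → i < w.length := by
  induction w using List.reverseRecOn with
  | nil => simp
  | append_singleton w x ih =>
    intro i h
    rw [rows_snoc, List.mem_append, List.mem_singleton] at h
    rw [List.length_append, List.length_singleton]
    rcases h with h | h
    · have := ih h; omega
    · have h1 : (ins w).length ≤ w.length := length_ins_le fun i hi => ih hi
      have := insert_row_le x (ins w)
      omega

/-- The row bumping lemma: weakly increasing words correspond to weakly decreasing sequences of
row indices. -/
theorem rowsFrom_pairwise_iff {z : List ℕ} {t : List (List ℕ)} (ht : IsTab t) :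
    (rowsFrom t z).Pairwise (· ≥ ·) ↔ z.Pairwise (· ≤ ·) := by
  rw [← List.isChain_iff_pairwise, ← List.isChain_iff_pairwise]
  induction z generalizing t with
  | nil => simp [rowsFrom]
  | cons x z ih =>
    cases z with
    | nil => simp [rowsFrom]
    | cons y z =>
      have := ih (t := (insert x t).1) (isTab_insert ht)
      simp only [rowsFrom, List.isChain_cons_cons] at this ⊢
      rw [this, ge_iff_le, insert_insert_row_le_iff ht]

/-- The boxes of a row with index `r` that is the last one can be removed by reverse insertion,
from the right to the left: up to Knuth equivalence, `w` ends with letters that have created exactly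
these boxes. -/
theorem exists_peel {r : ℕ} : ∀ (n : ℕ) (w : List ℕ), (∀ i ∈ rows w, i ≤ r) → (rows w).count r = n →
    ∃ w' z, ins (w' ++ z) = ins w ∧ rows (w' ++ z) = rows w' ++ List.replicate n r ∧
      ∀ i ∈ rows w', i < r
  | 0, w, h, h0 => ⟨w, [], by simp, by simp, fun i hi => lt_of_le_of_ne (h i hi) fun e =>
      List.count_eq_zero.1 h0 (e ▸ hi)⟩
  | n + 1, w, h, hn => by
    have hl : (ins w).length = r + 1 := by
      refine le_antisymm (length_ins_le fun i hi => Nat.lt_succ_of_le (h i hi)) ?_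
      by_contra hlt
      have h1 := getD_shape_ins w r
      rw [List.getD_eq_default _ _ (by simp; omega)] at h1
      omega
    have hc := corner_last (s := (ins w).map List.length)
      (by intro h; rw [List.map_eq_nil_iff] at h; simp [h] at hl) (isTab_ins w).zero_notMem
    rw [List.length_map, hl, Nat.add_sub_cancel] at hc
    obtain ⟨x, t, ht, hx⟩ := exists_insert_eq (isTab_ins w) hc
    obtain ⟨u, rfl⟩ := exists_ins_eq ht
    have hcount : ∀ i, (rows u).count i + (if r = i then 1 else 0) = (rows w).count i := fun i => by
      have h1 : ins (u ++ [x]) = ins w := by rw [ins_snoc, hx]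
      rw [← getD_shape_ins w, ← h1, getD_shape_ins, rows_snoc, hx, List.count_append,
        List.count_singleton]
      simp
    obtain ⟨w', z, h1, h2, h3⟩ := exists_peel n u (fun i hi => h i (List.count_pos_iff.1 (by
      have := hcount i
      have := List.count_pos_iff.2 hi
      omega))) (by have := hcount r; rw [if_pos rfl] at this; omega)
    refine ⟨w', z ++ [x], ?_, ?_, h3⟩
    · rw [← List.append_assoc, ins_snoc, h1, hx]
    · rw [← List.append_assoc, rows_snoc, h1, hx, h2, List.append_assoc, List.replicate_succ']

noncomputable section

open MvPowerSeries

variable (K : Type*) [CommRing K]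

/-- The generating series of the words with a given sequence of row indices. -/
def series (r : List ℕ) : MvPowerSeries ℕ K := fun e =>
  (((words e).filter fun v => rows v = r).card : K)

theorem coeff_series (r : List ℕ) (e : ℕ →₀ ℕ) :
    coeff e (series K r) = ∑ v ∈ words e, if rows v = r then 1 else 0 :=
  Finset.natCast_card_filter _ _

/-- The coefficients of the series count tableaux, hence depend only on the shape. -/
theorem coeff_series_rows (w : List ℕ) (e : ℕ →₀ ℕ) : coeff e (series K (rows w)) =
    (tabCount ((ins w).map List.length) (Finsupp.toMultiset e) : K) := by
  rw [← card_rows_eq]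
  change ((Finset.card _ : ℕ) : K) = _
  rw [← Nat.card_eq_finsetCard]
  exact congrArg Nat.cast (Nat.card_congr (Equiv.subtypeEquivRight fun v => by
    rw [Finset.mem_filter, mem_words, and_comm]))

/-- The weakly decreasing sequences of length `n` of numbers less than `N`. -/
def decreasing (n N : ℕ) : Finset (List ℕ) :=
  (Finset.univ.image fun f : Fin n → Fin N => List.ofFn fun i => (f i : ℕ)).filter
    (List.Pairwise (· ≥ ·))

theorem mem_decreasing {n N : ℕ} {j : List ℕ} :
    j ∈ decreasing n N ↔ j.length = n ∧ (∀ i ∈ j, i < N) ∧ j.Pairwise (· ≥ ·) := by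
  rw [decreasing, Finset.mem_filter, Finset.mem_image, ← and_assoc]
  refine and_congr_left fun _ => ⟨?_, ?_⟩
  · rintro ⟨f, -, rfl⟩
    simp [List.mem_ofFn]
  · rintro ⟨rfl, h⟩
    exact ⟨fun i => ⟨j[i], h _ (List.getElem_mem _)⟩, Finset.mem_univ _, by simp⟩

/-- A complete symmetric function is the generating series of the weakly increasing words. -/
theorem coeff_h (n : ℕ) (e : ℕ →₀ ℕ) : coeff e (SymFun.val K (SymFun.h K n)) =
    ∑ z ∈ words e, if z.length = n ∧ z.Pairwise (· ≤ ·) then 1 else 0 := by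
  rw [SymFun.h, SymFun.coeff_ofTyp, SymFun.sum_typ]
  have hs : (Finsupp.toMultiset e).sort (· ≤ ·) ∈ words e := mem_words.2 (Multiset.sort_eq _ _)
  have hl : ∀ z ∈ words e, z.length = e.degree := fun z hz => by
    rw [← Multiset.coe_card, mem_words.1 hz, Finsupp.card_toMultiset]; rfl
  rw [Finset.sum_eq_single_of_mem _ hs]
  · rw [hl _ hs]
    refine if_congr ?_ rfl rfl
    rw [and_iff_left]
    exact Multiset.pairwise_sort _ _
  · intro z hz hne
    refine if_neg fun h => hne ?_
    refine List.Perm.eq_of_pairwise' h.2 (Multiset.pairwise_sort _ _) ?_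
    rw [← Multiset.coe_eq_coe, mem_words.1 hz, Multiset.sort_eq]

/-- The Pieri rule. The product counts the words that consist of a word with the row indices of `w`
and of a weakly increasing word of length `n`; by the row bumping lemma, the latter is characterised
by the property that its row indices decrease weakly. The bound on the row indices only makes the
sum finite. -/
theorem series_mul_h (w : List ℕ) (n : ℕ) : series K (rows w) * SymFun.val K (SymFun.h K n) =
    ∑ j ∈ decreasing n (w.length + n), series K (rows w ++ j) := by
  classical
  ext e
  rw [coeff_mul, map_sum]
  simp only [coeff_series, coeff_h]
  rw [← sum_words_conv e (fun v => if rows v = rows w then (1 : K) else 0)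
    (fun z => if z.length = n ∧ z.Pairwise (· ≤ ·) then 1 else 0), Finset.sum_comm]
  refine Finset.sum_congr rfl fun v _ => ?_
  simp only [← ite_and, mul_ite, mul_one, mul_zero]
  by_cases h : ∃ j ∈ decreasing n (w.length + n), rows v = rows w ++ j
  · obtain ⟨j, hj, h⟩ := h
    have hj' := mem_decreasing.1 hj
    have hv : v.length = w.length + n := by
      simpa [hj'.1] using congrArg List.length h
    have h1 : rows (v.take w.length) = rows w := by
      rw [rows_take, h, List.take_left' (length_rows w)]
    have h2 : rowsFrom (ins (v.take w.length)) (v.drop w.length) = j := by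
      have h3 := rows_append (v.take w.length) (v.drop w.length)
      rw [List.take_append_drop, h, h1] at h3
      exact (List.append_cancel_left h3).symm
    rw [Finset.sum_eq_single w.length, Finset.sum_eq_single j, if_pos h, if_pos]
    · refine ⟨⟨by simp [hv], ?_⟩, h1⟩
      rw [← rowsFrom_pairwise_iff (isTab_ins _), h2]
      exact hj'.2.2
    · intro j' _ hne
      refine if_neg fun h' => hne ?_
      rw [h] at h'
      exact (List.append_cancel_left h').symm
    · exact fun h' => absurd hj h'
    · intro k hk hne
      refine if_neg fun h' => hne ?_
      have := congrArg List.length h'.2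
      simp at this hk
      omega
    · intro h'
      simp [hv] at h'
  · rw [Finset.sum_eq_zero, Finset.sum_eq_zero]
    · exact fun j hj => if_neg fun h' => h ⟨j, hj, h'⟩
    · intro k hk
      refine if_neg fun h' => h ⟨rowsFrom (ins (v.take k)) (v.drop k), ?_, ?_⟩
      · rw [mem_decreasing]
        refine ⟨by rw [length_rowsFrom, h'.1.1], fun i hi => ?_,
          (rowsFrom_pairwise_iff (isTab_ins _)).2 h'.1.2⟩
        have h3 := rows_append (v.take k) (v.drop k)
        rw [List.take_append_drop] at h3
        have h4 : i < v.length := lt_of_mem_rows (h3 ▸ List.mem_append_right _ hi)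
        have h5 := congrArg List.length h'.2
        have h6 := h'.1.1
        simp at h5 h6
        omega
      · rw [← h'.2, ← rows_append, List.take_append_drop]

/-- The generating series of the words with a given sequence of row indices is a polynomial in the
complete symmetric functions: if the word without the last row of its tableau is multiplied by the
complete symmetric function of the length of this row, then one term of the Pieri rule is the series
in question, and the tableaux of the others have no more rows, and a shorter one in place of the
last row. -/
theorem series_mem (w : List ℕ) : series K (rows w) ∈
    (Algebra.adjoin K (Set.range (SymFun.h K))).map (SymFun.val K) := by
  classical
  set S := (Algebra.adjoin K (Set.range (SymFun.h K))).map (SymFun.val K)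
  have hh : ∀ n, SymFun.val K (SymFun.h K n) ∈ S := fun n =>
    ⟨_, Algebra.subset_adjoin ⟨n, rfl⟩, rfl⟩
  -- induction on the number of rows of the tableau
  have key : ∀ r w, (∀ i ∈ rows w, i < r) → series K (rows w) ∈ S := by
    intro r
    induction r with
    | zero =>
      intro w h
      have hw : w = [] := by
        rw [← List.length_eq_zero_iff, ← length_rows, List.length_eq_zero_iff,
          List.eq_nil_iff_forall_not_mem]
        exact fun i hi => absurd (h i hi) (Nat.not_lt_zero i)
      have h1 : series K (rows w) = SymFun.val K (SymFun.h K 0) := by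
        ext e
        rw [coeff_series, coeff_h]
        refine Finset.sum_congr rfl fun v _ => if_congr ?_ rfl rfl
        rw [hw, rows_nil, ← List.length_eq_zero_iff, length_rows, iff_self_and]
        intro h
        rw [List.length_eq_zero_iff.1 h]
        exact List.Pairwise.nil
      rw [h1]
      exact hh 0
    | succ r ih =>
      -- induction on the length of the last row
      have key2 : ∀ n w, (∀ i ∈ rows w, i ≤ r) → (rows w).count r ≤ n → series K (rows w) ∈ S := by
        intro n
        induction n with
        | zero =>
          intro w h h0
          exact ih w fun i hi => lt_of_le_of_ne (h i hi) fun e =>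
            List.count_eq_zero.1 (Nat.le_zero.1 h0) (e ▸ hi)
        | succ n ihn =>
          intro w h hn
          by_cases hn' : (rows w).count r ≤ n
          · exact ihn w h hn'
          obtain ⟨w', z, h1, h2, h3⟩ := exists_peel (n + 1) w h (by omega)
          have hj : List.replicate (n + 1) r ∈ decreasing (n + 1) (w'.length + (n + 1)) := by
            refine mem_decreasing.2 ⟨by simp, fun i hi => ?_, by simp [List.pairwise_replicate]⟩
            have h4 : i ∈ rows (w' ++ z) := h2 ▸ List.mem_append_right _ hi
            have h5 := lt_of_mem_rows h4
            have h6 := congrArg List.length h2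
            simp at h5 h6
            omega
          have h4 : series K (rows w) = series K (rows w' ++ List.replicate (n + 1) r) := by
            ext e
            rw [← h2, coeff_series_rows, coeff_series_rows, h1]
          have h5 := series_mul_h K w' (n + 1)
          rw [← Finset.add_sum_erase _ _ hj, ← h4] at h5
          rw [eq_sub_of_add_eq h5.symm]
          refine sub_mem (mul_mem (ih w' h3) (hh _)) (sum_mem fun j hj' => ?_)
          rw [Finset.mem_erase, mem_decreasing] at hj'
          by_cases hr : ∃ v, rows v = rows w' ++ j
          · obtain ⟨v, hv⟩ := hr
            -- The tableau of `w'` has at most `r` rows, so the first letter of the suffix creates a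
            -- box in a row with index at most `r`, and the row indices decrease from then on.
            have hjr : ∀ i ∈ j, i ≤ r := by
              cases j with
              | nil => simp
              | cons a j =>
                have h6 : a ≤ r := by
                  have h7 := rows_append (v.take w'.length) (v.drop w'.length)
                  have h8 : rows (v.take w'.length) = rows w' := by
                    rw [rows_take, hv, List.take_left' (length_rows w')]
                  rw [List.take_append_drop, hv, h8] at h7
                  have h9 := List.append_cancel_left h7
                  have h10 : (ins (v.take w'.length)).length ≤ r :=
                    length_ins_le (h8 ▸ h3)
                  generalize v.drop w'.length = u at h9
                  cases u with
                  | nil => simp [rowsFrom] at h9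
                  | cons x u =>
                    simp only [rowsFrom, List.cons.injEq] at h9
                    have := insert_row_le x (ins (v.take w'.length))
                    omega
                intro i hi
                rcases List.mem_cons.1 hi with rfl | hi
                · exact h6
                · exact ((List.pairwise_cons.1 hj'.2.2.2).1 i hi).trans h6
            rw [← hv]
            refine ihn v (fun i hi => ?_) ?_
            · rw [hv, List.mem_append] at hi
              exact hi.elim (fun hi => (h3 i hi).le) (hjr i)
            · rw [hv, List.count_append, List.count_eq_zero.2 fun hi => (h3 r hi).ne rfl, zero_add]
              have h6 : j.count r ≤ j.length := List.count_le_length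
              rw [hj'.2.1] at h6
              by_contra h7
              have h8 : j.count r = j.length := by rw [hj'.2.1]; omega
              refine hj'.1 ?_
              rw [← hj'.2.1]
              exact List.eq_replicate_of_mem fun i hi => (List.count_eq_length.1 h8 i hi).symm
          -- a sequence that is not the sequence of rows of a word has the series `0`
          · have h6 : series K (rows w' ++ j) = 0 := by
              ext e
              rw [coeff_series, map_zero]
              exact Finset.sum_eq_zero fun v _ => if_neg fun hv => hr ⟨v, hv⟩
            rw [h6]
            exact zero_mem _
      exact fun w h => key2 _ w (fun i hi => Nat.le_of_lt_succ (h i hi)) le_rfl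
  exact key w.length w fun i hi => lt_of_mem_rows hi

end

end RobinsonSchensted

namespace SymFun

noncomputable section

open MvPowerSeries RobinsonSchensted

variable (K : Type*) [CommRing K]

theorem typ_eq_of_count {e : ℕ →₀ ℕ} {s : Multiset ℕ} (h0 : 0 ∉ s)
    (h : ∀ i, e i = (s.sort (· ≥ ·)).getD i 0) : typ e = s := by
  have hs : e.support = Finset.range (s.sort (· ≥ ·)).length := by
    ext i
    rw [Finsupp.mem_support_iff, h, Finset.mem_range]
    constructor
    · intro hi
      by_contra hi'
      exact hi (List.getD_eq_default _ _ (not_lt.1 hi'))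
    · intro hi
      rw [List.getD_eq_getElem _ _ hi]
      intro h1
      exact h0 ((Multiset.mem_sort _).1 (h1 ▸ List.getElem_mem hi))
  conv_rhs => rw [← Multiset.sort_eq s (· ≥ ·)]
  rw [typ, hs, Finset.range_val, Multiset.range, Multiset.map_coe, Multiset.coe_eq_coe]
  refine List.Perm.of_eq (List.ext_getElem (by simp) fun i h1 h2 => ?_)
  rw [List.getElem_map, List.getElem_range, h, List.getD_eq_getElem]

theorem exists_mem_adjoin_h (l : YoungDiagram) : ∃ f ∈ Algebra.adjoin K (Set.range (h K)),
    ∀ e, coeff e (val K f) = (tabCount l.rowLens (Finsupp.toMultiset e) : K) := by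
  obtain ⟨w, hw⟩ := exists_shape_ins l
  obtain ⟨f, hf, hf'⟩ := series_mem K w
  exact ⟨f, hf, fun e => by
    rw [← hw, ← coeff_series_rows, ← hf']; rfl⟩

/-- The generating series of tableaux of the shape `l` is a polynomial in the complete symmetric
functions, hence symmetric. As its coefficients at partitions are the Kostka numbers, it is the
Schur function. -/
theorem schur_mem_adjoin_and (l : YoungDiagram) : schur K l ∈ Algebra.adjoin K (Set.range (h K)) ∧
    ∀ e, coeff e (val K (schur K l)) = (tabCount l.rowLens (Finsupp.toMultiset e) : K) := by
  obtain ⟨f, hf, hf'⟩ := exists_mem_adjoin_h K l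
  suffices hs : schur K l = f by rw [hs]; exact ⟨hf, hf'⟩
  refine ext1 fun s => ?_
  have h0 : 0 ∉ s.1.sort (· ≥ ·) := by rw [Multiset.mem_sort]; exact s.2
  let e : ℕ →₀ ℕ := Finsupp.onFinset (Finset.range (s.1.sort (· ≥ ·)).length)
    (fun i => (s.1.sort (· ≥ ·)).getD i 0) fun i hi => by
      rw [Finset.mem_range]
      by_contra hi'
      exact hi (List.getD_eq_default _ _ (not_lt.1 hi'))
  have he : typ e = s.1 := typ_eq_of_count s.2 fun i => rfl
  rw [cf_apply, cf_apply, coeff_eq f ((typ_rep s).trans he.symm), hf', schur, coeff_ofTyp, typ_rep,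
    kostka_eq_tabCount l (M := Finsupp.toMultiset e)]
  intro i
  rw [Finsupp.count_toMultiset]
  rfl

theorem schur_mem_adjoin (l : YoungDiagram) : schur K l ∈ Algebra.adjoin K (Set.range (h K)) :=
  (schur_mem_adjoin_and K l).1

/-- All the coefficients of a Schur function count tableaux: the numbers of tableaux with given
contents are symmetric in the contents. -/
theorem coeff_schur (l : YoungDiagram) (e : ℕ →₀ ℕ) : coeff e (val K (schur K l)) =
    (tabCount l.rowLens (Finsupp.toMultiset e) : K) := (schur_mem_adjoin_and K l).2 e

end

end SymFun

/-! ### The basis of Schur functions -/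

namespace SymFun

open RobinsonSchensted

/-- The parts of the partition that is represented by a Young diagram. -/
def parts (l : YoungDiagram) : {s : Multiset ℕ // 0 ∉ s} :=
  ⟨l.rowLens, fun h => (l.pos_of_mem_rowLens 0 h).ne rfl⟩

theorem sort_parts (l : YoungDiagram) : (parts l).1.sort (· ≥ ·) = l.rowLens := by
  refine List.Perm.eq_of_pairwise' (Multiset.pairwise_sort _ _) l.rowLens_sorted.pairwise ?_
  rw [← Multiset.coe_eq_coe, Multiset.sort_eq]
  rfl

theorem rowLens_injective : Function.Injective YoungDiagram.rowLens := fun l m h => by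
  rw [← YoungDiagram.ofRowLens_to_rowLens_eq_self (μ := l),
    ← YoungDiagram.ofRowLens_to_rowLens_eq_self (μ := m)]
  congr 1

theorem parts_surjective : Function.Surjective parts := fun s => by
  have hs : ∀ x ∈ s.1.sort (· ≥ ·), 0 < x := fun x hx =>
    Nat.pos_of_ne_zero fun h => s.2 ((Multiset.mem_sort _).1 (h ▸ hx))
  refine ⟨YoungDiagram.ofRowLens (s.1.sort (· ≥ ·))
    (List.Pairwise.sortedGE (Multiset.pairwise_sort _ _)), Subtype.ext ?_⟩
  change ((YoungDiagram.rowLens _ : List ℕ) : Multiset ℕ) = _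
  rw [YoungDiagram.rowLens_ofRowLens_eq_self hs, Multiset.sort_eq]

/-- The statistic `n(λ) = ∑ i λ_i`, the rows being numbered from `0`; it is strictly decreasing for
the dominance order. -/
def nrow (l : YoungDiagram) : ℕ := ∑ c ∈ l.cells, c.1

theorem nrow_le (l : YoungDiagram) : nrow l ≤ l.card * l.card := by
  refine (Finset.sum_le_card_nsmul _ _ l.card fun c hc => ?_).trans (by simp [smul_eq_mul])
  have h1 : (c.1, 0) ∈ l := l.up_left_mem le_rfl (Nat.zero_le _) hc
  rw [YoungDiagram.mem_iff_lt_colLen] at h1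
  refine h1.le.trans ?_
  rw [YoungDiagram.colLen_eq_card]
  exact Finset.card_le_card (Finset.filter_subset _ _)

theorem card_filter_fst (m : YoungDiagram) (i : ℕ) :
    (m.cells.filter fun c => c.1 = i).card = m.rowLen i := by
  rw [YoungDiagram.rowLen_eq_card]; rfl

/-- If there is a tableau of shape `l` and content `m`, then `n(l) ≤ n(m)`, because entries in row
`i` are at least `i`. In the case of equality, `l = m` and all the entries in row `i` are `i`. -/
theorem nrow_of_content {l m : YoungDiagram} {T : SemistandardYoungTableau l}
    (hT : ∀ i, (l.cells.filter fun c => T c.1 c.2 = i).card = m.rowLen i) :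
    l.card = m.card ∧ (nrow l < nrow m ∨ l = m ∧ ∀ c ∈ l.cells, T c.1 c.2 = c.1) := by
  have hm : l.cells.val.map (fun c => T c.1 c.2) = m.cells.val.map Prod.fst := by
    ext i
    rw [Multiset.count_map, Multiset.count_map]
    have h := (hT i).trans (card_filter_fst m i).symm
    rw [Finset.card, Finset.card, Finset.filter_val, Finset.filter_val] at h
    simpa only [eq_comm] using h
  have hsum : ∑ c ∈ l.cells, T c.1 c.2 = nrow m := congrArg Multiset.sum hm
  have hge : ∀ i j, (i, j) ∈ l → i ≤ T i j := by
    intro i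
    induction i with
    | zero => exact fun _ _ => Nat.zero_le _
    | succ i ih =>
      intro j hj
      have h1 := ih j (l.up_left_mem (Nat.le_succ i) le_rfl hj)
      have h2 := T.col_strict (Nat.lt_add_one i) hj
      omega
  refine ⟨by simpa using congrArg Multiset.card hm, ?_⟩
  have hle : nrow l ≤ nrow m := hsum ▸ Finset.sum_le_sum fun c hc => hge c.1 c.2 hc
  refine hle.lt_or_eq.imp_right fun he => ?_
  have h1 : ∀ c ∈ l.cells, T c.1 c.2 = c.1 := fun c hc =>
    ((Finset.sum_eq_sum_iff_of_le fun c hc => hge c.1 c.2 hc).1 (he.trans hsum.symm) c hc).symm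
  refine ⟨?_, h1⟩
  refine rowLens_injective (eq_of_getD (fun h => (l.pos_of_mem_rowLens 0 h).ne rfl)
    (fun h => (m.pos_of_mem_rowLens 0 h).ne rfl) fun i => ?_)
  rw [getD_rowLens, getD_rowLens, ← hT i, ← card_filter_fst]
  congr 1
  exact Finset.filter_congr fun c hc => by rw [h1 c hc]

theorem getD_parts (m : YoungDiagram) (i : ℕ) :
    ((parts m).1.sort (· ≥ ·)).getD i 0 = m.rowLen i := by rw [sort_parts, getD_rowLens]

theorem kostka_self (l : YoungDiagram) : kostka l (parts l).1 = 1 := by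
  rw [kostka, Nat.card_eq_one_iff_unique]
  refine ⟨⟨fun T T' => Subtype.ext (SemistandardYoungTableau.ext fun i j => ?_)⟩,
    ⟨⟨SemistandardYoungTableau.highestWeight l, fun i => ?_⟩⟩⟩
  · by_cases hc : (i, j) ∈ l
    · have h1 := ((nrow_of_content fun i => (T.2 i).trans (getD_parts l i)).2.resolve_left
        (lt_irrefl _)).2 (i, j) hc
      have h2 := ((nrow_of_content fun i => (T'.2 i).trans (getD_parts l i)).2.resolve_left
        (lt_irrefl _)).2 (i, j) hc
      exact h1.trans h2.symm
    · rw [T.1.zeros hc, T'.1.zeros hc]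
  · rw [getD_parts, ← card_filter_fst]
    congr 1
    refine Finset.filter_congr fun c hc => ?_
    rw [SemistandardYoungTableau.highestWeight_apply, if_pos ((YoungDiagram.mem_cells c).1 hc)]

/-- The Kostka matrix is triangular for the order that is given by the statistic `nrow`. -/
theorem kostka_triangular {l m : YoungDiagram} (h : kostka l (parts m).1 ≠ 0) :
    l.card = m.card ∧ (nrow l < nrow m ∨ l = m) := by
  obtain ⟨T, hT⟩ := (Nat.card_ne_zero.1 h).1
  obtain ⟨h1, h2⟩ := nrow_of_content fun i => (hT i).trans (getD_parts m i)
  exact ⟨h1, h2.imp_right And.left⟩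

noncomputable section

open MvPowerSeries

variable (K : Type*) [CommRing K]

theorem cf_schur (l : YoungDiagram) (s) : cf K s (schur K l) = (kostka l s.1 : K) := by
  rw [cf_apply, schur, coeff_ofTyp, typ_rep]

/-- In a linear relation, a coefficient of a partition with minimal `nrow` is isolated by the
coefficient of the corresponding monomial symmetric function. -/
theorem linearIndependent_schur : LinearIndependent K (schur K) := by
  rw [linearIndependent_iff]
  intro c hc
  by_contra hne
  obtain ⟨m, hm, hmin⟩ := Finset.exists_min_image c.support nrow
    (Finsupp.support_nonempty_iff.2 hne)
  have h := congrArg (cf K (parts m)) hc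
  rw [Finsupp.linearCombination_apply, Finsupp.sum, map_sum, map_zero,
    Finset.sum_eq_single_of_mem m hm] at h
  · rw [map_smul, cf_schur, kostka_self, Nat.cast_one, smul_eq_mul, mul_one] at h
    exact Finsupp.mem_support_iff.1 hm h
  · intro l hl hlm
    rw [map_smul, cf_schur]
    by_cases hk : kostka l (parts m).1 = 0
    · rw [hk, Nat.cast_zero, smul_zero]
    · exact absurd (hmin l hl) (not_le.2 ((kostka_triangular hk).2.resolve_right hlm))

/-- By induction from large to small values of `nrow`, for which `nrow_le` is an upper bound: a
Schur function is the monomial symmetric function of the same partition plus a combination of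
monomial symmetric functions with larger `nrow`. -/
theorem mono_mem_span_schur : ∀ (N : ℕ) (m : YoungDiagram), m.card * m.card - nrow m ≤ N →
    mono K (parts m) ∈ Submodule.span K (Set.range (schur K)) := by
  classical
  intro N
  induction N using Nat.strong_induction_on with
  | _ N ih =>
    intro m hm
    have h := (mono K).linearCombination_repr (schur K m)
    rw [Finsupp.linearCombination_apply, Finsupp.sum] at h
    -- Over the zero ring the support is empty, but all the modules are zero.
    have hmem : parts m ∈ ((mono K).repr (schur K m)).support ∨ Subsingleton K := by
      by_cases hK : Subsingleton K
      · exact Or.inr hK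
      · left
        have := not_subsingleton_iff_nontrivial.1 hK
        rw [Finsupp.mem_support_iff, mono_repr, cf_schur, kostka_self, Nat.cast_one]
        exact one_ne_zero
    rcases hmem with hmem | hK
    · rw [← Finset.add_sum_erase _ _ hmem, mono_repr, cf_schur, kostka_self, Nat.cast_one,
        one_smul] at h
      rw [eq_sub_of_add_eq h]
      refine sub_mem (Submodule.subset_span ⟨m, rfl⟩) (sum_mem fun s hs => ?_)
      refine Submodule.smul_mem _ _ ?_
      obtain ⟨m', rfl⟩ := parts_surjective s
      rw [Finset.mem_erase, Finsupp.mem_support_iff, mono_repr, cf_schur] at hs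
      obtain ⟨h1, h2⟩ := kostka_triangular (l := m) (m := m') fun h0 =>
        hs.2 (by rw [h0, Nat.cast_zero])
      have h3 := h2.resolve_right fun e => hs.1 (by rw [e])
      have h4 := nrow_le m'
      refine ih (m'.card * m'.card - nrow m') ?_ m' le_rfl
      rw [← h1] at h4 ⊢
      omega
    · have := Module.subsingleton K (SymFun K)
      rw [Subsingleton.elim (mono K (parts m)) 0]
      exact zero_mem _

/-- The basis of Schur functions. -/
def schurBasis : Module.Basis YoungDiagram K (SymFun K) :=
  Module.Basis.mk (linearIndependent_schur K) (by
    rw [← (mono K).span_eq, Submodule.span_le]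
    rintro _ ⟨s, rfl⟩
    obtain ⟨m, rfl⟩ := parts_surjective s
    exact mono_mem_span_schur K _ m le_rfl)

@[simp] theorem schurBasis_apply (l : YoungDiagram) : schurBasis K l = schur K l :=
  Module.Basis.mk_apply _ _ _

/-- The complete symmetric functions generate the algebra of symmetric functions. -/
theorem adjoin_h : Algebra.adjoin K (Set.range (h K)) = ⊤ := by
  rw [← Algebra.toSubmodule_eq_top, eq_top_iff, ← (schurBasis K).span_eq, Submodule.span_le]
  rintro _ ⟨l, rfl⟩
  rw [schurBasis_apply]
  exact schur_mem_adjoin K l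

theorem h_zero : h K 0 = 1 := by
  refine val_injective (MvPowerSeries.ext fun e => ?_)
  classical
  rw [h, coeff_ofTyp, map_one, coeff_one, sum_typ]
  exact if_congr (Finsupp.degree_eq_zero_iff e) rfl rfl

/-- The words with an insertion tableau of one row are the weakly increasing ones. -/
theorem _root_.RobinsonSchensted.rows_eq_replicate_iff {v : List ℕ} {n : ℕ} :
    rows v = List.replicate n 0 ↔ v.length = n ∧ v.Pairwise (· ≤ ·) := by
  rw [← rowsFrom_pairwise_iff (t := []) trivial]
  constructor
  · intro h
    have h' : rowsFrom [] v = List.replicate n 0 := h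
    rw [h']
    exact ⟨by simpa using congrArg List.length h, by simp [List.pairwise_replicate]⟩
  · rintro ⟨rfl, h⟩
    cases v with
    | nil => rfl
    | cons x v =>
      rw [← length_rows]
      simp only [rowsFrom, insert_nil, List.pairwise_cons] at h
      refine List.eq_replicate_of_mem fun i hi => ?_
      change i ∈ rowsFrom [] (x :: v) at hi
      simp only [rowsFrom, insert_nil, List.mem_cons] at hi
      exact hi.elim id fun hi => Nat.le_zero.1 (h.1 i hi)

/-- The Schur function of a partition with at most one part is complete. -/
theorem schur_of_rowLen {l : YoungDiagram} {n : ℕ} (hl : ∀ i, l.rowLen i = if i = 0 then n else 0) :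
    schur K l = h K n := by
  refine val_injective (MvPowerSeries.ext fun e => ?_)
  have hr : rows (List.range n) = List.replicate n 0 :=
    rows_eq_replicate_iff.2 ⟨List.length_range, List.pairwise_le_range⟩
  have hw : (ins (List.range n)).map List.length = l.rowLens :=
    eq_of_getD (isTab_ins _).zero_notMem (fun h => (l.pos_of_mem_rowLens 0 h).ne rfl) fun i => by
      rw [getD_shape_ins, getD_rowLens, hl, hr, List.count_replicate]
      cases i <;> simp
  rw [coeff_schur, coeff_h, ← hw, ← coeff_series_rows, coeff_series, hr]
  exact Finset.sum_congr rfl fun v _ => if_congr rows_eq_replicate_iff rfl rfl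

theorem schur_mem_deg (l : YoungDiagram) : schur K l ∈ deg K l.card := by
  intro e he
  rw [coeff_schur, tabCount]
  have : IsEmpty {t : List (List ℕ) // IsTab t ∧ t.map List.length = l.rowLens ∧
      (t.flatten : Multiset ℕ) = Finsupp.toMultiset e} := by
    refine ⟨fun ⟨t, _, h1, h2⟩ => he ?_⟩
    have h3 := congrArg Multiset.card h2
    rw [Finsupp.card_toMultiset, Multiset.coe_card, List.length_flatten, h1] at h3
    rw [StdTableau.card_eq_length (default : SemistandardYoungTableau l), List.length_flatten,
      map_length_rowList, h3]
    rfl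
  rw [Nat.card_of_isEmpty, Nat.cast_zero]

end

end SymFun

/-! ### Coefficients of coloured symmetric functions -/

namespace ColSym

open MvPowerSeries RobinsonSchensted

noncomputable section

variable {K B : Type*} [CommRing K]

/-- The exponents of the variables of colour `b`. -/
def part (e : ℕ × B →₀ ℕ) (b : B) : ℕ →₀ ℕ :=
  e.comapDomain (fun i => (i, b)) fun _ _ _ _ h => congrArg Prod.fst h

@[simp] theorem part_apply (e : ℕ × B →₀ ℕ) (b : B) (i : ℕ) : part e b i = e (i, b) := rfl

theorem ext_part {e e' : ℕ × B →₀ ℕ} (h : ∀ b, part e b = part e' b) : e = e' := by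
  ext ⟨i, b⟩
  exact DFunLike.congr_fun (h b) i

theorem part_add (e e' : ℕ × B →₀ ℕ) (b : B) : part (e + e') b = part e b + part e' b := by
  ext i; simp

theorem msub_toMultiset [DecidableEq B] (e : ℕ × B →₀ ℕ) (b : B) :
    msub b (Finsupp.toMultiset e) = Finsupp.toMultiset (part e b) := by
  obtain ⟨v, hv⟩ := Quotient.exists_rep (Finsupp.toMultiset e)
  have hv : (v : Multiset (ℕ × B)) = Finsupp.toMultiset e := hv
  ext i
  have h := congrArg (Multiset.count (i, b)) hv
  rw [Multiset.coe_count, Finsupp.count_toMultiset] at h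
  rw [← hv, msub_coe, Multiset.coe_count, count_sub, Finsupp.count_toMultiset, part_apply]
  convert h

variable (K) in
/-- A pure tensor in `Λ(B)`. -/
def pure (f : B → SymFun K) : ColSym K B := PiTensorProduct.tprod K f

theorem pure_mul (f g : B → SymFun K) : pure K f * pure K g = pure K (f * g) :=
  PiTensorProduct.tprod_mul_tprod f g

theorem induction_pure {p : ColSym K B → Prop} (x : ColSym K B) (hs : ∀ (r : K) f, p (r • pure K f))
    (ha : ∀ x y, p x → p y → p (x + y)) : p x := PiTensorProduct.induction_on x hs ha

variable [Fintype B]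

/-- The monomial in coloured variables that is composed of given monomials. -/
def glue (f : B → ℕ →₀ ℕ) : ℕ × B →₀ ℕ := by
  classical
  exact Finsupp.onFinset ((Finset.univ.biUnion fun b => (f b).support) ×ˢ Finset.univ)
    (fun p => f p.2 p.1) fun p hp => by
      simp only [Finset.mem_product, Finset.mem_biUnion, Finset.mem_univ, true_and, and_true]
      exact ⟨p.2, Finsupp.mem_support_iff.2 hp⟩

@[simp] theorem part_glue (f : B → ℕ →₀ ℕ) (b : B) : part (glue f) b = f b := by
  ext i; rfl

theorem glue_part (e : ℕ × B →₀ ℕ) : glue (part e) = e := ext_part fun b => part_glue _ b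

variable (K) in
/-- The coefficient of a monomial in coloured variables. -/
def coeffB (e : ℕ × B →₀ ℕ) : ColSym K B →ₗ[K] K :=
  PiTensorProduct.lift ((MultilinearMap.mkPiAlgebra K B K).compLinearMap fun b =>
    coeff (part e b) ∘ₗ (SymFun.val K).toLinearMap)

theorem pure_eq_prod [DecidableEq B] (f : B → SymFun K) : pure K f = ∏ b, single K b (f b) := by
  have h := PiTensorProduct.tprod_prod (R := K) Finset.univ fun b => Pi.mulSingle b (f b)
  rw [Finset.univ_prod_mulSingle] at h
  exact h

theorem coeffB_pure (e : ℕ × B →₀ ℕ) (f : B → SymFun K) :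
    coeffB K e (pure K f) = ∏ b, coeff (part e b) (SymFun.val K (f b)) := by
  refine (PiTensorProduct.lift.tprod _).trans ?_
  simp

/-- Coloured symmetric functions are determined by their coefficients. -/
theorem ext_coeffB {x y : ColSym K B} (h : ∀ e, coeffB K e x = coeffB K e y) : x = y := by
  let m : Module.Basis (B → {s : Multiset ℕ // 0 ∉ s}) K (ColSym K B) :=
    Basis.piTensorProduct fun _ => SymFun.mono K
  refine m.ext_elem fun s => ?_
  have key : ∀ z, m.repr z s = coeffB K (glue fun b => SymFun.rep (s b)) z := fun z => by
    induction z using induction_pure with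
    | ha x y hx hy => rw [map_add, Finsupp.add_apply, hx, hy, map_add]
    | hs r f =>
      rw [map_smul, map_smul, Finsupp.smul_apply, coeffB_pure]
      congr 1
      refine (Basis.piTensorProduct_repr_tprod_apply (fun _ : B => SymFun.mono K) f s).trans ?_
      exact Finset.prod_congr rfl fun b _ => by rw [part_glue]; rfl
  rw [key, key, h]

variable [DecidableEq B]

theorem coeffB_mul (e : ℕ × B →₀ ℕ) (x y : ColSym K B) : coeffB K e (x * y) =
    ∑ p ∈ Finset.HasAntidiagonal.antidiagonal e, coeffB K p.1 x * coeffB K p.2 y := by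
  classical
  induction x using induction_pure with
  | ha x x' h h' => simp only [add_mul, map_add, h, h', Finset.sum_add_distrib]
  | hs r f =>
  induction y using induction_pure with
  | ha x x' h h' => simp only [mul_add, map_add, h, h', Finset.sum_add_distrib]
  | hs s g =>
    simp only [smul_mul_assoc, mul_smul_comm, map_smul, pure_mul, coeffB_pure, Pi.mul_apply,
      map_mul, coeff_mul, Finset.prod_univ_sum, ← Finset.smul_sum]
    congr 2
    refine (Finset.sum_bij' (fun p _ b => (part p.1 b, part p.2 b))
      (fun q _ => (glue fun b => (q b).1, glue fun b => (q b).2)) ?_ ?_ ?_ ?_ ?_).symm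
    · intro p hp
      rw [Finset.HasAntidiagonal.mem_antidiagonal] at hp
      rw [Fintype.mem_piFinset]
      intro b
      rw [Finset.HasAntidiagonal.mem_antidiagonal, ← hp, part_add]
    · intro q hq
      rw [Fintype.mem_piFinset] at hq
      rw [Finset.HasAntidiagonal.mem_antidiagonal]
      refine ext_part fun b => ?_
      have := hq b
      rw [Finset.HasAntidiagonal.mem_antidiagonal] at this
      rw [part_add, part_glue, part_glue, this]
    · intro p _
      exact Prod.ext (glue_part _) (glue_part _)
    · intro q _
      funext b
      exact Prod.ext (part_glue _ b) (part_glue _ b)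
    · intro p _
      rw [Finset.prod_mul_distrib]

variable (K B) in
/-- The basis of `Λ(B)` that consists of the products of Schur functions. -/
def schurBasis : Module.Basis (B → YoungDiagram) K (ColSym K B) :=
  Basis.piTensorProduct fun _ => SymFun.schurBasis K

@[simp] theorem schurBasis_apply (l : B → YoungDiagram) : schurBasis K B l = schur K l := by
  rw [schur, ← pure_eq_prod]
  refine (Basis.piTensorProduct_apply _ _).trans ?_
  simp only [SymFun.schurBasis_apply]
  rfl

theorem coeffB_schur (e : ℕ × B →₀ ℕ) (l : B → YoungDiagram) : coeffB K e (schur K l) =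
    ((∏ b, tabCount (l b).rowLens (msub b (Finsupp.toMultiset e)) : ℕ) : K) := by
  rw [schur, ← pure_eq_prod, coeffB_pure, Nat.cast_prod]
  simp only [SymFun.coeff_schur, msub_toMultiset]

theorem schur_mem_deg (l : B → YoungDiagram) : schur K l ∈ deg K B (∑ b, (l b).card) :=
  Submodule.subset_span ⟨fun b => (l b).card, fun b => SymFun.schur K (l b), rfl,
    fun b => SymFun.schur_mem_deg K (l b), rfl⟩

/-- `Λ(B)` is generated by the elements `h_n(b)`. -/
theorem adjoin_single_h : Algebra.adjoin K
    {x : ColSym K B | ∃ n, 1 ≤ n ∧ ∃ b, x = single K b (SymFun.h K n)} = ⊤ := by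
  set S := Algebra.adjoin K {x : ColSym K B | ∃ n, 1 ≤ n ∧ ∃ b, x = single K b (SymFun.h K n)}
  have h1 : ∀ b f, single K b f ∈ S := fun b f => by
    have hf : f ∈ Algebra.adjoin K (Set.range (SymFun.h K)) := by rw [SymFun.adjoin_h]; trivial
    have h2 : Algebra.adjoin K (Set.range (SymFun.h K)) ≤ S.comap (single K b) :=
      Algebra.adjoin_le (by
        rintro _ ⟨n, rfl⟩
        rcases Nat.eq_zero_or_pos n with rfl | hn
        · rw [SymFun.h_zero]; exact one_mem (S.comap (single K b))
        · exact Algebra.subset_adjoin ⟨n, hn, b, rfl⟩)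
    exact h2 hf
  rw [eq_top_iff]
  intro x _
  induction x using induction_pure with
  | ha x y hx hy => exact add_mem (hx trivial) (hy trivial)
  | hs r f =>
    rw [pure_eq_prod]
    exact Subalgebra.smul_mem _ (prod_mem fun b _ => h1 b _) r

end

end ColSym

/-! ### The homomorphism from the coplactic algebra to symmetric functions -/

namespace StdTableau

open RobinsonSchensted ColPerm FQSym

noncomputable section

variable {K B : Type*} [CommRing K] [Fintype B] [DecidableEq B]

open Classical in
variable (K B) in
/-- A linear map on `𝓕(K B)` with `t_T ↦ s_{sh(T)}`; it vanishes on the coloured permutations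
that are not chosen representatives of their coplactic classes. -/
def thetaMap : FQSym K B →ₗ[K] ColSym K B := (basis K B).constr K fun g =>
  if g = rep (recTab g) then ColSym.schur K (recTab g).shape else 0

open Classical in
theorem thetaMap_of {n : ℕ} (α : ColPerm B n) : thetaMap K B (of K α) =
    if ⟨n, α⟩ = rep (recTab ⟨n, α⟩) then ColSym.schur K (recTab ⟨n, α⟩).shape else 0 := by
  rw [thetaMap, of, Module.Basis.constr_basis]

theorem thetaMap_t (T : StdTableau B) : thetaMap K B (t K T) = ColSym.schur K T.shape := by
  classical
  obtain ⟨α₀, hα₀⟩ : ∃ α : ColPerm B T.size, rep T = ⟨T.size, α⟩ := ⟨_, rfl⟩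
  have hT : recTab ⟨T.size, α₀⟩ = T := by rw [← hα₀]; exact recTab_rep T
  rw [t, map_sum]
  simp only [thetaMap_of]
  refine (Finset.sum_eq_single α₀ ?_ ?_).trans ?_
  · intro α hα hne
    have h := isRecord_iff_recTab.1 (Finset.mem_filter.1 hα).2
    rw [h, if_neg]
    intro h'
    rw [hα₀] at h'
    exact hne (eq_of_heq (Sigma.mk.inj h').2)
  · intro h
    refine absurd ?_ h
    rw [Finset.mem_filter]
    exact ⟨Finset.mem_univ _, isRecord_iff_recTab.2 hT⟩
  · rw [hT]
    exact if_pos hα₀.symm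

/-- Coefficients of the image of a coplactic element: the words with given letters are counted
according to their standardisations. -/
theorem coeffB_thetaMap {x : FQSym K B} (hx : x ∈ coplactic K B) (e : ℕ × B →₀ ℕ) :
    ColSym.coeffB K e (thetaMap K B x) = ∑ v ∈ words e, co K B (std v) x := by
  classical
  induction hx using Submodule.span_induction with
  | zero => simp
  | add x y _ _ hx hy => simp only [map_add, hx, hy, Finset.sum_add_distrib]
  | smul c x _ hx => simp only [map_smul, hx, Finset.smul_sum]
  | mem x hx =>
    obtain ⟨T, rfl⟩ := hx
    have h1 : ∀ b, (T.shape b).rowLens = (ins (sub b (rep T).2.line)).map List.length := fun b => by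
      rw [← rowLens_shape, recTab_rep]
    have h2 : ∀ v, recTab (std v) = T ↔ SameRecord v (rep T).2.line := fun v => by
      have h3 : recTab (std v) = T ↔ recTab (std v) = recTab (rep T) := by rw [recTab_rep]
      rw [h3, recTab_eq_iff]
      exact ⟨(stdOf_std v).sameRecord.symm.trans, (stdOf_std v).sameRecord.trans⟩
    rw [thetaMap_t, ColSym.coeffB_schur]
    simp only [h1, co_t, h2]
    rw [← card_sameRecord_eq, ← Finset.natCast_card_filter, ← Nat.card_eq_finsetCard]
    exact congrArg Nat.cast (Nat.card_congr (Equiv.subtypeEquivRight fun v => by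
      rw [Finset.mem_filter, mem_words, and_comm]))

/-- The homomorphism `Θ` is multiplicative: the coefficients of a product in `𝓕(K B)` at the
standardisation of a word are sums over the cuts of the word, and these correspond to products of
coloured monomials. -/
theorem thetaMap_mul {x y : FQSym K B} (hx : x ∈ coplactic K B) (hy : y ∈ coplactic K B) :
    thetaMap K B (x * y) = thetaMap K B x * thetaMap K B y := by
  refine ColSym.ext_coeffB fun e => ?_
  rw [coeffB_thetaMap (mul_mem_coplactic hx hy), ColSym.coeffB_mul]
  simp only [coeffB_thetaMap hx, coeffB_thetaMap hy]
  rw [← sum_words_conv e (fun v => co K B (std v) x) fun v => co K B (std v) y]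
  refine Finset.sum_congr rfl fun v _ => ?_
  rw [co_mul]
  exact Finset.sum_congr rfl fun k _ => by rw [std_take, std_drop]

/-- The coplactic class of `(b, …, b; e)` consists of one element, so that `y_{n,b}` is one of the
elements `t_T`. -/
theorem recTab_eq_one_iff {n : ℕ} {b : B} {g : Σ n, ColPerm B n} :
    recTab g = recTab ⟨n, ⟨fun _ => b, 1⟩⟩ ↔ g = ⟨n, ⟨fun _ => b, 1⟩⟩ := by
  refine ⟨fun h => ?_, fun h => by rw [h]⟩
  have hl : (⟨fun _ => b, 1⟩ : ColPerm B n).line = (List.range n).map fun i => (i, b) :=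
    List.ext_getElem (by simp) fun i _ _ => by simp [line]
  obtain ⟨h1, h2⟩ := recTab_eq_iff.1 h
  refine line_injective (eq_of_sub h1 fun c => ?_)
  simp only [hl] at h1 h2 ⊢
  have hs : ∀ v : List (ℕ × B), (∀ p ∈ v, p.2 = b) → sub b v = v.map Prod.fst := fun v hv => by
    rw [sub, List.filter_eq_self.2]
    simpa using hv
  have hr : sub b ((List.range n).map fun i => (i, b)) = List.range n := by
    rw [hs _ (by simp), List.map_map]
    simp [Function.comp_def]
  by_cases hc : c = b
  · subst hc
    have h3 := h2 c
    rw [hr] at h3 ⊢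
    have hsort : (sub c g.2.line).Pairwise (· ≤ ·) := by
      rw [← rowsFrom_pairwise_iff (t := []) trivial]
      change (rows _).Pairwise _
      rw [h3]
      exact (rowsFrom_pairwise_iff (t := []) trivial).2 List.pairwise_le_range
    have hn : g.1 = n := by simpa using congrArg List.length h1
    refine List.Perm.eq_of_pairwise' hsort List.pairwise_le_range ?_
    rw [hs, ← hn]
    · exact map_fst_line_perm g.2
    · intro p hp
      have := List.mem_map_of_mem (f := Prod.snd) hp
      rw [h1] at this
      simp only [List.map_map, List.mem_map, Function.comp_apply, exists_and_right] at this
      exact this.2.symm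
  · have h3 : sub c ((List.range n).map fun i => (i, b)) = [] := by
      simp [sub, List.filter_eq_nil_iff, Ne.symm hc]
    rw [h3]
    have h4 := congrArg List.length (h2 c)
    rw [h3] at h4
    simpa using h4

theorem y_eq_t (n : ℕ) (b : B) : y K n b = t K (recTab ⟨n, ⟨fun _ => b, 1⟩⟩) := by
  classical
  refine ext_co fun g => ?_
  rw [co_t, y, co_of]
  exact if_congr (by rw [recTab_eq_one_iff, eq_comm]) rfl rfl

theorem y_mem (n : ℕ) (b : B) : y K n b ∈ coplactic K B := y_eq_t (K := K) n b ▸ t_mem _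

theorem thetaMap_y (n : ℕ) (b : B) :
    thetaMap K B (y K n b) = ColSym.single K b (SymFun.h K n) := by
  have hl : (⟨fun _ => b, 1⟩ : ColPerm B n).line = (List.range n).map fun i => (i, b) :=
    List.ext_getElem (by simp) fun i _ _ => by simp [line]
  rw [y_eq_t, thetaMap_t, ColSym.schur, Finset.prod_eq_single b]
  · rw [SymFun.schur_of_rowLen K (n := n)]
    intro i
    have hr : sub b ((List.range n).map fun i => (i, b)) = List.range n := by
      simp [sub, List.filter_map, Function.comp_def]
    rw [← getD_rowLens, rowLens_shape, getD_shape_ins, hl, hr,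
      rows_eq_replicate_iff.2 ⟨List.length_range, List.pairwise_le_range⟩, List.count_replicate]
    cases i <;> simp
  · intro c _ hc
    rw [SymFun.schur_of_rowLen K (n := 0), SymFun.h_zero, map_one]
    intro i
    have hr : sub c ((List.range n).map fun i => (i, b)) = [] := by
      simp [sub, List.filter_eq_nil_iff, Ne.symm hc]
    rw [← getD_rowLens, rowLens_shape, getD_shape_ins, hl, hr]
    simp
  · simp

theorem mantaciReutenauer_le : mantaciReutenauer K B ≤ coplacticAlg K B :=
  Algebra.adjoin_le (by
    rintro _ ⟨n, -, b, rfl⟩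
    exact y_mem n b)

theorem thetaMap_one : thetaMap K B 1 = 1 := by
  classical
  have h0 : ∀ g : Σ n, ColPerm B n, g.1 = 0 → ⟨0, ⟨Fin.elim0, 1⟩⟩ = g := by
    rintro ⟨n, α⟩ rfl
    congr 1
    ext i <;> exact i.elim0
  refine (thetaMap_of (⟨Fin.elim0, 1⟩ : ColPerm B 0)).trans ?_
  rw [if_pos (h0 _ (size_recTab _)), ColSym.schur]
  refine Finset.prod_eq_one fun b _ => ?_
  rw [SymFun.schur_of_rowLen K (n := 0), SymFun.h_zero, map_one]
  intro i
  rw [← getD_rowLens, rowLens_shape]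
  simp [line]

variable (K B) in
/-- The homomorphism of algebras `𝓠(B) → Λ(B)`. -/
def theta : coplacticAlg K B →ₐ[K] ColSym K B :=
  AlgHom.ofLinearMap (thetaMap K B ∘ₗ inc K B)
    thetaMap_one
    fun x y => thetaMap_mul x.2 y.2

theorem theta_apply (x : coplacticAlg K B) : theta K B x = thetaMap K B x := rfl

end

end StdTableau

/-! ### The pairings -/

namespace StdTableau

open RobinsonSchensted ColPerm FQSym

noncomputable section

variable {K B : Type*} [CommRing K] [DecidableEq B]

theorem sub_map_colour {star : B → B} (hstar : Function.Involutive star) (c : B)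
    (v : List (ℕ × B)) : sub c (v.map fun p => (p.1, star p.2)) = sub (star c) v := by
  have h : ∀ b, star b = c ↔ b = star c := fun b =>
    ⟨fun h => by rw [← h, hstar], fun h => by rw [h, hstar]⟩
  simp [sub, List.filter_map, Function.comp_def, h]

variable [Fintype B]

/-- By the Robinson–Schensted correspondence, a coloured permutation is determined by its record
tableaux and by those of its dual, and these can be prescribed as long as the shapes agree. -/
theorem exists_unique_dual {star : B → B} (hstar : Function.Involutive star) (T U : StdTableau B) :
    (∀ g h : Σ n, ColPerm B n, recTab g = U → recTab ⟨g.1, g.2.dual star⟩ = T → recTab h = U →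
      recTab ⟨h.1, h.2.dual star⟩ = T → g = h) ∧
    ((∃ g : Σ n, ColPerm B n, recTab g = U ∧ recTab ⟨g.1, g.2.dual star⟩ = T) ↔
      U.shape = fun b => T.shape (star b)) := by
  -- the components of the record tableaux of the dual are insertion tableaux
  have hd : ∀ g : Σ n, ColPerm B n, recTab ⟨g.1, g.2.dual star⟩ = T ↔
      ∀ b, (ins (sub b g.2.line)).map (List.map (· + 1)) = rowList (T.tab (star b)) := fun g => by
    rw [← isRecord_iff_recTab, isRecord_iff, hstar.surjective.forall]
    refine forall_congr' fun b => ?_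
    rw [record_line, word_dual, sub_map_colour hstar, hstar]
  constructor
  · intro g h h1 h2 h3 h4
    rw [hd] at h2 h4
    obtain ⟨h5, h6⟩ := recTab_eq_iff.1 (h1.trans h3.symm)
    refine line_injective (eq_of_sub h5 fun b => ins_rows_injective ?_ (h6 b))
    have h7 := (h2 b).trans (h4 b).symm
    exact (List.map_injective_iff.2 (List.map_injective_iff.2 (add_left_injective 1))) h7
  · constructor
    · rintro ⟨g, rfl, h2⟩
      rw [hd] at h2
      funext b
      apply SymFun.rowLens_injective
      rw [rowLens_shape, ← map_length_rowList (T.tab (star b)), ← h2, List.map_map]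
      simp [Function.comp_def]
    · intro hs
      have ht : ∀ b, (ins (sub (star b) (rep T).2.word)).map (List.map (· + 1)) =
          rowList (T.tab (star b)) := fun b => by
        have h := isRecord_iff_recTab (α := (rep T).2).2 (recTab_rep T)
        rw [← record_line, isRecord_iff.1 h]
      choose w hw1 hw2 using fun b => exists_ins_rows (sub b (rep U).2.line)
        (isTab_ins (sub (star b) (rep T).2.word)) (by
          rw [← rowLens_shape, recTab_rep, hs, ← map_length_rowList (T.tab (star b)), ← ht b,
            List.map_map]
          simp [Function.comp_def])
      obtain ⟨v, hv1, hv2⟩ := exists_sub (w := w) (c := (rep U).2.line.map Prod.snd) fun b => by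
        rw [← length_sub, ← length_rows, hw2, length_rows]
      have hsize : T.size = U.size := by
        rw [size, size, hs]
        exact (Equiv.sum_comp hstar.toPerm fun b => (T.shape b).card).symm
      obtain ⟨α, rfl⟩ := exists_line (n := U.size) (v := v) <| by
        have h1 : (List.range U.size).Perm ((rep T).2.word.map Prod.fst) := by
          rw [← hsize]; exact (map_fst_word_perm (rep T).2).symm
        refine (List.perm_iff_count.2 fun x => ?_).trans h1.symm
        rw [← sum_count_sub, ← sum_count_sub, ← Equiv.sum_comp hstar.toPerm]
        refine Finset.sum_congr rfl fun b _ => ?_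
        rw [hv2, ← (ins_perm _).count_eq, hw1, (ins_perm _).count_eq, hstar.coe_toPerm, hstar]
      refine ⟨⟨U.size, α⟩, ?_, (hd _).2 fun b => ?_⟩
      · refine Eq.trans ?_ (recTab_rep U)
        rw [recTab_eq_iff]
        exact ⟨hv1, fun b => by rw [hv2, hw2]⟩
      · rw [hv2, hw1, ht]

open Classical in
theorem pairing_t {star : B → B} (hstar : Function.Involutive star) (T U : StdTableau B) :
    pairing K star (t K T) (t K U) = if U.shape = fun b => T.shape (star b) then 1 else 0 := by
  obtain ⟨h1, h2⟩ := exists_unique_dual hstar T U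
  have h3 : pairing K star (t K T) (t K U) = ∑ β : ColPerm B U.size with IsRecord β U,
      if recTab ⟨U.size, β.dual star⟩ = T then (1 : K) else 0 := by
    rw [t.eq_def K U, map_sum]
    refine Finset.sum_congr (by congr) fun β _ => ?_
    rw [pairing_of hstar, co_t]
  rw [h3]
  split_ifs with h
  · obtain ⟨⟨n, β₀⟩, h4, h5⟩ := h2.2 h
    obtain rfl : n = U.size := by rw [← h4, size_recTab]
    refine (Finset.sum_eq_single β₀ (fun β hβ hne => if_neg fun h6 => hne ?_)
      fun hβ => absurd ?_ hβ).trans (if_pos h5)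
    · have h7 := h1 _ _ (isRecord_iff_recTab.1 (Finset.mem_filter.1 hβ).2) h6 h4 h5
      exact eq_of_heq (Sigma.mk.inj h7).2
    · exact Finset.mem_filter.2 ⟨Finset.mem_univ _, isRecord_iff_recTab.2 h4⟩
  · exact Finset.sum_eq_zero fun β hβ => if_neg fun h6 =>
      h (h2.1 ⟨_, isRecord_iff_recTab.1 (Finset.mem_filter.1 hβ).2, h6⟩)

variable (K) in
/-- The pairing on `Λ(B)` with `⟨s_λ, s_μ⟩ = 1` if `μ = λ*`, and `0` otherwise. -/
def _root_.ColSym.pair (star : B → B) : LinearMap.BilinForm K (ColSym K B) :=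
  (ColSym.schurBasis K B).constr K fun l => (ColSym.schurBasis K B).coord fun b => l (star b)

theorem _root_.ColSym.pair_schur (star : B → B) (l : B → YoungDiagram) (z : ColSym K B) :
    ColSym.pair K star (ColSym.schur K l) z =
      (ColSym.schurBasis K B).coord (fun b => l (star b)) z := by
  rw [ColSym.pair, ← ColSym.schurBasis_apply, Module.Basis.constr_basis]

open Classical in
theorem _root_.ColSym.pair_schur_schur (star : B → B) (l m : B → YoungDiagram) :
    ColSym.pair K star (ColSym.schur K l) (ColSym.schur K m) =
      if m = fun b => l (star b) then 1 else 0 := by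
  rw [ColSym.pair_schur, ← ColSym.schurBasis_apply, Module.Basis.coord_apply,
    Module.Basis.repr_self, Finsupp.single_apply]

theorem pairing_eq_pair {star : B → B} (hstar : Function.Involutive star) {x y : FQSym K B}
    (hx : x ∈ coplactic K B) (hy : y ∈ coplactic K B) :
    pairing K star x y = ColSym.pair K star (thetaMap K B x) (thetaMap K B y) := by
  induction hx using Submodule.span_induction with
  | zero => simp
  | add x x' _ _ h h' => simp only [map_add, LinearMap.add_apply, h, h']
  | smul c x _ h => simp only [map_smul, LinearMap.smul_apply, h]
  | mem x hx =>
  induction hy using Submodule.span_induction with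
  | zero => simp
  | add y y' _ _ h h' => simp only [map_add, h, h']
  | smul c y _ h => simp only [map_smul, h]
  | mem y hy =>
    obtain ⟨T, rfl⟩ := hx
    obtain ⟨U, rfl⟩ := hy
    rw [pairing_t hstar, thetaMap_t, thetaMap_t, ColSym.pair_schur_schur]

/-- As the pairing of `Λ(B)` is nondegenerate, the kernel of the restriction of `Θ` to a submodule
with full image is the radical of the restriction of `ϖ_tot`. -/
theorem thetaMap_eq_zero_iff {star : B → B} (hstar : Function.Involutive star)
    {N : Submodule K (FQSym K B)} (hN : N ≤ coplactic K B) (hs : N.map (thetaMap K B) = ⊤)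
    {x : FQSym K B} (hx : x ∈ coplactic K B) :
    thetaMap K B x = 0 ↔ x ∈ (pairing K star).orthogonal N := by
  rw [LinearMap.BilinForm.mem_orthogonal_iff]
  constructor
  · intro h y hy
    rw [pairing_eq_pair hstar (hN hy) hx, h, map_zero]
  · intro h
    refine (ColSym.schurBasis K B).ext_elem fun l => ?_
    obtain ⟨y, hy, hy'⟩ : ColSym.schur K (fun b => l (star b)) ∈ N.map (thetaMap K B) := by
      rw [hs]; trivial
    have h1 := h y hy
    rw [pairing_eq_pair hstar (hN hy) hx, hy',
      ColSym.pair_schur] at h1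
    simp only [hstar _] at h1
    rw [map_zero]
    exact h1

end

end StdTableau

/-! ### Compatibility with the coproducts and with the gradings -/

namespace SymFun

noncomputable section

variable {K : Type*} [CommRing K]

theorem cf_h (s : {s : Multiset ℕ // 0 ∉ s}) (n : ℕ) :
    cf K s (h K n) = if s.1.sum = n then 1 else 0 := by
  rw [cf_apply, h, coeff_ofTyp, typ_rep]

theorem comul_h (n : ℕ) : Coalgebra.comul (R := K) (h K n) =
    ∑ k : Fin (n + 1), h K k ⊗ₜ[K] h K (n - k) := by
  refine ext2 fun s u => (cf2_comul s u _).trans ?_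
  rw [map_sum, Fin.sum_univ_eq_sum_range fun k => cf2 s u (h K k ⊗ₜ[K] h K (n - k))]
  simp only [cf2_tmul, cf_h, uni, Multiset.sum_add]
  split_ifs with hn
  · rw [Finset.sum_eq_single s.1.sum, if_pos rfl, if_pos (by omega), one_mul]
    · intro k _ hk
      rw [if_neg hk.symm, zero_mul]
    · intro hs
      rw [Finset.mem_range] at hs
      omega
  · refine (Finset.sum_eq_zero fun k hk => ?_).symm
    rw [Finset.mem_range] at hk
    rw [ite_zero_mul_ite_zero, if_neg (by omega)]

theorem counit_h {n : ℕ} (hn : 1 ≤ n) : Coalgebra.counit (R := K) (h K n) = 0 := by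
  refine (counitHom_eq (h K n)).trans ?_
  rw [cf_h]
  exact if_neg (by simp; omega)

end

end SymFun

namespace StdTableau

open RobinsonSchensted ColPerm FQSym

noncomputable section

variable {K B : Type*} [CommRing K]

theorem comul_y (n : ℕ) (b : B) : Coalgebra.comul (R := K) (y K n b) =
    ∑ k : Fin (n + 1), y K k b ⊗ₜ[K] y K (n - k) b := by
  refine (comulMap_of _).trans (Finset.sum_congr rfl fun k _ => ?_)
  have h1 : (⟨fun _ => b, 1⟩ : ColPerm B n).low k k.is_le = ⟨fun _ => b, 1⟩ :=
    ColPerm.ext rfl (Tuple.sort_eq_refl_iff_monotone.2 fun i j h => h)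
  have h2 : (⟨fun _ => b, 1⟩ : ColPerm B n).high k k.is_le = ⟨fun _ => b, 1⟩ :=
    ColPerm.ext rfl (Tuple.sort_eq_refl_iff_monotone.2 fun i j h => by
      change (k : ℕ) + i ≤ k + j
      exact Nat.add_le_add_left h _)
  rw [h1, h2, y, y]

theorem counit_y {n : ℕ} (hn : 1 ≤ n) (b : B) : Coalgebra.counit (R := K) (y K n b) = 0 :=
  (counitMap_of _).trans (if_neg (by omega))

/-- The unit of the product is adjoint to the counit. -/
theorem pairing_one {star : B → B} (hstar : Function.Involutive star) (x : FQSym K B) :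
    pairing K star 1 x = Coalgebra.counit (R := K) x := by
  classical
  induction x using ind with
  | h0 => simp
  | ha x x' h h' => simp only [map_add, h, h']
  | hs c x h => simp only [map_smul, h]
  | hw n α =>
    rw [pairing_of hstar]
    refine (co_of _ _).trans (Eq.trans ?_ (counitMap_of α).symm)
    refine if_congr ⟨fun h => (congrArg Sigma.fst h).symm, ?_⟩ rfl rfl
    rintro rfl
    congr 1
    ext i <;> exact i.elim0

variable [Fintype B] [DecidableEq B]

/-- The image of the Mantaci-Reutenauer algebra contains the generators of `Λ(B)`. -/
theorem map_mantaciReutenauer :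
    (Subalgebra.toSubmodule (mantaciReutenauer K B)).map (thetaMap K B) = ⊤ := by
  have h : ((mantaciReutenauer K B).comap (coplacticAlg K B).val).map (theta K B) = ⊤ := by
    rw [eq_top_iff, ← ColSym.adjoin_single_h]
    refine Algebra.adjoin_le ?_
    rintro _ ⟨n, hn, b, rfl⟩
    exact ⟨⟨y K n b, y_mem n b⟩, Algebra.subset_adjoin ⟨n, hn, b, rfl⟩, thetaMap_y n b⟩
  rw [eq_top_iff]
  intro z _
  obtain ⟨x, hx, rfl⟩ : z ∈ ((mantaciReutenauer K B).comap (coplacticAlg K B).val).map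
    (theta K B) := by rw [h]; trivial
  exact ⟨x, hx, rfl⟩

theorem map_coplactic : (coplactic K B).map (thetaMap K B) = ⊤ :=
  eq_top_iff.2 (map_mantaciReutenauer.symm.le.trans (Submodule.map_mono mantaciReutenauer_le))

/-- `𝓠(B)` is the sum of `𝓓(B)` and of the kernel of `Θ`, because `Θ` is already surjective on
`𝓓(B)`. -/
theorem exists_sub_mem_ker (x : coplacticAlg K B) : ∃ d : coplacticAlg K B,
    (d : FQSym K B) ∈ mantaciReutenauer K B ∧ theta K B (x - d) = 0 := by
  obtain ⟨d, hd, hd'⟩ : theta K B x ∈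
      (Subalgebra.toSubmodule (mantaciReutenauer K B)).map (thetaMap K B) := by
    rw [map_mantaciReutenauer]; trivial
  exact ⟨⟨d, mantaciReutenauer_le hd⟩, hd, by rw [map_sub, sub_eq_zero, ← hd', theta_apply]⟩

/-- Two algebra homomorphisms on the coplactic algebra that agree on the elements `y_{n,b}` and
vanish on the kernel of `Θ` are equal. -/
theorem algHom_ext {A : Type*} [Ring A] [Algebra K A] {F G : coplacticAlg K B →ₐ[K] A}
    (hy : ∀ n, 1 ≤ n → ∀ b, F ⟨y K n b, y_mem n b⟩ = G ⟨y K n b, y_mem n b⟩)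
    (hF : ∀ x, theta K B x = 0 → F x = 0) (hG : ∀ x, theta K B x = 0 → G x = 0) : F = G := by
  have h1 : mantaciReutenauer K B ≤ (AlgHom.equalizer F G).map (coplacticAlg K B).val :=
    Algebra.adjoin_le (by
      rintro _ ⟨n, hn, b, rfl⟩
      exact ⟨⟨y K n b, y_mem n b⟩, hy n hn b, rfl⟩)
  refine AlgHom.ext fun x => ?_
  obtain ⟨d, hd, hx⟩ := exists_sub_mem_ker x
  obtain ⟨d', hd', e⟩ := h1 hd
  obtain rfl : d' = d := Subtype.ext e
  rw [← sub_add_cancel x d', map_add, map_add, hF _ hx, hG _ hx, hd']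

/-- `Θ` is compatible with the counits; on the kernel of `Θ`, the counit vanishes because it is the
pairing with `1`. -/
theorem counit_comp_theta :
    (Bialgebra.counitAlgHom K (ColSym K B)).comp (theta K B) =
      Bialgebra.counitAlgHom K (coplacticAlg K B) := by
  refine algHom_ext (fun n hn b => ?_) (fun x hx => ?_) fun x hx => ?_
  · change Coalgebra.counit (thetaMap K B (y K n b)) = Coalgebra.counit (R := K) (y K n b)
    rw [thetaMap_y, counit_y hn]
    exact (ColSym.counitHom_single_apply b _).trans (SymFun.counit_h hn)
  · rw [AlgHom.comp_apply, hx, map_zero]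
  · change Coalgebra.counit (R := K) (x : FQSym K B) = 0
    rw [← pairing_one (star := id) (fun _ => rfl), pairing_eq_pair (fun _ => rfl)
      (one_mem_coplactic) x.2, ← theta_apply x, hx, map_zero]

/-- By the adjointness of the product and the coproduct, the coordinates of `(Θ ⊗ Θ)(Δ x)` are the
values of the pairing of `x` with products of elements of `𝓠(B)`; if `Θ x = 0`, then `x` is
orthogonal to these products. As `Θ` does not depend on the involution, the trivial one can be
used. -/
theorem map_theta_comul_eq_zero {x : coplacticAlg K B} (hx : theta K B x = 0) :
    TensorProduct.map (theta K B).toLinearMap (theta K B).toLinearMap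
      (Coalgebra.comul (R := K) x) = 0 := by
  refine ((ColSym.schurBasis K B).tensorProduct (ColSym.schurBasis K B)).ext_elem
    fun ⟨l, m⟩ => ?_
  have key : ∀ l : B → YoungDiagram, ∃ a ∈ coplactic K B, ∀ w : coplacticAlg K B,
      (ColSym.schurBasis K B).coord l (theta K B w) = pairing K id a w := fun l => by
    obtain ⟨a, ha, ha'⟩ : ColSym.schur K l ∈ (coplactic K B).map (thetaMap K B) := by
      rw [map_coplactic]; trivial
    exact ⟨a, ha, fun w => by
      rw [pairing_eq_pair (fun _ => rfl) ha w.2, ha', ColSym.pair_schur, theta_apply]; rfl⟩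
  obtain ⟨a, ha, hl⟩ := key l
  obtain ⟨c, hc, hm⟩ := key m
  have h1 : ∀ z, ((ColSym.schurBasis K B).tensorProduct (ColSym.schurBasis K B)).repr
      (TensorProduct.map (theta K B).toLinearMap (theta K B).toLinearMap z) (l, m) =
      LinearMap.mul' K K (TensorProduct.map (pairing K id a) (pairing K id c)
        (TensorProduct.map (inc K B) (inc K B) z)) := fun z => by
    induction z using TensorProduct.induction_on with
    | zero => simp
    | add z z' h h' => simp only [map_add, Finsupp.add_apply, h, h']
    | tmul v w =>
      have hv := hl v
      have hw := hm w
      rw [Module.Basis.coord_apply] at hv hw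
      simp [Module.Basis.tensorProduct_repr_tmul_apply, hv, hw, mul_comm]
  rw [h1, map_inc_comul, ← pairing_mul (fun _ => rfl), pairing_eq_pair (fun _ => rfl)
    (mul_mem_coplactic ha hc) x.2, ← theta_apply x, hx, map_zero, map_zero, Finsupp.zero_apply]

/-- `Θ` is compatible with the coproducts. Both sides are homomorphisms of algebras, so that it
suffices to compare them at the elements `y_{n,b}` and on the kernel of `Θ`. -/
theorem map_theta_comp_comul :
    (Algebra.TensorProduct.map (theta K B) (theta K B)).comp
        (Bialgebra.comulAlgHom K (coplacticAlg K B)) =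
      (Bialgebra.comulAlgHom K (ColSym K B)).comp (theta K B) := by
  refine algHom_ext (fun n hn b => ?_) (fun x hx => map_theta_comul_eq_zero hx) fun x hx => ?_
  · have h1 : Coalgebra.comul (R := K) (⟨y K n b, y_mem n b⟩ : coplacticAlg K B) =
        ∑ k : Fin (n + 1), ⟨y K k b, y_mem k b⟩ ⊗ₜ[K] ⟨y K (n - k) b, y_mem (n - k) b⟩ := by
      apply inc2_injective
      rw [map_inc_comul, comul_y, map_sum]
      rfl
    have h2 : Coalgebra.comul (R := K) (ColSym.single K b (SymFun.h K n)) =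
        ∑ k : Fin (n + 1), ColSym.single K b (SymFun.h K k) ⊗ₜ[K]
          ColSym.single K b (SymFun.h K (n - k)) := by
      refine (ColSym.comulHom_single_apply b _).trans ?_
      rw [SymFun.comul_h, map_sum]
      rfl
    change TensorProduct.map (theta K B).toLinearMap (theta K B).toLinearMap
      (Coalgebra.comul (R := K) (⟨y K n b, y_mem n b⟩ : coplacticAlg K B)) =
      Coalgebra.comul (R := K) (thetaMap K B (y K n b))
    rw [h1, map_sum, thetaMap_y, h2]
    refine Finset.sum_congr rfl fun k _ => ?_
    rw [TensorProduct.map_tmul, ← thetaMap_y, ← thetaMap_y]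
    rfl
  · rw [AlgHom.comp_apply, hx, map_zero]

theorem thetaMap_mem_deg {n : ℕ} {x : FQSym K B} (hx : x ∈ FQSym.deg K B n) :
    thetaMap K B x ∈ ColSym.deg K B n := by
  classical
  induction hx using Submodule.span_induction with
  | zero => rw [map_zero]; exact zero_mem _
  | add x y _ _ h h' => rw [map_add]; exact add_mem h h'
  | smul c x _ h => rw [map_smul]; exact Submodule.smul_mem _ _ h
  | mem x hx =>
    obtain ⟨α, rfl⟩ := hx
    simp only [thetaMap_of]
    split_ifs
    · have h := ColSym.schur_mem_deg (K := K) (recTab ⟨n, α⟩).shape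
      have e : ∑ b, ((recTab ⟨n, α⟩).shape b).card = n := size_recTab ⟨n, α⟩
      rwa [e] at h
    · exact zero_mem _

theorem coplactic_eq_iSup : coplactic K B = ⨆ n, coplactic K B ⊓ FQSym.deg K B n := by
  refine le_antisymm (Submodule.span_le.2 ?_) (iSup_le fun n => inf_le_left)
  rintro _ ⟨T, rfl⟩
  refine Submodule.mem_iSup_of_mem T.size ⟨t_mem T, ?_⟩
  exact sum_mem fun α _ => Submodule.subset_span ⟨α, rfl⟩

end

end StdTableau

theorem mainTheorem3 (K : Type*) [CommRing K] (B : Type*) [Fintype B] [DecidableEq B]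
    (star : B → B) (hstar : Function.Involutive star) :
    -- `𝓠(B)` is a graded subbialgebra of `𝓕(K B)`, and `Θ : 𝓠(B) → Λ(B)` is a morphism of bialgebras
    ∃ (Q : Subalgebra K (FQSym K B)) (_ : Coalgebra K Q) (incl : Q →ₐc[K] FQSym K B)
      (Θ : Q →ₐc[K] ColSym K B) (pair : LinearMap.BilinForm K (ColSym K B)),
      Subalgebra.toSubmodule Q = StdTableau.coplactic K B ∧
      (∃ Δ : Q →ₐ[K] Q ⊗[K] Q, ∀ x, Δ x = Coalgebra.comul (R := K) x) ∧
      (∃ ε : Q →ₐ[K] K, ∀ x, ε x = Coalgebra.counit (R := K) x) ∧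
      (∀ x : Q, incl x = (x : FQSym K B)) ∧
      StdTableau.coplactic K B = ⨆ n, StdTableau.coplactic K B ⊓ FQSym.deg K B n ∧
      (∀ (T : StdTableau B) (x : Q), (x : FQSym K B) = StdTableau.t K T →
        Θ x = ColSym.schur K T.shape) ∧
      (∀ (n : ℕ) (x : Q), (x : FQSym K B) ∈ FQSym.deg K B n → Θ x ∈ ColSym.deg K B n) ∧
      Function.Surjective Θ ∧
      (∀ x : Q, Θ x = 0 ↔
        (x : FQSym K B) ∈ (FQSym.pairing K star).orthogonal (StdTableau.coplactic K B)) ∧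
      -- `pair` is the pairing `⟨s_λ, s_μ⟩ = δ_{μ, λ*}` on `Λ(B)`, and `Θ` is compatible with it
      (∀ l m : B → YoungDiagram, pair (ColSym.schur K l) (ColSym.schur K m) =
        (open Classical in if m = fun b => l (star b) then 1 else 0)) ∧
      (∀ x y : Q, FQSym.pairing K star (x : FQSym K B) (y : FQSym K B) = pair (Θ x) (Θ y)) ∧
      -- the restriction `θ` of `Θ` to `𝓓(B)`
      ∃ (hD : FQSym.mantaciReutenauer K B ≤ Q)
        (θ : FQSym.mantaciReutenauer K B →ₐ[K] ColSym K B),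
        (∀ x, θ x = Θ ⟨x, hD x.2⟩) ∧
        (∀ n : ℕ, 1 ≤ n → ∀ (b : B) (x : FQSym.mantaciReutenauer K B),
          (x : FQSym K B) = FQSym.y K n b → θ x = ColSym.single K b (SymFun.h K n)) ∧
        (∀ θ' : FQSym.mantaciReutenauer K B →ₐ[K] ColSym K B,
          (∀ n : ℕ, 1 ≤ n → ∀ (b : B) (x : FQSym.mantaciReutenauer K B),
            (x : FQSym K B) = FQSym.y K n b → θ' x = ColSym.single K b (SymFun.h K n)) →
          θ' = θ) ∧
        Function.Surjective θ ∧
        (∀ x : FQSym.mantaciReutenauer K B, θ x = 0 ↔ (x : FQSym K B) ∈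
          (FQSym.pairing K star).orthogonal
            (Subalgebra.toSubmodule (FQSym.mantaciReutenauer K B))) := by
  have hD := StdTableau.mantaciReutenauer_le (K := K) (B := B)
  have hinc : (Algebra.TensorProduct.map (StdTableau.coplacticAlg K B).val
      (StdTableau.coplacticAlg K B).val).comp
        (Bialgebra.comulAlgHom K (StdTableau.coplacticAlg K B)) =
      (Bialgebra.comulAlgHom K (FQSym K B)).comp (StdTableau.coplacticAlg K B).val :=
    AlgHom.ext fun x => StdTableau.map_inc_comul x
  have hker {N : Submodule K (FQSym K B)} (hN : N ≤ StdTableau.coplactic K B)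
      (hs : N.map (StdTableau.thetaMap K B) = ⊤) {x : FQSym K B}
      (hx : x ∈ StdTableau.coplactic K B) := StdTableau.thetaMap_eq_zero_iff hstar hN hs hx
  have hsurj : Function.Surjective
      ((StdTableau.theta K B).comp (Subalgebra.inclusion hD)) := fun z => by
    obtain ⟨d, hd, h⟩ : z ∈ (Subalgebra.toSubmodule (FQSym.mantaciReutenauer K B)).map
        (StdTableau.thetaMap K B) := by rw [StdTableau.map_mantaciReutenauer]; trivial
    exact ⟨⟨d, hd⟩, h⟩
  refine ⟨StdTableau.coplacticAlg K B, inferInstance,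
    BialgHom.ofAlgHom (StdTableau.coplacticAlg K B).val rfl hinc,
    BialgHom.ofAlgHom (StdTableau.theta K B) StdTableau.counit_comp_theta
      StdTableau.map_theta_comp_comul, ColSym.pair K star, rfl,
    ⟨Bialgebra.comulAlgHom K _, fun _ => rfl⟩, ⟨Bialgebra.counitAlgHom K _, fun _ => rfl⟩,
    fun _ => rfl, StdTableau.coplactic_eq_iSup, fun T x hx => ?_,
    fun n x hx => StdTableau.thetaMap_mem_deg hx, fun z => ?_,
    fun x => hker le_rfl StdTableau.map_coplactic x.2, ColSym.pair_schur_schur star,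
    fun x y => StdTableau.pairing_eq_pair hstar x.2 y.2, hD,
    (StdTableau.theta K B).comp (Subalgebra.inclusion hD), fun _ => rfl, ?_, ?_, hsurj,
    fun x => hker hD StdTableau.map_mantaciReutenauer (hD x.2)⟩
  · change StdTableau.thetaMap K B x = _
    rw [hx, StdTableau.thetaMap_t]
  · obtain ⟨d, hd⟩ := hsurj z
    exact ⟨_, hd⟩
  · intro n _ b x hx
    change StdTableau.thetaMap K B x = _
    rw [hx, StdTableau.thetaMap_y]
  · intro θ' h
    refine AlgHom.adjoin_ext fun x hx => ?_
    obtain ⟨n, hn, b, rfl⟩ := hx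
    exact (h n hn b _ rfl).trans (StdTableau.thetaMap_y n b).symm
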